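/- Let $d\ge 3$ and let $\mathbb T_d$ be the infinite $d$-regular tree; $N(x)$ is the set of neighbours of $x$ and $\mathrm{dist}$ is the graph distance. Fix a root $o$; a vertex $x$ is odd if $\mathrm{dist}(o,x)$ is odd. The minus-biased vote process with noise $\epsilon\in(0,1)$ starts from $\sigma_x(0)=1$ for all $x$. At each time $t\ge 1$, independently over all vertices and times, each vertex $x$ is updated as follows: with probability $1-\epsilon$, $\sigma_x(t)=-1$ if $|\{y\in N(x):\sigma_y(t-1)=-1\}|\ge 2$ and $\sigma_x(t)=1$ otherwise; with probability $\epsilon$, $\sigma_x(t)$ is $-1$ or $1$ with probability one half each. A finite non-empty set of odd vertices is an odd cluster if it is connected for the relation $\mathrm{dist}(x,y)=2$. Two disjoint odd sets $A,B$ are adjacent if $\min_{x\in A,y\in B}\mathrm{dist}(x,y)=2$. For a finite vertex set $A$ and $3\le p\le d$, let $\mathrm{STri}(A,p)$ be the number of vertices $x$ with $|N(x)\cap A|=p$, and let $\mathrm{DTri}(A,p)$ be the number of vertices $x$ for which there is $Y\subset N(x)$ with $|Y|=p$ and $N(y)\cap(A\setminus\{x\})\ne\emptyset$ for all $y\in Y$.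 Put $$\mathrm{STri}(A)=\sum_{p=3}^d(p-2)\,\mathrm{STri}(A,p),\qquad \mathrm{DTri}(A)=\sum_{p=3}^d(p-2)\,\mathrm{DTri}(A,p).$$ Theorem. For every $d\ge 3$ there exist constants $c_1,c_2,c_3>1$ and $\epsilon_0>0$, depending only on $d$, such that the following holds for every $\epsilon\in(0,1)$ with $\epsilon<\epsilon_0$ and every time $t\ge 0$. If $A$ is a disjoint union of pairwise non-adjacent odd clusters $A_1,\dots,A_k$, $k\ge1$, then $$\mathbb P\big(\sigma_x(t)=-1\text{ for all }x\in A\big)\le\prod_{i=1}^k\Big[\Big(\frac{\epsilon}{2}\Big)^{|A_i|}+c_1\,\epsilon^{|A_i|+1}\,c_2^{\mathrm{STri}(A_i)}\,c_3^{\mathrm{DTri}(A_i)}\Big].$$ -/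

import Mathlib

namespace MinusBiasedVote

/-! ### Vertices, double neighbours, clusters -/

section Graph

variable {V : Type*} (G : SimpleGraph V)

/-- The graph joining two vertices exactly when they are double neighbours, i.e. at graph
distance `2` in `G`. -/
def doubleNeighborGraph : SimpleGraph V where
  Adj x y := G.dist x y = 2
  symm := ⟨fun x y h => by rw [SimpleGraph.dist_comm]; exact h⟩
  loopless := ⟨fun x h => by simp [SimpleGraph.dist_self] at h⟩

/-- The odd vertices, for the bipartition of `G` seen from the base vertex `o`. -/
def IsOddVertex (o x : V) : Prop := Odd (G.dist o x)

/-- A set of odd vertices that is connected (in particular non-empty) for the double-neighbouring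
relation. -/
def IsOddCluster (o : V) (A : Set V) : Prop :=
  (∀ x ∈ A, IsOddVertex G o x) ∧ ((doubleNeighborGraph G).induce A).Connected

/-- The distance between two vertex sets; the minimum of the distances when both are non-empty. -/
noncomputable def setDist (A B : Set V) : ℕ :=
  sInf {n | ∃ x ∈ A, ∃ y ∈ B, G.dist x y = n}

/-- Adjacency of two disjoint sets of odd vertices. -/
def AdjacentSets (A B : Set V) : Prop := setDist G A B = 2

/-! ### Trifurcations -/

/-- `x` is a type `p` single trifurcation of `A`: exactly `p` neighbours of `x` lie in `A`. -/
def IsSingleTrifurcation (A : Set V) (p : ℕ) (x : V) : Prop :=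
  (G.neighborSet x ∩ A).encard = p

/-- `x` is a type `p` double trifurcation of `A`: some `p` neighbours of `x` each have a neighbour
in `A` other than `x`. -/
def IsDoubleTrifurcation (A : Set V) (p : ℕ) (x : V) : Prop :=
  ∃ Y : Finset V, (Y : Set V) ⊆ G.neighborSet x ∧ Y.card = p ∧
    ∀ y ∈ Y, (G.neighborSet y ∩ (A \ {x})).Nonempty

/-- `STri(A) = ∑_{p=3}^d (p-2) STri(A,p)`, where `STri(A,p)` is the number of type `p` single
trifurcations of `A`. -/
noncomputable def STri (d : ℕ) (A : Set V) : ℕ :=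
  ∑ p ∈ Finset.Icc 3 d, (p - 2) * {x | IsSingleTrifurcation G A p x}.ncard

/-- `DTri(A) = ∑_{p=3}^d (p-2) DTri(A,p)`, where `DTri(A,p)` is the number of type `p` double
trifurcations of `A`. -/
noncomputable def DTri (d : ℕ) (A : Set V) : ℕ :=
  ∑ p ∈ Finset.Icc 3 d, (p - 2) * {x | IsDoubleTrifurcation G A p x}.ncard

end Graph

/-! ### The minus biased vote process -/

/-- What happens at one vertex at one time: a minus bias (vote) update, or a noise update that sets
the spin to the given value. Spins are elements of `ℤˣ = {-1, 1}`. -/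
inductive Update where
  | vote : Update
  | noise : ℤˣ → Update

instance : MeasurableSpace Update := ⊤

/-- The law of a single update: a vote with probability `1 - ε`, a noise update with probability
`ε`, whose value is `-1` or `1` with probability one half each. -/
noncomputable def updateLaw (ε : ℝ) : MeasureTheory.Measure Update :=
  ENNReal.ofReal (1 - ε) • MeasureTheory.Measure.dirac Update.vote
    + ENNReal.ofReal (ε / 2) • MeasureTheory.Measure.dirac (Update.noise (-1))
    + ENNReal.ofReal (ε / 2) • MeasureTheory.Measure.dirac (Update.noise 1)

/-- For a noise parameter in `[0, 1]` the law of an update is a probability measure (so that the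
product measure below is the genuine one). -/
theorem isProbabilityMeasure_updateLaw {ε : ℝ} (h0 : 0 ≤ ε) (h1 : ε ≤ 1) :
    MeasureTheory.IsProbabilityMeasure (updateLaw ε) := by
  constructor
  simp only [updateLaw, MeasureTheory.Measure.coe_add, MeasureTheory.Measure.coe_smul,
    Pi.add_apply, Pi.smul_apply, MeasureTheory.measure_univ, smul_eq_mul, mul_one]
  rw [← ENNReal.ofReal_add (by linarith) (by linarith),
    ← ENNReal.ofReal_add (by linarith) (by linarith),
    show 1 - ε + ε / 2 + ε / 2 = 1 by ring, ENNReal.ofReal_one]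

/-- The joint law of the updates: independent over all (time, vertex) pairs. -/
noncomputable def processLaw (V : Type*) (ε : ℝ) : MeasureTheory.Measure (ℕ × V → Update) :=
  MeasureTheory.Measure.infinitePi (fun _ => updateLaw ε)

open Classical in
/-- The minus biased vote process on `G` started from all plus, as a function of the updates `ω`:
`spin G ω t x` is the spin of `x` at time `t`, and `ω (t, x)` is the update at `x` at time `t ≥ 1`.
A vote update makes the spin `-1` if at least two neighbours have spin `-1` at the previous time,
and `1` otherwise. -/
noncomputable def spin {V : Type*} (G : SimpleGraph V) (ω : ℕ × V → Update) : ℕ → V → ℤˣ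
  | 0 => fun _ => 1
  | t + 1 => fun x =>
    match ω (t + 1, x) with
    | Update.vote => if 2 ≤ {y ∈ G.neighborSet x | spin G ω t y = -1}.encard then -1 else 1
    | Update.noise s => s

/-- The probability that all vertices of `A` have spin `-1` at time `t`. -/
noncomputable def probMinus {V : Type*} (G : SimpleGraph V) (ε : ℝ) (t : ℕ) (A : Set V) : ℝ :=
  (processLaw V ε).real {ω | ∀ x ∈ A, spin G ω t x = -1}

end MinusBiasedVote

/-!
The proof is by induction on time: at every time, the probability that all clusters of a family are
minus is at most the product of the bounds `clusterBound`, where two clusters of a family have no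
common neighbour (`IsFamily`; `probMinus_family_le`). The number `c₁ ε` is written `κ`, so that the
bound for a cluster `C` is `(ε / 2) ^ |C| + κ ε ^ |C| c₂ ^ e c₃ ^ q`. Here
`e = excess G 2 (nbhd G C) C` and `q = branchExcess G C` only count trifurcations at neighbours and
at vertices of `C`; they are at most `STri` and `DTri` (`excess_le_STri`, `branchExcess_le_DTri`).
The first term stands for a cluster that is minus by noise alone, and a cluster for which the second
term is taken is called voted.

Given the set `U` of minus vertices at time `t`, the vertices of `A` are minus at time `t + 1`
independently, with probability `1 - ε / 2` or `ε / 2` according as they have at least two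
neighbours in `U` or not. What remains is a finite inequality between sums over `U` (`minusSum`),
the distribution of `U` being controlled through the families of clusters it contains
(`FamilyBound`).

*Rooting.* Take a leaf `x` of a cluster `C` of `A`. If no neighbour of `x` is in `U`, then `x` is
minus by noise, which costs `ε / 2`, and `C` loses the vertex `x`. Otherwise `C` has a neighbour
in `U`, and is rooted there. The second case has to be shown to cost
`ε ^ (|C| + 1) c₂ ^ e c₃ ^ q` up to a constant, that is, an additional factor `ε`. Geometric
summation over the leaves then gives the two terms of the bound (`pending_bound`).

*Exploration.* For rooted clusters the vertices `x` are examined one after another, those farthest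
from the root first. The states of the children of `x` that have further neighbours in `A` are then
known, the state of the parent is decided now, and of the other children only those needed for two
minus votes are asked to be minus. In the end a set `D` of neighbours of `A` is demanded to be
minus, and the induction hypothesis bounds its probability by a product over the clusters of `D`.
Expanding this product amounts to choosing a set `M` of vertices of `D` in voted clusters
(`siteWeight`). Every price `κ` is to be paid once per cluster and not once per vertex of `M`; this
is repaired at the vertices `x` with several neighbours in `M`, which join them (`joinWeight`).
With suitable weights for the vertices on the boundary of the explored region (`frontWeight`), each
vertex of `A` multiplies the bound by at most `ε`, without any loss of a constant if the cluster
does not branch there (`update_new`); this exactness is where the factor `1 - ε / 2` enters. At the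
irregular vertices a power of a constant `K` is lost (`exploration_bound`), and these are
controlled by the trifurcations of `A` (`sum_irregularity_le`).

*Accounting.* A cluster `C` has at most `1 + ∑ (deg - 1)` vertices, the sum being over its
neighbours (`IsConn.card_le`), so the joins at the vertices of `A` account for all vertices of the
voted clusters beyond the first ones, except for links through vertices outside `A`. In a tree
such links use roots, at most one each (`IsRooted.excess_sdiff_le`); this requires the top vertex of
a cluster either to be the root or to be known to be plus. The trifurcations of the voted clusters
are paid by the joins and by those of `A` in the same way (`IsRooted.terminal_bound`). Every root
contributes a factor `ε` times a constant depending only on `d`, and `c₁` is chosen larger than this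
constant.
-/

namespace MinusBiasedVote

set_option linter.unusedSectionVars false

open Finset

/-! ### Trees seen from a root -/

section Tree

variable {V : Type*} {G : SimpleGraph V}

theorem dist_parent_or_child (hG : G.IsTree) (r : V) {v u : V} (h : G.Adj v u) :
    G.dist r u + 1 = G.dist r v ∨ G.dist r u = G.dist r v + 1 := by
  rcases hG.dist_eq_dist_add_one_of_adj r h with h | h <;> omega

theorem parent_unique (hG : G.IsTree) (r : V) {v u u' : V} (hu : G.Adj v u) (hu' : G.Adj v u')
    (h : G.dist r u + 1 = G.dist r v) (h' : G.dist r u' + 1 = G.dist r v) : u = u' := by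
  obtain ⟨p, hp⟩ := hG.1.exists_walk_length_eq_dist r u
  obtain ⟨q, hq⟩ := hG.1.exists_walk_length_eq_dist r u'
  have hp' : (p.concat hu.symm).IsPath :=
    SimpleGraph.Walk.isPath_of_length_eq_dist _ (by rw [SimpleGraph.Walk.length_concat]; omega)
  have hq' : (q.concat hu'.symm).IsPath :=
    SimpleGraph.Walk.isPath_of_length_eq_dist _ (by rw [SimpleGraph.Walk.length_concat]; omega)
  have := (hG.2.subsingleton_path r v).elim ⟨_, hp'⟩ ⟨_, hq'⟩
  have h2 := congrArg (fun w : G.Path r v => w.1.penultimate) this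
  simpa using h2

theorem exists_parent (hG : G.IsTree) {r v : V} (h : v ≠ r) :
    ∃ u, G.Adj v u ∧ G.dist r u + 1 = G.dist r v := by
  obtain ⟨p, hp⟩ := hG.1.exists_walk_length_eq_dist v r
  cases p with
  | nil => exact absurd rfl h
  | @cons _ u _ hu p =>
    refine ⟨u, hu, ?_⟩
    rw [SimpleGraph.Walk.length_cons] at hp
    have h1 : G.dist u r ≤ p.length := SimpleGraph.dist_le p
    rw [G.dist_comm (u := r) (v := u), G.dist_comm (u := r) (v := v)]
    have := dist_parent_or_child hG r hu
    rw [G.dist_comm (u := r) (v := u), G.dist_comm (u := r) (v := v)] at this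
    omega

open Classical in
/-- The parent of `v` in the tree `G` rooted at `r`, i.e. the neighbour of `v` closer to `r`;
by convention the root is its own parent. -/
noncomputable def parent (G : SimpleGraph V) (r v : V) : V :=
  if h : ∃ u, G.Adj v u ∧ G.dist r u + 1 = G.dist r v then h.choose else v

theorem parent_spec (hG : G.IsTree) {r v : V} (h : v ≠ r) :
    G.Adj v (parent G r v) ∧ G.dist r (parent G r v) + 1 = G.dist r v := by
  have h' := exists_parent hG h
  rw [parent, dif_pos h']
  exact h'.choose_spec

theorem parent_eq (hG : G.IsTree) {r v u : V} (hu : G.Adj v u)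
    (h : G.dist r u + 1 = G.dist r v) : parent G r v = u := by
  have hv : v ≠ r := by
    rintro rfl
    simp at h
  exact parent_unique hG r (parent_spec hG hv).1 hu (parent_spec hG hv).2 h

/-- The vertices `z` whose geodesic to `r` passes through `a` are closed under taking neighbours,
except at `a` itself: a subtree can only be left through its root. -/
theorem descendant_step (hG : G.IsTree) {r a z m : V}
    (hz : G.dist r z = G.dist r a + G.dist a z) (hzm : G.Adj z m) (hza : z ≠ a) :
    G.dist r m = G.dist r a + G.dist a m := by
  obtain ⟨u, hu, hua⟩ := exists_parent hG hza
  have h1 : G.dist r u ≤ G.dist r a + G.dist a u := hG.1.dist_triangle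
  have h2 : G.dist r m ≤ G.dist r a + G.dist a m := hG.1.dist_triangle
  have h3 := dist_parent_or_child hG r hu
  have h4 := dist_parent_or_child hG r hzm
  have h5 := dist_parent_or_child hG a hzm
  rcases h4 with h4 | h4
  · have : m = u := parent_unique hG r hzm hu h4 (by omega)
    subst this
    omega
  · omega

end Tree

/-! ### Clusters and their excess -/

section Clusters

variable {V : Type*} [DecidableEq V] (G : SimpleGraph V) [G.LocallyFinite]

/-- The number of neighbours of `x` in `M`. -/
def degIn (M : Finset V) (x : V) : ℕ := (G.neighborFinset x ∩ M).card

/-- The set of all neighbours of vertices of `M`. -/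
def nbhd (M : Finset V) : Finset V := M.biUnion fun x => G.neighborFinset x

/-- The sum over `x ∈ S` of the number of neighbours of `x` in `M` beyond the first `k`. -/
def excess (k : ℕ) (S M : Finset V) : ℕ := ∑ x ∈ S, (degIn G M x - k)

/-- The number of neighbours of `v` that have at least two neighbours in `M`. If `v ∈ M`, this is
the number of directions in which the cluster of `v` continues. -/
def branchDeg (M : Finset V) (v : V) : ℕ := #{y ∈ G.neighborFinset v | 2 ≤ degIn G M y}

/-- The total branching excess of `M` at its own vertices. -/
def branchExcess (M : Finset V) : ℕ := ∑ v ∈ M, (branchDeg G M v - 2)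

/-- `C` is non-empty and connected for the relation of having a common neighbour. Connectedness is
expressed by cuts: a non-empty part of `C` that is closed under this relation is all of `C`. -/
def IsConn (C : Finset V) : Prop :=
  C.Nonempty ∧ ∀ S ⊆ C, S.Nonempty →
    (∀ z ∈ S, ∀ z' ∈ C, ∀ y, G.Adj z y → G.Adj z' y → z' ∈ S) → S = C

variable {G}

@[simp] theorem mem_nbhd {M : Finset V} {v : V} : v ∈ nbhd G M ↔ ∃ x ∈ M, G.Adj x v := by
  simp [nbhd]

theorem nbhd_mono {M M' : Finset V} (h : M ⊆ M') : nbhd G M ⊆ nbhd G M' :=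
  biUnion_subset_biUnion_of_subset_left _ h

theorem nbhd_union (M M' : Finset V) : nbhd G (M ∪ M') = nbhd G M ∪ nbhd G M' := by
  ext; simp [or_and_right, exists_or]

theorem degIn_mono {M M' : Finset V} (h : M ⊆ M') (x : V) : degIn G M x ≤ degIn G M' x :=
  card_le_card (inter_subset_inter_left h)

theorem degIn_pos {M : Finset V} {x : V} : 0 < degIn G M x ↔ ∃ y ∈ M, G.Adj x y := by
  rw [degIn, card_pos, Finset.Nonempty]
  simp [and_comm]

theorem degIn_eq_zero_of_notMem {M : Finset V} {x : V} (h : x ∉ nbhd G M) : degIn G M x = 0 := by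
  by_contra h0
  obtain ⟨y, hy, hxy⟩ := degIn_pos.1 (Nat.pos_of_ne_zero h0)
  exact h (mem_nbhd.2 ⟨y, hy, hxy.symm⟩)

theorem degIn_union_le (M M' : Finset V) (x : V) :
    degIn G (M ∪ M') x ≤ degIn G M x + degIn G M' x := by
  rw [degIn, inter_union_distrib_left]; exact card_union_le _ _

theorem degIn_le_degree (M : Finset V) (x : V) : degIn G M x ≤ G.degree x :=
  (card_le_card inter_subset_left).trans_eq (G.card_neighborFinset_eq_degree x)

theorem branchDeg_le_degree (M : Finset V) (v : V) : branchDeg G M v ≤ G.degree v :=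
  (card_le_card (filter_subset _ _)).trans_eq (G.card_neighborFinset_eq_degree v)

theorem branchDeg_mono {M M' : Finset V} (h : M ⊆ M') (v : V) :
    branchDeg G M v ≤ branchDeg G M' v :=
  card_le_card (monotone_filter_right _ fun _ _ hy => le_trans hy (degIn_mono h _))

theorem excess_mono (k : ℕ) {S S' M M' : Finset V} (hS : S ⊆ S') (hM : M ⊆ M') :
    excess G k S M ≤ excess G k S' M' :=
  (sum_le_sum fun x _ => Nat.sub_le_sub_right (degIn_mono hM x) k).trans
    (sum_le_sum_of_subset hS)

theorem branchExcess_mono {M M' : Finset V} (h : M ⊆ M') : branchExcess G M ≤ branchExcess G M' :=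
  (sum_le_sum fun x _ => Nat.sub_le_sub_right (branchDeg_mono h x) 2).trans
    (sum_le_sum_of_subset h)

/-- A cluster has at most one vertex more than its total excess: adding its vertices one after
another, each new one shares a neighbour with the previous ones. -/
theorem IsConn.card_le {C : Finset V} (hC : IsConn G C) :
    C.card ≤ 1 + excess G 1 (nbhd G C) C := by
  obtain ⟨⟨z₀, hz₀⟩, hconn⟩ := hC
  have key : ∀ n, n + 1 ≤ C.card → ∃ S ⊆ C, S.card = n + 1 ∧ n ≤ excess G 1 (nbhd G C) S := by
    intro n
    induction n with
    | zero => exact fun _ => ⟨{z₀}, by simpa using hz₀, by simp, by simp⟩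
    | succ n ih =>
      intro hn
      obtain ⟨S, hSC, hS, hle⟩ := ih (by omega)
      have hne : S ≠ C := by rintro rfl; omega
      have hSne : S.Nonempty := card_pos.1 (by omega)
      have := mt (hconn S hSC hSne) hne
      push Not at this
      obtain ⟨z, hz, z', hz', y, hzy, hzy', hz'S⟩ := this
      refine ⟨insert z' S, insert_subset hz' hSC, by rw [card_insert_of_notMem hz'S, hS], ?_⟩
      refine Nat.succ_le_of_lt (lt_of_le_of_lt hle ?_)
      refine sum_lt_sum (fun x _ => Nat.sub_le_sub_right (degIn_mono (subset_insert _ _) x) 1)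
        ⟨y, mem_nbhd.2 ⟨z, hSC hz, hzy⟩, ?_⟩
      have h1 : 0 < degIn G S y := degIn_pos.2 ⟨z, hz, hzy.symm⟩
      have h2 : degIn G S y < degIn G (insert z' S) y := by
        refine card_lt_card ⟨inter_subset_inter_left (subset_insert _ _), fun h => ?_⟩
        have := h (mem_inter.2 ⟨(G.mem_neighborFinset y z').2 hzy'.symm, mem_insert_self _ _⟩)
        exact hz'S (mem_inter.1 this).2
      omega
  have hpos : 0 < C.card := card_pos.2 ⟨z₀, hz₀⟩
  obtain ⟨S, hSC, hS, hle⟩ := key (C.card - 1) (by omega)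
  have : S = C := eq_of_subset_of_card_le hSC (by omega)
  subst this
  omega

/-- All distances from a given vertex to the vertices of a cluster have the same parity. -/
theorem IsConn.parity (hG : G.IsTree) {C : Finset V} (hC : IsConn G C) (r : V) {z z' : V}
    (hz : z ∈ C) (hz' : z' ∈ C) : G.dist r z % 2 = G.dist r z' % 2 := by
  have := hC.2 {w ∈ C | G.dist r z % 2 = G.dist r w % 2} (filter_subset _ _)
    ⟨z, by simp [hz]⟩ (by
      intro a ha b hb y hay hby
      have h1 := dist_parent_or_child hG r hay
      have h2 := dist_parent_or_child hG r hby
      rw [mem_filter] at ha ⊢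
      exact ⟨hb, by omega⟩)
  rw [← this] at hz'
  exact (mem_filter.1 hz').2

/-- If a cluster has a vertex in the subtree below `a` (for the root `r`) then, unless it contains
`a` or passes through both `a` and the parent of `a`, it lies entirely in this subtree. -/
theorem IsConn.subset_descendants (hG : G.IsTree) {C : Finset V} (hC : IsConn G C) {r a x : V}
    (hx : x ∈ C) (hxa : G.dist r x = G.dist r a + G.dist a x) (haC : a ∉ C)
    (hpar : ∀ z ∈ C, ∀ z' ∈ C, G.Adj a z → G.Adj a z' →
      G.dist r z = G.dist r a + G.dist a z → G.dist r z' = G.dist r a + G.dist a z') :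
    ∀ z ∈ C, G.dist r z = G.dist r a + G.dist a z := by
  have := hC.2 {w ∈ C | G.dist r w = G.dist r a + G.dist a w} (filter_subset _ _)
    ⟨x, by simp [hx, hxa]⟩ (by
      intro z hz z' hz' y hzy hzy'
      rw [mem_filter] at hz ⊢
      refine ⟨hz', ?_⟩
      have hza : z ≠ a := fun h => haC (h ▸ hz.1)
      have hy := descendant_step hG hz.2 hzy hza
      by_cases hya : y = a
      · subst hya
        exact hpar z hz.1 z' hz' hzy.symm hzy'.symm hz.2
      · exact descendant_step hG hy hzy'.symm hya)
  intro z hz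
  rw [← this] at hz
  exact (mem_filter.1 hz).2

/-- In a cluster rooted at a neighbour `y` of it, the parent of every vertex is either the root or
the child of another vertex of the cluster. -/
theorem IsConn.exists_grandparent (hG : G.IsTree) {C : Finset V} (hC : IsConn G C) {y x : V}
    (hy : y ∈ nbhd G C) (hx : x ∈ C) (hxy : parent G y x ≠ y) :
    ∃ x' ∈ C, G.Adj x' (parent G y x) ∧ parent G y x' ≠ parent G y x := by
  obtain ⟨w, hw, hwy⟩ := mem_nbhd.1 hy
  have hodd : ∀ z ∈ C, G.dist y z % 2 = 1 := fun z hz => by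
    rw [hC.parity hG y hz hw, SimpleGraph.dist_comm, SimpleGraph.dist_eq_one_iff_adj.2 hwy]
  have hx0 : x ≠ y := by
    rintro rfl
    have := hodd x hx
    simp at this
  obtain ⟨h1, h2⟩ := parent_spec hG hx0
  obtain ⟨h3, h4⟩ := parent_spec hG hxy
  set u := parent G y x
  set a := parent G y u
  refine ⟨a, ?_, h3.symm, fun h => ?_⟩
  · by_contra ha
    have hax : G.dist a x ≤ 2 := by
      have := hG.1.dist_triangle (u := a) (v := u) (w := x)
      rw [SimpleGraph.dist_eq_one_iff_adj.2 h3.symm, SimpleGraph.dist_eq_one_iff_adj.2 h1.symm]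
        at this
      omega
    have hxa : G.dist y x = G.dist y a + G.dist a x := by
      have := hG.1.dist_triangle (u := y) (v := a) (w := x)
      omega
    have hoddx := hodd x hx
    have hno : ∀ z ∈ C, ¬ G.Adj a z := fun z hz hza => by
      have := dist_parent_or_child hG y hza
      have := hodd z hz
      omega
    have := hC.subset_descendants hG hx hxa ha (fun z hz z' _ hz1 => absurd hz1 (hno z hz)) w hw
    have hwy' := SimpleGraph.dist_eq_one_iff_adj.2 hwy.symm
    have : G.dist a w = 0 := by omega
    have : a = w := hG.1.dist_eq_zero_iff.1 this
    exact ha (this ▸ hw)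
  · have hay : a ≠ y := by
      intro e
      have := hodd x hx
      rw [e, SimpleGraph.dist_self] at h4
      omega
    have := (parent_spec hG hay).2
    rw [h] at this
    omega

/-- Every cluster has a top, for the tree rooted at `o`: a neighbour of the cluster such that every
other neighbour of the cluster is a child of one of its vertices. -/
theorem IsConn.exists_top (hG : G.IsTree) {C : Finset V} (hC : IsConn G C)
    (hdeg : ∀ v, 0 < G.degree v) (o : V) :
    ∃ top ∈ nbhd G C, ∀ z ∈ nbhd G C, ∀ x ∉ C, G.Adj x z →
      G.dist o z = G.dist o x + 1 → z = top := by
  obtain ⟨w, hw⟩ := hC.1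
  have hne : (nbhd G C).Nonempty := by
    obtain ⟨u, hu⟩ := (G.degree_pos_iff_exists_adj w).1 (hdeg w)
    exact ⟨u, mem_nbhd.2 ⟨w, hw, hu⟩⟩
  obtain ⟨top, htop, hmin⟩ := exists_min_image (nbhd G C) (fun z => G.dist o z) hne
  refine ⟨top, htop, fun z hz x hx hxz hd => ?_⟩
  have hpar : ∀ v ∈ C, G.Adj z v → G.dist o v = G.dist o z + G.dist z v := by
    intro v hv hzv
    rw [SimpleGraph.dist_eq_one_iff_adj.2 hzv]
    rcases dist_parent_or_child hG o hzv with h | h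
    · exact absurd (parent_unique hG o hzv hxz.symm h hd.symm ▸ hv) hx
    · exact h
  obtain ⟨v, hv, hvz⟩ := mem_nbhd.1 hz
  have hoddz : ∀ u ∈ C, G.dist z u % 2 = 1 := fun u hu => by
    rw [hC.parity hG z hu hv, SimpleGraph.dist_eq_one_iff_adj.2 hvz.symm]
  have hzC : z ∉ C := fun h => by simpa using hoddz z h
  have hall := hC.subset_descendants hG hv (hpar v hv hvz.symm) hzC
    (fun _ _ z' hz' _ h _ => hpar z' hz' h)
  obtain ⟨t, ht, htt⟩ := mem_nbhd.1 htop
  have htz : t ≠ z := fun h => hzC (h ▸ ht)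
  have h1 := descendant_step hG (hall t ht) htt htz
  have h2 := hmin z hz
  exact (hG.1.dist_eq_zero_iff.1 (by omega : G.dist z top = 0))

/-- A vertex of a cluster at maximal distance from a neighbour of the cluster can be removed without
disconnecting it. -/
theorem IsConn.exists_leaf (hG : G.IsTree) {C : Finset V} (hC : IsConn G C)
    (hdeg : ∀ v, 0 < G.degree v) :
    ∃ x ∈ C, C = {x} ∨ IsConn G (C.erase x) := by
  obtain ⟨w, hw⟩ := hC.1
  obtain ⟨r, hr⟩ := (G.degree_pos_iff_exists_adj w).1 (hdeg w)
  obtain ⟨x, hx, hmax⟩ := exists_max_image C (fun z => G.dist r z) hC.1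
  refine ⟨x, hx, ?_⟩
  by_cases hcx : C = {x}
  · exact Or.inl hcx
  right
  have hodd : ∀ z ∈ C, G.dist r z % 2 = 1 := fun z hz => by
    rw [hC.parity hG r hz hw, SimpleGraph.dist_eq_one_iff_adj.2 hr.symm]
  have hxr : x ≠ r := by
    rintro rfl
    simpa using hodd x hx
  have hpx := parent_spec hG hxr
  -- every other vertex of the cluster linked to `x` is so through the parent of `x`
  have hlink : ∀ z ∈ C, z ≠ x → ∀ y, G.Adj z y → G.Adj x y → y = parent G r x := by
    intro z hz hzx y hzy hxy
    rcases dist_parent_or_child hG r hxy with h | h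
    · exact parent_unique hG r hxy hpx.1 h hpx.2
    · exfalso
      rcases dist_parent_or_child hG r hzy.symm with h' | h'
      · exact hzx (parent_unique hG r hzy.symm hxy.symm h' h.symm)
      · have := hmax z hz
        omega
  refine ⟨?_, fun S hS hSne hcl => ?_⟩
  · rw [Finset.nonempty_iff_ne_empty]
    intro he
    apply hcx
    have := insert_erase hx
    rw [he] at this
    simpa using this.symm
  have hSC : S ⊆ C := hS.trans (erase_subset _ _)
  have hxS : x ∉ S := fun h => by simpa using hS h
  by_cases hadj : ∃ z ∈ S, G.Adj z (parent G r x)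
  · obtain ⟨z, hz, hzp⟩ := hadj
    have := hC.2 (insert x S) (insert_subset hx hSC) (insert_nonempty _ _) (by
      intro a ha b hb y hay hby
      rw [mem_insert] at ha ⊢
      by_cases hbx : b = x
      · exact Or.inl hbx
      right
      rcases ha with rfl | ha
      · have := hlink b hb hbx y hby hay
        subst this
        exact hcl z hz b (mem_erase.2 ⟨hbx, hb⟩) _ hzp hby
      · exact hcl a ha b (mem_erase.2 ⟨hbx, hb⟩) y hay hby)
    rw [← this, erase_insert hxS]
  · exfalso
    have := hC.2 S hSC hSne (by
      intro a ha b hb y hay hby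
      by_cases hbx : b = x
      · subst hbx
        exfalso
        have hax : a ≠ b := fun h => hxS (h ▸ ha)
        exact hadj ⟨a, ha, hlink a (hSC ha) hax y hay hby ▸ hay⟩
      · exact hcl a ha b (mem_erase.2 ⟨hbx, hb⟩) y hay hby)
    exact hxS (this ▸ hx)

end Clusters

/-! ### Local inequalities for the weights -/

/-- The regime of parameters in which the local inequalities of the expansion hold: `ε` is the noise,
`κ = c₁ ε` the price of a voted cluster of the previous time, `c₂` the price of a single
trifurcation, and `K` the price of an irregular vertex of the explored cluster. -/
structure Regime (d : ℕ) (K ε κ c₂ : ℝ) : Prop where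
  one_le_d : 1 ≤ d
  eps_pos : 0 < ε
  eps_le : 16 * (d : ℝ) ^ 2 * ε ≤ 1
  kappa_pos : 0 < κ
  kappa_le : 24 * (d : ℝ) ^ 2 * κ ≤ 1
  one_le_c : 1 ≤ c₂
  c_eps_le : c₂ * ε ≤ 1
  le_K : 8 * (d : ℝ) ≤ K

/-- The factor of the weight attached to a voting vertex with `k` neighbours in voted clusters: `k`
such neighbours are joined into one cluster, which saves `k - 1` prices `κ`, and they add `k - 2` to
its trifurcation count. -/
noncomputable def joinWeight (κ c₂ : ℝ) (k : ℕ) : ℝ := c₂ ^ (k - 2) / κ ^ (k - 1)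

/-- An upper bound for the total weight of the possible updates of a vertex `x`, when `j` of its
neighbours are known to be minus, `m` of them being in voted clusters, and at most `d` further
neighbours may be minus. If `j ≤ 1`, either `x` is minus by noise or `2 - j` further neighbours
are minus. -/
noncomputable def updateWeight (d : ℕ) (ε κ c₂ : ℝ) (j m : ℕ) : ℝ :=
  if 2 ≤ j then (if m = 0 ∨ m = j then (1 - ε / 2) * joinWeight κ c₂ m else 0)
  else if j = 1 then (if m = 0 then ε / 2 + d * (ε / 2) else ε / 2 + d * ε)
  else ε / 2 + (d : ℝ) ^ 2 * (ε ^ 2 / 4 + ε ^ 2 * κ)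

section Numeric

variable {d : ℕ} {K ε κ c₂ : ℝ}

namespace Regime

theorem one_le_d' (h : Regime d K ε κ c₂) : (1 : ℝ) ≤ d := by exact_mod_cast h.one_le_d

theorem one_le_K (h : Regime d K ε κ c₂) : 1 ≤ K := by linarith [h.le_K, h.one_le_d']

theorem eps_le_one (h : Regime d K ε κ c₂) : ε ≤ 1 := by
  nlinarith [h.one_le_d', h.eps_pos, h.eps_le, mul_pos h.eps_pos h.eps_pos]

theorem kappa_le_one (h : Regime d K ε κ c₂) : κ ≤ 1 := by
  nlinarith [h.one_le_d', h.kappa_pos, h.kappa_le]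

end Regime

theorem joinWeight_nonneg (h : Regime d K ε κ c₂) (k : ℕ) : 0 ≤ joinWeight κ c₂ k := by
  have := h.kappa_pos
  have := h.one_le_c
  rw [joinWeight]
  positivity

theorem updateWeight_nonneg (h : Regime d K ε κ c₂) (j m : ℕ) :
    0 ≤ updateWeight d ε κ c₂ j m := by
  have h1 := h.eps_pos
  have h2 := h.kappa_pos
  have h3 := h.eps_le_one
  have h4 := joinWeight_nonneg h m
  have h5 : 0 ≤ 1 - ε / 2 := by linarith
  unfold updateWeight
  split_ifs <;> positivity

theorem pow_mul_joinWeight (h : Regime d K ε κ c₂) {k : ℕ} (hk : 2 ≤ k) :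
    (K * ε * κ) ^ k * joinWeight κ c₂ k ≤ K ^ k * (ε ^ 2 * κ) := by
  have hκ := h.kappa_pos
  have hε := h.eps_pos
  have hK := h.one_le_K
  have hc := h.one_le_c
  obtain ⟨n, rfl⟩ := Nat.exists_eq_add_of_le hk
  have e : (K * ε * κ) ^ (2 + n) * joinWeight κ c₂ (2 + n)
      = K ^ (2 + n) * (ε ^ 2 * κ) * (c₂ * ε) ^ n := by
    rw [joinWeight, show 2 + n - 2 = n by omega, show 2 + n - 1 = n + 1 by omega]
    field_simp
    ring
  rw [e]
  exact mul_le_of_le_one_right (by positivity) (pow_le_one₀ (by positivity) h.c_eps_le)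

theorem pow_mul_joinWeight_succ (h : Regime d K ε κ c₂) {k : ℕ} (hk : 1 ≤ k) :
    (K * ε * κ) ^ k * joinWeight κ c₂ (k + 1) ≤ K ^ k * ε := by
  have hκ := h.kappa_pos
  have hε := h.eps_pos
  have hK := h.one_le_K
  have hc := h.one_le_c
  obtain ⟨n, rfl⟩ := Nat.exists_eq_add_of_le hk
  have e : (K * ε * κ) ^ (1 + n) * joinWeight κ c₂ (1 + n + 1)
      = K ^ (1 + n) * ε * (c₂ * ε) ^ n := by
    rw [joinWeight, show 1 + n + 1 - 2 = n by omega, show 1 + n + 1 - 1 = n + 1 by omega]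
    field_simp
    ring
  rw [e]
  exact mul_le_of_le_one_right (by positivity) (pow_le_one₀ (by positivity) h.c_eps_le)

theorem pow_le_eps (h : Regime d K ε κ c₂) {k : ℕ} (hk : 1 ≤ k) : (K * ε) ^ k ≤ K ^ k * ε := by
  rw [mul_pow]
  have := h.one_le_K
  gcongr
  simpa using pow_le_pow_of_le_one h.eps_pos.le h.eps_le_one hk

/-- The local inequality at a vertex whose parent has already been decided. Here `kM`, `kN` and `kO`
are the numbers of decided children in voted clusters, in noise clusters, and of spin plus, `a`
tells whether the parent is minus, and `b` whether it is in a voted cluster. -/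
theorem update_decided (h : Regime d K ε κ c₂) (kM kN kO a b : ℕ) (hb : b ≤ a) (ha : a ≤ 1) :
    (K * ε * κ) ^ kM * (K * ε) ^ kN * (K / (8 * d)) ^ kO *
        updateWeight d ε κ c₂ (kM + kN + a) (kM + b) ≤
      ε * K ^ (2 * (kM + kN + kO - 1) + 2) := by
  have hκ := h.kappa_pos
  have hε := h.eps_pos
  have hK := h.one_le_K
  have hd := h.one_le_d'
  have hε1 := h.eps_le_one
  have hκ1 := h.kappa_le_one
  have hA0 : 0 ≤ K / (8 * d) := by positivity
  have hA : K / (8 * d) ≤ K := div_le_self (by linarith) (by linarith)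
  have hAp : (K / (8 * d)) ^ kO ≤ K ^ kO := by gcongr
  have hAp0 : 0 ≤ (K / (8 * d)) ^ kO := by positivity
  have h1 : 0 ≤ 1 - ε / 2 := by linarith
  have hfin : 2 * d * ε * K ^ (kM + kN + kO) ≤ ε * K ^ (2 * (kM + kN + kO - 1) + 2) := by
    calc 2 * d * ε * K ^ (kM + kN + kO) ≤ K * ε * K ^ (kM + kN + kO) := by
          gcongr; linarith [h.le_K]
      _ = ε * K ^ (kM + kN + kO + 1) := by ring
      _ ≤ _ := mul_le_mul_of_nonneg_left (pow_le_pow_right₀ hK (by omega)) hε.le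
  have hKε : K * ε * κ ≤ K := by
    calc K * ε * κ ≤ K * 1 * 1 := by gcongr
      _ = K := by ring
  have hKε' : K * ε ≤ K := by nlinarith
  have hprod : (K * ε * κ) ^ kM * (K * ε) ^ kN * (K / (8 * d)) ^ kO ≤ K ^ (kM + kN + kO) := by
    rw [pow_add, pow_add]
    gcongr
  have hprod0 : 0 ≤ (K * ε * κ) ^ kM * (K * ε) ^ kN * (K / (8 * d)) ^ kO := by positivity
  refine le_trans ?_ hfin
  have easy : updateWeight d ε κ c₂ (kM + kN + a) (kM + b) ≤ 2 * d * ε →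
      (K * ε * κ) ^ kM * (K * ε) ^ kN * (K / (8 * d)) ^ kO *
        updateWeight d ε κ c₂ (kM + kN + a) (kM + b) ≤ 2 * d * ε * K ^ (kM + kN + kO) := by
    intro hh
    calc _ ≤ K ^ (kM + kN + kO) * (2 * d * ε) := by
          gcongr
          exact updateWeight_nonneg h _ _
      _ = _ := by ring
  have done : ∀ X : ℝ, (K * ε * κ) ^ kM * (K * ε) ^ kN * X ≤ K ^ (kM + kN) * ε → 0 ≤ X →
      (K * ε * κ) ^ kM * (K * ε) ^ kN * (K / (8 * d)) ^ kO * ((1 - ε / 2) * X) ≤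
        2 * d * ε * K ^ (kM + kN + kO) := by
    intro X hX hX0
    calc _ = (K * ε * κ) ^ kM * (K * ε) ^ kN * X * ((K / (8 * d)) ^ kO * (1 - ε / 2)) := by ring
      _ ≤ K ^ (kM + kN) * ε * (K ^ kO * 1) := by
          gcongr
          linarith
      _ = 1 * ε * K ^ (kM + kN + kO) := by ring
      _ ≤ _ := by gcongr; linarith
  by_cases hj : 2 ≤ kM + kN + a
  · by_cases hm : kM + b = 0 ∨ kM + b = kM + kN + a
    · rw [updateWeight, if_pos hj, if_pos hm]
      refine done _ ?_ (joinWeight_nonneg h _)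
      rcases hm with hm | hm
      · obtain ⟨rfl, rfl⟩ : kM = 0 ∧ b = 0 := by omega
        have : joinWeight κ c₂ (0 + 0) = 1 := by simp [joinWeight]
        rw [this]
        have := pow_le_eps h (k := kN) (by omega)
        simpa using this
      · obtain ⟨rfl, rfl⟩ : kN = 0 ∧ b = a := by omega
        have h01 : b = 0 ∨ b = 1 := by omega
        rcases h01 with rfl | rfl
        · have := pow_mul_joinWeight h (k := kM) (by omega)
          have h2 : K ^ kM * (ε ^ 2 * κ) ≤ K ^ kM * ε := by
            gcongr
            calc ε ^ 2 * κ ≤ ε ^ 2 * 1 := by gcongr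
              _ ≤ ε := by nlinarith
          simpa using this.trans h2
        · have := pow_mul_joinWeight_succ h (k := kM) (by omega)
          simpa using this
    · rw [updateWeight, if_pos hj, if_neg hm, mul_zero]
      positivity
  · refine easy ?_
    rw [updateWeight, if_neg hj]
    split_ifs
    · nlinarith
    · nlinarith
    · have := h.eps_le
      have h3 : (d : ℝ) ^ 2 * (ε ^ 2 / 4 + ε ^ 2 * κ) ≤ ε := by
        calc (d : ℝ) ^ 2 * (ε ^ 2 / 4 + ε ^ 2 * κ) ≤ (d : ℝ) ^ 2 * (ε ^ 2 / 4 + ε ^ 2 * 1) := by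
              gcongr
          _ ≤ (16 * (d : ℝ) ^ 2 * ε) * ε := by nlinarith [mul_pos hε hε, sq_nonneg (d : ℝ)]
          _ ≤ 1 * ε := by gcongr
          _ = ε := one_mul ε
      nlinarith

/-- The local inequality at a vertex whose parent has not been decided yet: the sum over the three
possible states of the parent, with the weights `8 d`, `1 / ε` and `1 / (ε κ)` of these states, is at
most the product of the weights of the states of the children. If there is exactly one child, there
is no loss at all, which is where the factor `1 - ε / 2` is used. -/
theorem update_new (h : Regime d K ε κ c₂) (kM kN kO : ℕ) :
    (K * ε * κ) ^ kM * (K * ε) ^ kN * (K / (8 * d)) ^ kO *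
        (8 * d / K * updateWeight d ε κ c₂ (kM + kN) kM +
          1 / (2 * K) * updateWeight d ε κ c₂ (kM + kN + 1) kM +
          1 / K * updateWeight d ε κ c₂ (kM + kN + 1) (kM + 1)) ≤
      ε * K ^ (2 * (kM + kN + kO - 1)) := by
  have hκ := h.kappa_pos
  have hε := h.eps_pos
  have hK := h.one_le_K
  have hK0 : 0 < K := by linarith
  have hd := h.one_le_d'
  have hε1 := h.eps_le_one
  have hκ1 := h.kappa_le_one
  have hεd := h.eps_le
  have hκd := h.kappa_le
  have h8K := h.le_K
  have hA0 : 0 ≤ K / (8 * d) := by positivity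
  have hA : K / (8 * d) ≤ K := div_le_self (by linarith) (by linarith)
  have hApn : ∀ n, (K / (8 * d)) ^ n ≤ K ^ n := fun n => by gcongr
  have hAp0 : 0 ≤ (K / (8 * d)) ^ kO := by positivity
  have h1 : 0 ≤ 1 - ε / 2 := by linarith
  have hW := updateWeight_nonneg h
  have hεd1 : (d : ℝ) * ε ≤ 1 / 16 := by nlinarith
  have hdd : (d : ℝ) ≤ (d : ℝ) ^ 2 := by nlinarith
  rcases Nat.eq_zero_or_pos kM with rfl | hkM
  · rcases Nat.eq_zero_or_pos kN with rfl | hkN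
    · -- no child is minus
      have u0 : updateWeight d ε κ c₂ 0 0 = ε / 2 + (d : ℝ) ^ 2 * (ε ^ 2 / 4 + ε ^ 2 * κ) := by
        simp [updateWeight]
      have u1 : updateWeight d ε κ c₂ 1 0 = ε / 2 + d * (ε / 2) := by simp [updateWeight]
      have u2 : updateWeight d ε κ c₂ 1 1 = ε / 2 + d * ε := by simp [updateWeight]
      simp only [pow_zero, one_mul, zero_add, u0, u1, u2]
      have h3 : (d : ℝ) ^ 2 * (ε ^ 2 / 4 + ε ^ 2 * κ) ≤ ε / 8 := by
        calc (d : ℝ) ^ 2 * (ε ^ 2 / 4 + ε ^ 2 * κ) ≤ (d : ℝ) ^ 2 * (ε ^ 2 / 4 + ε ^ 2 * 1) := by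
              gcongr
          _ = (16 * (d : ℝ) ^ 2 * ε) * ε * (5 / 64) := by ring
          _ ≤ 1 * ε * (5 / 64) := by gcongr
          _ ≤ ε / 8 := by linarith
      have h4 : 8 * d / K * (ε / 2 + (d : ℝ) ^ 2 * (ε ^ 2 / 4 + ε ^ 2 * κ)) +
          1 / (2 * K) * (ε / 2 + d * (ε / 2)) + 1 / K * (ε / 2 + d * ε) ≤ ε * (8 * d / K) := by
        have e : 8 * d / K * (ε / 2 + (d : ℝ) ^ 2 * (ε ^ 2 / 4 + ε ^ 2 * κ)) +
          1 / (2 * K) * (ε / 2 + d * (ε / 2)) + 1 / K * (ε / 2 + d * ε) =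
          (8 * d * (ε / 2 + (d : ℝ) ^ 2 * (ε ^ 2 / 4 + ε ^ 2 * κ)) +
          (1 / 2) * (ε / 2 + d * (ε / 2)) + (ε / 2 + d * ε)) / K := by
            field_simp
        rw [e, show ε * (8 * d / K) = ε * (8 * d) / K by ring]
        gcongr
        nlinarith
      refine (mul_le_mul_of_nonneg_left h4 hAp0).trans ?_
      rw [show (K / (8 * d)) ^ kO * (ε * (8 * d / K)) = ε * ((K / (8 * d)) ^ kO * (8 * d / K))
        by ring]
      refine mul_le_mul_of_nonneg_left ?_ hε.le
      rcases kO with _ | n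
      · simpa using (div_le_one hK0).2 h8K
      · have : (K / (8 * d)) ^ (n + 1) * (8 * d / K) = (K / (8 * d)) ^ n := by
          rw [pow_succ]
          field_simp
        rw [this]
        refine (hApn n).trans ?_
        gcongr; omega
    · -- some children are minus, in noise clusters
      have u2 : updateWeight d ε κ c₂ (kN + 1) (0 + 1) = 0 := by
        rw [updateWeight, if_pos (by omega), if_neg (by omega)]
      have u1 : updateWeight d ε κ c₂ (kN + 1) 0 ≤ 1 := by
        rw [updateWeight, if_pos (by omega), if_pos (by omega)]
        simp [joinWeight]; linarith
      have u0 : (K * ε) ^ kN * (8 * d / K * updateWeight d ε κ c₂ kN 0) ≤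
          K ^ (kN - 1) * ε * (1 / 2) := by
        obtain ⟨n, rfl⟩ := Nat.exists_eq_add_of_le hkN
        rcases n with _ | n
        · have : updateWeight d ε κ c₂ 1 0 = ε / 2 + d * (ε / 2) := by simp [updateWeight]
          simp only [add_zero, this, pow_one, Nat.sub_self, pow_zero, one_mul]
          have : K * ε * (8 * d / K * (ε / 2 + d * (ε / 2))) = ε * (4 * d * ε + 4 * d ^ 2 * ε) := by
            field_simp
            ring
          rw [this]
          gcongr
          nlinarith
        · have : updateWeight d ε κ c₂ (1 + (n + 1)) 0 ≤ 1 := by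
            rw [updateWeight, if_pos (by omega), if_pos (by omega)]
            simp [joinWeight]; linarith
          have e : (K * ε) ^ (1 + (n + 1)) * (8 * d / K * 1) =
            K ^ (1 + (n + 1) - 1) * ε * (8 * d * ε * ε ^ n) := by
            rw [show 1 + (n + 1) - 1 = n + 1 by omega]
            field_simp
            ring
          calc _ ≤ (K * ε) ^ (1 + (n + 1)) * (8 * d / K * 1) := by gcongr
            _ = K ^ (1 + (n + 1) - 1) * ε * (8 * d * ε * ε ^ n) := e
            _ ≤ K ^ (1 + (n + 1) - 1) * ε * (8 * d * ε * 1) := by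
                gcongr; exact pow_le_one₀ hε.le hε1
            _ ≤ _ := by gcongr; nlinarith
      have u3 : (K * ε) ^ kN * (1 / (2 * K) * updateWeight d ε κ c₂ (kN + 1) 0) ≤
          K ^ (kN - 1) * ε * (1 / 2) := by
        calc _ ≤ K ^ kN * ε * (1 / (2 * K) * 1) := by
              gcongr
              · exact mul_nonneg (by positivity) (hW _ _)
              · exact pow_le_eps h hkN
          _ = _ := by
            obtain ⟨n, rfl⟩ := Nat.exists_eq_add_of_le hkN
            rw [show 1 + n - 1 = n by omega]
            field_simp
            ring
      simp only [pow_zero, one_mul, zero_add] at u2 ⊢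
      rw [u2, mul_zero, add_zero]
      calc _ = (K / (8 * d)) ^ kO * ((K * ε) ^ kN * (8 * d / K * updateWeight d ε κ c₂ kN 0) +
          (K * ε) ^ kN * (1 / (2 * K) * updateWeight d ε κ c₂ (kN + 1) 0)) := by ring
        _ ≤ K ^ kO * (K ^ (kN - 1) * ε * (1 / 2) + K ^ (kN - 1) * ε * (1 / 2)) := by
            gcongr
            · exact add_nonneg (mul_nonneg (by positivity) (mul_nonneg (by positivity) (hW _ _)))
                (mul_nonneg (by positivity) (mul_nonneg (by positivity) (hW _ _)))
        _ = ε * K ^ (kO + (kN - 1)) := by ring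
        _ ≤ _ := by gcongr; omega
  · rcases Nat.eq_zero_or_pos kN with rfl | hkN
    · -- some children are minus, in voted clusters
      have u1 : updateWeight d ε κ c₂ (kM + 1) kM = 0 := by
        rw [updateWeight, if_pos (by omega), if_neg (by omega)]
      simp only [add_zero, pow_zero, mul_one, u1, mul_zero]
      obtain ⟨n, rfl⟩ := Nat.exists_eq_add_of_le hkM
      rcases n with _ | n
      · have v0 : updateWeight d ε κ c₂ 1 1 = ε / 2 + d * ε := by simp [updateWeight]
        have v1 : updateWeight d ε κ c₂ (1 + 1) (1 + 1) = (1 - ε / 2) / κ := by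
          simp [updateWeight, joinWeight]; ring
        simp only [add_zero, pow_one, v0, v1]
        have e : K * ε * κ * (K / (8 * d)) ^ kO *
            (8 * d / K * (ε / 2 + d * ε) + 1 / K * ((1 - ε / 2) / κ)) =
            (K / (8 * d)) ^ kO * ε * ((4 * d + 8 * d ^ 2) * κ * ε + (1 - ε / 2)) := by
          field_simp
          ring
        rw [e]
        have h5 : (4 * (d : ℝ) + 8 * d ^ 2) * κ ≤ 1 / 2 := by nlinarith
        calc _ ≤ K ^ kO * ε * (1 / 2 * ε + (1 - ε / 2)) := by
              gcongr
          _ = ε * K ^ kO := by ring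
          _ ≤ _ := by gcongr; omega
      · have hle : ∀ m, updateWeight d ε κ c₂ (m + 2) (m + 2) ≤ joinWeight κ c₂ (m + 2) := by
          intro m
          rw [updateWeight, if_pos (by omega), if_pos (Or.inr rfl)]
          have := joinWeight_nonneg h (m + 2)
          nlinarith
        have v0 : (K * ε * κ) ^ (1 + (n + 1)) *
            (8 * d / K * updateWeight d ε κ c₂ (1 + (n + 1)) (1 + (n + 1))) ≤
            K ^ (n + 1) * ε := by
          have := pow_mul_joinWeight h (k := 1 + (n + 1)) (by omega)
          have h6 := hle n
          rw [show n + 2 = 1 + (n + 1) by omega] at h6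
          calc _ ≤ (K * ε * κ) ^ (1 + (n + 1)) * (8 * d / K * joinWeight κ c₂ (1 + (n + 1))) := by
                gcongr
            _ = 8 * d / K * ((K * ε * κ) ^ (1 + (n + 1)) * joinWeight κ c₂ (1 + (n + 1))) := by ring
            _ ≤ 8 * d / K * (K ^ (1 + (n + 1)) * (ε ^ 2 * κ)) := by gcongr
            _ = K ^ (n + 1) * ε * (8 * (d * ε) * κ) := by
                field_simp
                ring
            _ ≤ K ^ (n + 1) * ε * (8 * (1 / 16) * 1) := by gcongr
            _ ≤ K ^ (n + 1) * ε * 1 := by gcongr; norm_num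
            _ = _ := by ring
        have v1 : (K * ε * κ) ^ (1 + (n + 1)) *
            (1 / K * updateWeight d ε κ c₂ (1 + (n + 1) + 1) (1 + (n + 1) + 1)) ≤
            K ^ (n + 1) * ε := by
          have := pow_mul_joinWeight_succ h (k := 1 + (n + 1)) (by omega)
          have h6 := hle (n + 1)
          rw [show n + 1 + 2 = 1 + (n + 1) + 1 by omega] at h6
          calc _ ≤ (K * ε * κ) ^ (1 + (n + 1)) *
                (1 / K * joinWeight κ c₂ (1 + (n + 1) + 1)) := by gcongr
            _ = 1 / K * ((K * ε * κ) ^ (1 + (n + 1)) * joinWeight κ c₂ (1 + (n + 1) + 1)) := by ring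
            _ ≤ 1 / K * (K ^ (1 + (n + 1)) * ε) := by gcongr
            _ = _ := by
                field_simp
                ring
        calc _ = (K / (8 * d)) ^ kO * ((K * ε * κ) ^ (1 + (n + 1)) *
            (8 * d / K * updateWeight d ε κ c₂ (1 + (n + 1)) (1 + (n + 1))) +
            (K * ε * κ) ^ (1 + (n + 1)) *
            (1 / K * updateWeight d ε κ c₂ (1 + (n + 1) + 1) (1 + (n + 1) + 1))) := by ring
          _ ≤ K ^ kO * (K ^ (n + 1) * ε + K ^ (n + 1) * ε) := by
              gcongr
              · exact add_nonneg (mul_nonneg (by positivity) (mul_nonneg (by positivity) (hW _ _)))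
                  (mul_nonneg (by positivity) (mul_nonneg (by positivity) (hW _ _)))
          _ = 2 * (ε * K ^ (kO + (n + 1))) := by ring
          _ ≤ K * (ε * K ^ (kO + (n + 1))) := by gcongr; linarith
          _ = ε * K ^ (kO + (n + 1) + 1) := by ring
          _ ≤ _ := by gcongr; omega
    · -- a vertex cannot join a voted cluster to a noise cluster
      have u0 : updateWeight d ε κ c₂ (kM + kN) kM = 0 := by
        rw [updateWeight, if_pos (by omega), if_neg (by omega)]
      have u1 : updateWeight d ε κ c₂ (kM + kN + 1) kM = 0 := by
        rw [updateWeight, if_pos (by omega), if_neg (by omega)]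
      have u2 : updateWeight d ε κ c₂ (kM + kN + 1) (kM + 1) = 0 := by
        rw [updateWeight, if_pos (by omega), if_neg (by omega)]
      simp only [u0, u1, u2, mul_zero, add_zero]
      positivity

end Numeric

/-! ### Rooted unions of clusters and the weights of their exploration -/

section Exploration

variable {V : Type*} [DecidableEq V] {G : SimpleGraph V} [G.LocallyFinite]

variable (G) in
/-- `A` is a union of pairwise unlinked clusters, each rooted at one of its neighbours: `R` is the
set of roots, `π x` is the neighbour of `x` towards the root of its cluster, and `rk x` is the
distance to this root. The last condition says that a neighbour of `A` which is neither in `O` nor a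
root is not the child, in the tree rooted at `o`, of a vertex outside `A`. -/
structure IsRooted (o : V) (A R O : Finset V) (π : V → V) (rk : V → ℕ) : Prop where
  adj : ∀ x ∈ A, G.Adj x (π x)
  child : ∀ x ∈ A, ∀ y, G.Adj x y → y ≠ π x → ∀ x' ∈ A, G.Adj x' y → x' ≠ x →
    π x' = y ∧ rk x < rk x'
  par : ∀ x ∈ A, π x ∈ R ∨ ∃ x' ∈ A, G.Adj x' (π x) ∧ π x' ≠ π x
  root : ∀ r ∈ R, ∀ x ∈ A, G.Adj x r → π x = r
  root_mem : R ⊆ nbhd G A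
  out : ∀ x ∉ A, ∀ z ∈ nbhd G A, z ∉ O → G.Adj x z → G.dist o z = G.dist o x + 1 → z ∈ R

variable (G) in
/-- The children of `x` that have further neighbours in `A`. -/
def kids (A : Finset V) (π : V → V) (x : V) : Finset V :=
  {c ∈ G.neighborFinset x | c ≠ π x ∧ 2 ≤ degIn G A c}

variable (G) in
/-- The children of `x` that have no further neighbour in `A`. -/
def bareKids (A : Finset V) (π : V → V) (x : V) : Finset V :=
  {c ∈ G.neighborFinset x | c ≠ π x ∧ ¬ 2 ≤ degIn G A c}

variable (G) in
/-- The conditional probability that `x` is minus, given the set `U` of minus vertices at the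
previous time. -/
noncomputable def minusProb (ε : ℝ) (U : Finset V) (x : V) : ℝ :=
  if 2 ≤ degIn G U x then 1 - ε / 2 else ε / 2

variable (G) in
/-- The probability that the vertices of `A` are minus, that those of `D` were minus at the
previous time and those of `O` plus, if the set of vertices of `E` that were minus is `U` with
probability `p U`. -/
noncomputable def minusSum (p : Finset V → ℝ) (E : Finset V) (ε : ℝ) (A D O : Finset V) : ℝ :=
  ∑ U ∈ E.powerset with (D ⊆ U ∧ Disjoint O U), p U * ∏ x ∈ A, minusProb G ε U x

variable (G) in
/-- The labelled configurations: `M ⊆ D` is the part of `D` in voted clusters, and all the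
neighbours in `D` of a vertex of `P` are in the same cluster. -/
def labels (P D : Finset V) : Finset (Finset V) :=
  {M ∈ D.powerset | ∀ x ∈ P, degIn G M x = 0 ∨ degIn G M x = degIn G D x}

/-- The weight of a minus vertex of the previous time, depending on its label. -/
noncomputable def siteWeight (ε κ : ℝ) (R M : Finset V) (y : V) : ℝ :=
  ε * (if y ∈ M then (if y ∈ R then 1 else κ) else 1 / 2)

/-- The additional weight of a decided vertex `y` whose parent is still to be explored: it bounds
the total weight of what can happen further up, given the state of `y`. -/
noncomputable def frontWeight (d : ℕ) (K ε κ : ℝ) (D M : Finset V) (y : V) : ℝ :=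
  if y ∈ M then 1 / (K * ε * κ) else if y ∈ D then 1 / (K * ε) else 8 * d / K

variable (G) in
/-- The weight of an explored vertex `x`: the front weights of its children have been used up. -/
noncomputable def vertexWeight (d : ℕ) (K ε κ c₂ : ℝ) (A : Finset V) (π : V → V) (D M : Finset V)
    (x : V) : ℝ :=
  joinWeight κ c₂ (degIn G M x) * ∏ c ∈ kids G A π x, (frontWeight d K ε κ D M c)⁻¹

/-- The exponent of `K` paid at `x`: it vanishes at vertices which have at most one child
continuing the cluster and whose parent is neither the root nor the parent of another vertex. -/
noncomputable def irregularity (G : SimpleGraph V) [G.LocallyFinite] (A R : Finset V) (π : V → V)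
    (x : V) : ℕ :=
  2 * ((kids G A π x).card - 1) + if π x ∈ R ∨ ∃ x' ∈ A, x' ≠ x ∧ π x' = π x then 2 else 0

variable (G) in
/-- The weight of the labelled configuration `(D, M)` when the vertices of `P` are explored. -/
noncomputable def stageWeight (d : ℕ) (K ε κ c₂ : ℝ) (A R : Finset V) (π : V → V)
    (P D M : Finset V) : ℝ :=
  (∏ y ∈ D, siteWeight ε κ R M y) * (∏ y ∈ P.image π \ R, frontWeight d K ε κ D M y) *
    ∏ x ∈ P, vertexWeight G d K ε κ c₂ A π D M x

theorem mem_labels {P D M : Finset V} : M ∈ labels G P D ↔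
    M ⊆ D ∧ ∀ x ∈ P, degIn G M x = 0 ∨ degIn G M x = degIn G D x := by
  simp [labels]

section Weights

variable {d : ℕ} {K ε κ c₂ : ℝ} {A R : Finset V} {π : V → V}

theorem siteWeight_nonneg (h : Regime d K ε κ c₂) (M : Finset V) (y : V) :
    0 ≤ siteWeight ε κ R M y := by
  have := h.eps_pos
  have := h.kappa_pos
  unfold siteWeight
  split_ifs <;> positivity

theorem frontWeight_pos (h : Regime d K ε κ c₂) (D M : Finset V) (y : V) :
    0 < frontWeight d K ε κ D M y := by
  have := h.eps_pos
  have := h.kappa_pos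
  have := h.one_le_K
  have := h.one_le_d'
  unfold frontWeight
  split_ifs <;> positivity

theorem vertexWeight_nonneg (h : Regime d K ε κ c₂) (D M : Finset V) (x : V) :
    0 ≤ vertexWeight G d K ε κ c₂ A π D M x :=
  mul_nonneg (joinWeight_nonneg h _)
    (prod_nonneg fun _ _ => inv_nonneg.2 (frontWeight_pos h _ _ _).le)

theorem stageWeight_nonneg (h : Regime d K ε κ c₂) (P D M : Finset V) :
    0 ≤ stageWeight G d K ε κ c₂ A R π P D M :=
  mul_nonneg (mul_nonneg (prod_nonneg fun _ _ => siteWeight_nonneg h _ _)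
    (prod_nonneg fun _ _ => (frontWeight_pos h _ _ _).le))
    (prod_nonneg fun _ _ => vertexWeight_nonneg h _ _ _)

theorem siteWeight_congr {M M' : Finset V} {y : V} (h : y ∈ M' ↔ y ∈ M) :
    siteWeight ε κ R M' y = siteWeight ε κ R M y := by
  simp only [siteWeight, h]

theorem frontWeight_congr {D D' M M' : Finset V} {y : V} (h : y ∈ M' ↔ y ∈ M)
    (h' : y ∈ D' ↔ y ∈ D) : frontWeight d K ε κ D' M' y = frontWeight d K ε κ D M y := by
  simp only [frontWeight, h, h']

theorem prod_frontWeight_inv (D M : Finset V) (s : Finset V) :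
    ∏ c ∈ s, (frontWeight d K ε κ D M c)⁻¹ = (K * ε * κ) ^ (#{c ∈ s | c ∈ M}) *
      (K * ε) ^ (#{c ∈ s | c ∉ M ∧ c ∈ D}) * (K / (8 * d)) ^ (#{c ∈ s | c ∉ M ∧ c ∉ D}) := by
  have : ∀ c, (frontWeight d K ε κ D M c)⁻¹ =
      if c ∈ M then K * ε * κ else if c ∈ D then K * ε else K / (8 * d) := fun c => by
    unfold frontWeight
    split_ifs <;> simp
  simp only [this]
  rw [prod_ite, prod_ite, prod_const, prod_const, prod_const, filter_filter, filter_filter]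
  ring

end Weights

/-- Splitting a sum over the labellings of `D ∪ S` according to the common label of `S`. -/
theorem sum_labels_union_le {L L' : Finset (Finset V)} {D S : Finset V} {f : Finset V → ℝ}
    (hf : ∀ M, 0 ≤ f M) (hLD : ∀ M ∈ L, M ⊆ D) (hDS : Disjoint D S)
    (h1 : ∀ M ∈ L', M ⊆ D ∪ S ∧ M ∩ D ∈ L) (h2 : ∀ M ∈ L', Disjoint M S ∨ S ⊆ M) :
    ∑ M ∈ L', f M ≤
      ∑ M ∈ L, ((if M ∈ L' then f M else 0) + if M ∪ S ∈ L' then f (M ∪ S) else 0) := by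
  rw [sum_add_distrib, ← sum_filter, ← sum_filter]
  have hinj : Set.InjOn (fun M => M ∪ S) (↑({M ∈ L | M ∪ S ∈ L'}) : Set (Finset V)) := by
    intro M hM N hN h
    have hM' := hLD M (mem_filter.1 hM).1
    have hN' := hLD N (mem_filter.1 hN).1
    have e : ∀ T ⊆ D, (T ∪ S) ∩ D = T := fun T hT => by
      rw [union_inter_distrib_right, inter_eq_left.2 hT, (disjoint_iff_inter_eq_empty.1 hDS.symm),
        union_empty]
    rw [← e M hM', ← e N hN']
    exact congrArg (· ∩ D) h
  rw [← sum_image (f := f) hinj]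
  refine (sum_le_sum_of_subset_of_nonneg (t := {M ∈ L | M ∈ L'} ∪
    {M ∈ L | M ∪ S ∈ L'}.image (fun M => M ∪ S)) ?_ fun M _ _ => hf M).trans ?_
  · intro M hM
    obtain ⟨hsub, hL⟩ := h1 M hM
    rcases h2 M hM with h | h
    · have : M ∩ D = M := by
        refine inter_eq_left.2 fun z hz => ?_
        exact (mem_union.1 (hsub hz)).resolve_right (disjoint_left.1 h hz)
      rw [this] at hL
      exact mem_union_left _ (mem_filter.2 ⟨hL, hM⟩)
    · have e : M ∩ D ∪ S = M := by
        ext z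
        simp only [mem_union, mem_inter]
        constructor
        · rintro (hz | hz)
          exacts [hz.1, h hz]
        · intro hz
          exact (mem_union.1 (hsub hz)).imp (fun h => ⟨hz, h⟩) id
      exact mem_union_right _ (mem_image.2 ⟨M ∩ D, mem_filter.2 ⟨hL, by rwa [e]⟩, e⟩)
  · rw [← sum_union_inter]
    exact le_add_of_nonneg_right (sum_nonneg fun M _ => hf M)

namespace IsRooted

variable {o : V} {A R O : Finset V} {π : V → V} {rk : V → ℕ}

theorem exists_of_mem_kids (h : IsRooted G o A R O π rk) {x c : V} (hx : x ∈ A)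
    (hc : c ∈ kids G A π x) : ∃ x' ∈ A, x' ≠ x ∧ π x' = c ∧ rk x < rk x' := by
  simp only [kids, mem_filter, SimpleGraph.mem_neighborFinset] at hc
  obtain ⟨hxc, hne, hdeg⟩ := hc
  obtain ⟨x', hx', hne'⟩ := exists_mem_ne (show 1 < (G.neighborFinset c ∩ A).card from hdeg) x
  rw [mem_inter, SimpleGraph.mem_neighborFinset] at hx'
  have := h.child x hx c hxc hne x' hx'.2 hx'.1.symm hne'
  exact ⟨x', hx'.2, hne', this⟩

theorem eq_of_mem_bareKids {x x' b : V} (hx : x ∈ A)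
    (hb : b ∈ bareKids G A π x) (hx' : x' ∈ A) (hadj : G.Adj x' b) : x' = x := by
  simp only [bareKids, mem_filter, SimpleGraph.mem_neighborFinset] at hb
  by_contra hne
  refine hb.2.2 ?_
  have : ({x, x'} : Finset V) ⊆ G.neighborFinset b ∩ A := by
    intro z hz
    simp only [mem_insert, mem_singleton] at hz
    rcases hz with rfl | rfl
    · exact mem_inter.2 ⟨(G.mem_neighborFinset _ _).2 hb.1.symm, hx⟩
    · exact mem_inter.2 ⟨(G.mem_neighborFinset _ _).2 hadj.symm, hx'⟩
  have h2 := card_le_card this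
  rw [card_pair (Ne.symm hne)] at h2
  exact h2

end IsRooted

theorem mem_neighbor_cases {A : Finset V} {π : V → V} {x z : V} (hz : G.Adj x z) :
    z = π x ∨ z ∈ kids G A π x ∨ z ∈ bareKids G A π x := by
  simp only [kids, bareKids, mem_filter, SimpleGraph.mem_neighborFinset]
  tauto

theorem minusProb_nonneg {ε : ℝ} (h0 : 0 ≤ ε) (h1 : ε ≤ 1) (U : Finset V) (x : V) :
    0 ≤ minusProb G ε U x := by
  unfold minusProb
  split_ifs <;> linarith

/-- Deciding the state of a vertex `y`. -/
theorem minusSum_eq_add (p : Finset V → ℝ) (E : Finset V) (ε : ℝ) (A D O : Finset V) (y : V) :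
    minusSum G p E ε A D O =
      minusSum G p E ε A (insert y D) O + minusSum G p E ε A D (insert y O) := by
  unfold minusSum
  rw [← sum_filter_add_sum_filter_not _ (fun U => y ∈ U), filter_filter, filter_filter]
  congr 1
  · refine sum_congr (filter_congr fun U _ => ?_) fun _ _ => rfl
    rw [insert_subset_iff]; tauto
  · refine sum_congr (filter_congr fun U _ => ?_) fun _ _ => rfl
    rw [disjoint_insert_left]; tauto

/-- Exploring the vertex `x`, all of whose neighbours outside `S` are decided: if at most one
neighbour is known to be minus, then `x` is minus by noise unless enough vertices of `S` are
minus. -/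
theorem minusSum_explore {p : Finset V → ℝ} (hp : ∀ U, 0 ≤ p U) {ε : ℝ} (h0 : 0 ≤ ε) (h1 : ε ≤ 1)
    {E A D O S : Finset V} {x : V} (hx : x ∈ A)
    (hdec : ∀ z, G.Adj x z → z ∉ S → z ∈ D ∪ O) :
    minusSum G p E ε A D O ≤
      if 2 ≤ degIn G D x then (1 - ε / 2) * minusSum G p E ε (A.erase x) D O
      else ε / 2 * minusSum G p E ε (A.erase x) D O +
        ∑ T ∈ S.powersetCard (2 - degIn G D x), minusSum G p E ε (A.erase x) (D ∪ T) O := by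
  have hq : ∀ U, 0 ≤ ∏ z ∈ A.erase x, minusProb G ε U z :=
    fun U => prod_nonneg fun _ _ => minusProb_nonneg h0 h1 U _
  have hsplit : ∀ U, ∏ z ∈ A, minusProb G ε U z =
      minusProb G ε U x * ∏ z ∈ A.erase x, minusProb G ε U z :=
    fun U => (mul_prod_erase A _ hx).symm
  split_ifs with hj
  · unfold minusSum
    rw [mul_sum]
    refine sum_le_sum fun U hU => ?_
    rw [mem_filter] at hU
    rw [hsplit, minusProb, if_pos (hj.trans (degIn_mono hU.2.1 x))]
    exact (by ring : _ = _).le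
  · have e : ∀ T, minusSum G p E ε (A.erase x) (D ∪ T) O =
        ∑ U ∈ E.powerset with (D ⊆ U ∧ Disjoint O U),
          if T ⊆ U then p U * ∏ z ∈ A.erase x, minusProb G ε U z else 0 := by
      intro T
      rw [minusSum, ← sum_filter, filter_filter]
      refine sum_congr (filter_congr fun U _ => ?_) fun _ _ => rfl
      rw [union_subset_iff]; tauto
    simp only [e]
    rw [sum_comm]
    unfold minusSum
    rw [mul_sum, ← sum_add_distrib]
    refine sum_le_sum fun U hU => ?_
    rw [mem_filter] at hU
    obtain ⟨-, hDU, hOU⟩ := hU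
    rw [hsplit]
    have hnn : 0 ≤ p U * ∏ z ∈ A.erase x, minusProb G ε U z := mul_nonneg (hp U) (hq U)
    have hs0 : ∀ T, 0 ≤ if T ⊆ U then p U * ∏ z ∈ A.erase x, minusProb G ε U z else 0 := by
      intro T; split_ifs <;> [exact hnn; exact le_rfl]
    by_cases h2 : 2 ≤ degIn G U x
    · -- some set of `2 - j` undecided neighbours is minus
      have hsub : G.neighborFinset x ∩ U ⊆ (G.neighborFinset x ∩ D) ∪ (S ∩ U) := by
        intro z hz
        rw [mem_inter, SimpleGraph.mem_neighborFinset] at hz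
        by_cases hzS : z ∈ S
        · exact mem_union_right _ (mem_inter.2 ⟨hzS, hz.2⟩)
        · rcases mem_union.1 (hdec z hz.1 hzS) with h | h
          · exact mem_union_left _ (mem_inter.2 ⟨(G.mem_neighborFinset _ _).2 hz.1, h⟩)
          · exact absurd hz.2 (disjoint_left.1 hOU h)
      have hcard : 2 - degIn G D x ≤ (S ∩ U).card := by
        have := (card_le_card hsub).trans (card_union_le _ _)
        change degIn G U x ≤ degIn G D x + _ at this
        omega
      obtain ⟨T, hTS, hT⟩ := exists_subset_card_eq hcard
      have hTmem : T ∈ S.powersetCard (2 - degIn G D x) :=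
        mem_powersetCard.2 ⟨hTS.trans inter_subset_left, hT⟩
      have := single_le_sum (f := fun T => if T ⊆ U then
        p U * ∏ z ∈ A.erase x, minusProb G ε U z else 0) (fun T _ => hs0 T) hTmem
      rw [if_pos (hTS.trans inter_subset_right)] at this
      rw [minusProb, if_pos h2]
      nlinarith
    · have := sum_nonneg (s := S.powersetCard (2 - degIn G D x)) fun T _ => hs0 T
      rw [minusProb, if_neg h2]
      nlinarith

end Exploration

/-! ### Exploring one vertex -/

section Exploration

variable {V : Type*} [DecidableEq V] {G : SimpleGraph V} [G.LocallyFinite]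

theorem degIn_union_of_disjoint {D S : Finset V} (h : Disjoint D S) (x : V) :
    degIn G (D ∪ S) x = degIn G D x + degIn G S x := by
  rw [degIn, inter_union_distrib_left, card_union_of_disjoint]
  · rfl
  · exact h.mono inter_subset_right inter_subset_right

theorem degIn_eq_card_of_subset {S : Finset V} {x : V} (h : S ⊆ G.neighborFinset x) :
    degIn G S x = S.card := by
  rw [degIn, inter_eq_right.2 h]

namespace IsRooted

variable {d : ℕ} {K ε κ c₂ : ℝ} {o : V} {A' R O : Finset V} {π : V → V} {rk : V → ℕ}

/-- The bare children of a vertex `x` about to be explored are not among the vertices demanded so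
far: these are roots, parents of vertices of `insert x P`, or bare children of vertices of `P`. -/
theorem notMem_of_mem_bareKids (hR : IsRooted G o A' R O π rk) {D P : Finset V} {x : V}
    (hPA : P ⊆ A') (hx : x ∈ A') (hxP : x ∉ P)
    (hfresh : ∀ z ∈ D, z ∈ R ∨ z ∈ (insert x P).image π ∨
      ∃ a ∈ P, ∀ b ∈ A', G.Adj b z → b = a) {z : V} (hz : z ∈ bareKids G A' π x) :
    z ∉ R ∧ z ∉ (insert x P).image π ∧ z ∉ D := by
  have hz' := hz
  simp only [bareKids, mem_filter, SimpleGraph.mem_neighborFinset] at hz'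
  have h1 : z ∉ R := fun h => hz'.2.1 (hR.root z h x hx hz'.1).symm
  have h2 : z ∉ (insert x P).image π := by
    intro h
    obtain ⟨a, ha, rfl⟩ := mem_image.1 h
    have haA : a ∈ A' := by
      rcases mem_insert.1 ha with rfl | ha
      exacts [hx, hPA ha]
    have := eq_of_mem_bareKids hx hz haA (hR.adj a haA)
    subst this
    exact hz'.2.1 rfl
  refine ⟨h1, h2, fun h => ?_⟩
  rcases hfresh z h with h | h | ⟨a, ha, h⟩
  · exact h1 h
  · exact h2 h
  · exact hxP (h x hx hz'.1 ▸ ha)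

/-- One step of the exploration: the vertex `x` is processed, its parent having been decided. The
set of explored vertices is `P` before the step and `insert x P` after it; `r` is the factor for
the later steps. -/
theorem process_vertex (hR : IsRooted G o A' R O π rk) (hreg : Regime d K ε κ c₂)
    (hdeg : ∀ v, G.degree v ≤ d) {p : Finset V → ℝ} (hp : ∀ U, 0 ≤ p U) {E A D O' P : Finset V}
    {x : V} (hA : A ⊆ A') (hPA : P ⊆ A') (hx : x ∈ A) (hxP : x ∉ P)
    (hmax : ∀ z ∈ A', rk x < rk z → z ∈ P)
    (hdec : ∀ z ∈ insert x P, π z ∈ D ∪ O')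
    (hfresh : ∀ z ∈ D, z ∈ R ∨ z ∈ (insert x P).image π ∨
      ∃ a ∈ P, ∀ b ∈ A', G.Adj b z → b = a) {r : ℝ} (hr : 0 ≤ r)
    (IH : ∀ T ⊆ bareKids G A' π x, minusSum G p E ε (A.erase x) (D ∪ T) O' ≤
      r * ∑ M ∈ labels G (insert x P) (D ∪ T),
        stageWeight G d K ε κ c₂ A' R π (insert x P) (D ∪ T) M) :
    minusSum G p E ε A D O' ≤ r * ∑ M ∈ labels G P D,
      ((∏ y ∈ D, siteWeight ε κ R M y) *
        (∏ y ∈ (insert x P).image π \ R, frontWeight d K ε κ D M y) *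
        ∏ x ∈ P, vertexWeight G d K ε κ c₂ A' π D M x) *
      ((∏ c ∈ kids G A' π x, (frontWeight d K ε κ D M c)⁻¹) *
        updateWeight d ε κ c₂ (degIn G D x) (degIn G M x)) := by
  have hε := hreg.eps_pos
  have hκ := hreg.kappa_pos
  have hε1 := hreg.eps_le_one
  have hxA' := hA hx
  have hbare := fun z hz => hR.notMem_of_mem_bareKids hPA hxA' hxP hfresh (z := z) hz
  have hbareP : ∀ z ∈ bareKids G A' π x, ∀ a ∈ P, ¬ G.Adj a z := by
    intro z hz a ha haz
    exact hxP (eq_of_mem_bareKids hxA' hz (hPA ha) haz ▸ ha)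
  have hbareadj : ∀ z ∈ bareKids G A' π x, G.Adj x z := by
    intro z hz
    simp only [bareKids, mem_filter, SimpleGraph.mem_neighborFinset] at hz
    exact hz.1
  have hdec' : ∀ z, G.Adj x z → z ∉ bareKids G A' π x → z ∈ D ∪ O' := by
    intro z hz hzb
    rcases mem_neighbor_cases (A := A') (π := π) hz with rfl | h | h
    · exact hdec x (mem_insert_self _ _)
    · obtain ⟨a, ha, -, rfl, hrk⟩ := hR.exists_of_mem_kids hxA' h
      exact hdec a (mem_insert_of_mem (hmax a ha hrk))
    · exact absurd h hzb
  set q : Finset V → ℝ := fun M => (∏ y ∈ D, siteWeight ε κ R M y) *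
        (∏ y ∈ (insert x P).image π \ R, frontWeight d K ε κ D M y) *
        ∏ x ∈ P, vertexWeight G d K ε κ c₂ A' π D M x with hq
  set f : Finset V → ℝ := fun M => ∏ c ∈ kids G A' π x, (frontWeight d K ε κ D M c)⁻¹ with hf
  have hq0 : ∀ M, 0 ≤ q M := fun M =>
    mul_nonneg (mul_nonneg (prod_nonneg fun _ _ => siteWeight_nonneg hreg _ _)
      (prod_nonneg fun _ _ => (frontWeight_pos hreg _ _ _).le))
      (prod_nonneg fun _ _ => vertexWeight_nonneg hreg _ _ _)
  have hf0 : ∀ M, 0 ≤ f M := fun M => prod_nonneg fun _ _ =>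
    inv_nonneg.2 (frontWeight_pos hreg _ _ _).le
  -- the stage weight after the step, when no bare child is involved
  have hstage : ∀ M, stageWeight G d K ε κ c₂ A' R π (insert x P) D M =
      q M * f M * joinWeight κ c₂ (degIn G M x) := by
    intro M
    rw [stageWeight, prod_insert hxP, vertexWeight]
    simp only [hq, hf]
    ring
  have hlab : ∀ M, M ∈ labels G (insert x P) D ↔ M ∈ labels G P D ∧
      (degIn G M x = 0 ∨ degIn G M x = degIn G D x) := by
    intro M
    simp only [mem_labels, mem_insert, forall_eq_or_imp]
    tauto
  have hle : ∀ M ∈ labels G P D, degIn G M x ≤ degIn G D x :=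
    fun M hM => degIn_mono (mem_labels.1 hM).1 x
  have IH0 := IH ∅ (empty_subset _)
  rw [union_empty] at IH0
  have hexp := minusSum_explore hp hε.le hε1 (E := E) hx hdec'
  by_cases hj : 2 ≤ degIn G D x
  · rw [if_pos hj] at hexp
    refine hexp.trans ((mul_le_mul_of_nonneg_left IH0 (by linarith)).trans ?_)
    rw [mul_left_comm]
    refine mul_le_mul_of_nonneg_left ?_ hr
    rw [mul_sum]
    have : labels G (insert x P) D = {M ∈ labels G P D |
        degIn G M x = 0 ∨ degIn G M x = degIn G D x} := by
      ext M; rw [hlab, mem_filter]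
    rw [this, sum_filter]
    refine sum_le_sum fun M _ => ?_
    rw [updateWeight, if_pos hj]
    split_ifs
    · rw [hstage]
      exact (by ring : _ = _).le
    · simp
  · rw [if_neg hj] at hexp
    -- each choice of a set `T` of minus bare children has the same weight
    set t : Finset V → ℝ := fun M => if degIn G D x = 1 then
      (if degIn G M x = 0 then ε / 2 else ε) else ε ^ 2 / 4 + ε ^ 2 * κ with ht
    have hT : ∀ T ∈ (bareKids G A' π x).powersetCard (2 - degIn G D x),
        minusSum G p E ε (A.erase x) (D ∪ T) O' ≤ r * ∑ M ∈ labels G P D, q M * f M * t M := by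
      intro T hT
      obtain ⟨hTb, hTc⟩ := mem_powersetCard.1 hT
      refine (IH T hTb).trans (mul_le_mul_of_nonneg_left ?_ hr)
      have hDT : Disjoint D T := disjoint_right.2 fun z hz => (hbare z (hTb hz)).2.2
      have hTN : T ⊆ G.neighborFinset x := fun z hz =>
        (G.mem_neighborFinset _ _).2 (hbareadj z (hTb hz))
      have hTP : ∀ a ∈ P, degIn G T a = 0 := by
        intro a ha
        by_contra h
        obtain ⟨z, hz, haz⟩ := degIn_pos.1 (Nat.pos_of_ne_zero h)
        exact hbareP z (hTb hz) a ha haz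
      have hsub : ∀ M ∈ labels G (insert x P) (D ∪ T), Disjoint M T ∨ T ⊆ M := by
        intro M hM
        obtain ⟨h1, h2⟩ := mem_labels.1 hM
        rcases h2 x (mem_insert_self _ _) with h | h
        · left
          refine disjoint_right.2 fun z hz hzM => ?_
          exact (degIn_pos.2 ⟨z, hzM, hbareadj z (hTb hz)⟩).ne' h
        · right
          have hss : G.neighborFinset x ∩ M ⊆ G.neighborFinset x ∩ (D ∪ T) :=
            inter_subset_inter_left h1
          have := eq_of_subset_of_card_le hss (le_of_eq h.symm)
          intro z hz
          have hz' : z ∈ G.neighborFinset x ∩ (D ∪ T) :=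
            mem_inter.2 ⟨hTN hz, mem_union_right _ hz⟩
          rw [← this] at hz'
          exact (mem_inter.1 hz').2
      have hinter : ∀ M ∈ labels G (insert x P) (D ∪ T), M ⊆ D ∪ T ∧ M ∩ D ∈ labels G P D := by
        intro M hM
        obtain ⟨h1, h2⟩ := mem_labels.1 hM
        refine ⟨h1, mem_labels.2 ⟨inter_subset_right, fun a ha => ?_⟩⟩
        have e : degIn G (M ∩ D) a = degIn G M a := by
          have : G.neighborFinset a ∩ (M ∩ D) = G.neighborFinset a ∩ M := by
            ext z
            simp only [mem_inter, SimpleGraph.mem_neighborFinset]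
            refine ⟨fun h => ⟨h.1, h.2.1⟩, fun h => ⟨h.1, h.2, ?_⟩⟩
            refine (mem_union.1 (h1 h.2)).resolve_right fun hzT => ?_
            exact hbareP z (hTb hzT) a ha h.1
          rw [degIn, this, degIn]
        have := h2 a (mem_insert_of_mem ha)
        rwa [degIn_union_of_disjoint hDT, hTP a ha, add_zero, ← e] at this
      refine (sum_labels_union_le (fun M => stageWeight_nonneg hreg _ _ M)
        (fun M hM => (mem_labels.1 hM).1) hDT hinter hsub).trans ?_
      refine sum_le_sum fun M hM => ?_
      have hMD := (mem_labels.1 hM).1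
      have hMT : Disjoint M T := hDT.mono_left hMD
      -- the weights after the step
      have hsw : ∀ N, (N = M ∨ N = M ∪ T) → stageWeight G d K ε κ c₂ A' R π (insert x P) (D ∪ T) N =
          q M * f M * ((∏ y ∈ T, siteWeight ε κ R N y) * joinWeight κ c₂ (degIn G N x)) := by
        intro N hN
        have hmem : ∀ z, z ∉ T → (z ∈ N ↔ z ∈ M) := by
          intro z hz
          rcases hN with rfl | rfl
          · rfl
          · simp [hz]
        have hmem' : ∀ z, z ∉ T → (z ∈ D ∪ T ↔ z ∈ D) := by
          intro z hz
          simp [hz]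
        have hkidsT : ∀ a ∈ A', ∀ z ∈ kids G A' π a, z ∉ T := by
          intro a ha z hz hzT
          have hz2 := hTb hzT
          simp only [kids, bareKids, mem_filter] at hz hz2
          exact hz2.2.2 hz.2.2
        have e1 : ∏ y ∈ D ∪ T, siteWeight ε κ R N y =
            (∏ y ∈ D, siteWeight ε κ R M y) * ∏ y ∈ T, siteWeight ε κ R N y := by
          rw [prod_union hDT]
          congr 1
          exact prod_congr rfl fun y hy => siteWeight_congr (hmem y (disjoint_left.1 hDT hy))
        have e2 : ∏ y ∈ (insert x P).image π \ R, frontWeight d K ε κ (D ∪ T) N y =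
            ∏ y ∈ (insert x P).image π \ R, frontWeight d K ε κ D M y := by
          refine prod_congr rfl fun y hy => ?_
          have hyT : y ∉ T := fun h => (hbare y (hTb h)).2.1 (mem_sdiff.1 hy).1
          exact frontWeight_congr (hmem y hyT) (hmem' y hyT)
        have e3 : ∀ a ∈ A', ∏ c ∈ kids G A' π a, (frontWeight d K ε κ (D ∪ T) N c)⁻¹ =
            ∏ c ∈ kids G A' π a, (frontWeight d K ε κ D M c)⁻¹ := by
          intro a ha
          refine prod_congr rfl fun c hc => ?_
          have hcT := hkidsT a ha c hc
          rw [frontWeight_congr (hmem c hcT) (hmem' c hcT)]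
        have e4 : ∏ a ∈ P, vertexWeight G d K ε κ c₂ A' π (D ∪ T) N a =
            ∏ a ∈ P, vertexWeight G d K ε κ c₂ A' π D M a := by
          refine prod_congr rfl fun a ha => ?_
          rw [vertexWeight, vertexWeight, e3 a (hPA ha)]
          congr 2
          rcases hN with rfl | rfl
          · rfl
          · rw [degIn_union_of_disjoint hMT, hTP a ha, add_zero]
        rw [stageWeight, prod_insert hxP, e1, e2, e4, vertexWeight, e3 x hxA']
        simp only [hq, hf]
        ring
      have hnoR : ∀ z ∈ T, z ∉ R := fun z hz => (hbare z (hTb hz)).1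
      have hp1 : ∏ y ∈ T, siteWeight ε κ R M y = (ε / 2) ^ T.card := by
        rw [← prod_const]
        refine prod_congr rfl fun y hy => ?_
        rw [siteWeight, if_neg (disjoint_right.1 hMT hy)]
        ring
      have hp2 : ∏ y ∈ T, siteWeight ε κ R (M ∪ T) y = (ε * κ) ^ T.card := by
        rw [← prod_const]
        refine prod_congr rfl fun y hy => ?_
        rw [siteWeight, if_pos (mem_union_right _ hy), if_neg (hnoR y hy)]
      have hd1 : degIn G (M ∪ T) x = degIn G M x + T.card := by
        rw [degIn_union_of_disjoint hMT, degIn_eq_card_of_subset hTN]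
      have hd2 : degIn G (D ∪ T) x = 2 := by
        rw [degIn_union_of_disjoint hDT, degIn_eq_card_of_subset hTN, hTc]
        omega
      have hcompat : ∀ N, N ∈ labels G (insert x P) (D ∪ T) →
          degIn G N x = 0 ∨ degIn G N x = 2 := fun N hN => by
        have := (mem_labels.1 hN).2 x (mem_insert_self _ _)
        rwa [hd2] at this
      have hqf := mul_nonneg (hq0 M) (hf0 M)
      have hj0 : joinWeight κ c₂ 0 = 1 := by simp [joinWeight]
      have hj2 : joinWeight κ c₂ 2 = 1 / κ := by simp [joinWeight]
      have hdm := hle M hM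
      by_cases hj1 : degIn G D x = 1
      · have hTc1 : T.card = 1 := by omega
        by_cases hm : degIn G M x = 0
        · have : M ∪ T ∉ labels G (insert x P) (D ∪ T) := fun h => by
            have := hcompat _ h
            omega
          rw [if_neg this, add_zero, hsw M (Or.inl rfl), hp1, hm, hj0]
          simp only [ht, if_pos hj1, hm, if_true, hTc1]
          split_ifs
          · simp
          · exact mul_nonneg hqf (by positivity)
        · have : M ∉ labels G (insert x P) (D ∪ T) := fun h => by
            have := hcompat _ h
            omega
          rw [if_neg this, zero_add, hsw _ (Or.inr rfl), hp2, hd1,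
            show degIn G M x + T.card = 2 by omega, hj2]
          simp only [ht, if_pos hj1, if_neg hm, hTc1]
          split_ifs
          · exact (by field_simp : _ = _).le
          · exact mul_nonneg hqf hε.le
      · have hj00 : degIn G D x = 0 := by omega
        have hTc2 : T.card = 2 := by omega
        have hm : degIn G M x = 0 := by omega
        simp only [ht, if_neg hj1]
        rw [mul_add]
        refine add_le_add ?_ ?_
        · rw [hsw M (Or.inl rfl), hp1, hm, hj0, hTc2]
          split_ifs
          · exact (by ring : _ = _).le
          · exact mul_nonneg hqf (by positivity)
        · rw [hsw _ (Or.inr rfl), hp2, hd1, hm, hTc2, hj2]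
          split_ifs
          · exact (by field_simp : _ = _).le
          · exact mul_nonneg hqf (by positivity)
    have hsum := sum_le_card_nsmul _ _ _ hT
    rw [nsmul_eq_mul, card_powersetCard] at hsum
    have hcard : (bareKids G A' π x).card ≤ d := by
      refine le_trans (card_le_card (filter_subset _ _)) ?_
      rw [G.card_neighborFinset_eq_degree]
      exact hdeg x
    have ht0 : ∀ M, 0 ≤ t M := by
      intro M
      simp only [ht]
      split_ifs <;> positivity
    have hbase : minusSum G p E ε (A.erase x) D O' ≤ r * ∑ M ∈ labels G P D, q M * f M := by
      refine IH0.trans (mul_le_mul_of_nonneg_left ?_ hr)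
      refine (sum_le_sum_of_subset_of_nonneg (t := labels G P D)
        (fun M hM => ((hlab M).1 hM).1) fun M _ _ => stageWeight_nonneg hreg _ _ M).trans ?_
      refine sum_le_sum fun M hM => ?_
      have := hle M hM
      have h1 : degIn G M x = 0 ∨ degIn G M x = 1 := by omega
      rw [hstage]
      rcases h1 with h1 | h1 <;> rw [h1] <;> simp [joinWeight]
    have hchoose : (((bareKids G A' π x).card.choose (2 - degIn G D x) : ℕ) : ℝ) ≤
        if degIn G D x = 1 then (d : ℝ) else (d : ℝ) ^ 2 := by
      split_ifs with hj1
      · rw [hj1, show 2 - 1 = 1 from rfl, Nat.choose_one_right]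
        exact_mod_cast hcard
      · rw [show degIn G D x = 0 by omega]
        calc (((bareKids G A' π x).card.choose 2 : ℕ) : ℝ)
            ≤ (((bareKids G A' π x).card ^ 2 : ℕ) : ℝ) := by
              exact_mod_cast Nat.choose_le_pow _ 2
          _ ≤ (d : ℝ) ^ 2 := by
            rw [Nat.cast_pow]
            exact pow_le_pow_left₀ (Nat.cast_nonneg _) (Nat.cast_le.2 hcard) 2
    have hS0 : 0 ≤ r * ∑ M ∈ labels G P D, q M * f M * t M :=
      mul_nonneg hr (sum_nonneg fun M _ => mul_nonneg (mul_nonneg (hq0 M) (hf0 M)) (ht0 M))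
    calc minusSum G p E ε A D O'
        ≤ ε / 2 * (r * ∑ M ∈ labels G P D, q M * f M) +
          (if degIn G D x = 1 then (d : ℝ) else (d : ℝ) ^ 2) *
            (r * ∑ M ∈ labels G P D, q M * f M * t M) := by
          refine hexp.trans (add_le_add ?_ (hsum.trans ?_))
          · exact mul_le_mul_of_nonneg_left hbase (by positivity)
          · exact mul_le_mul_of_nonneg_right hchoose hS0
      _ = r * ∑ M ∈ labels G P D, q M * f M *
          (ε / 2 + (if degIn G D x = 1 then (d : ℝ) else (d : ℝ) ^ 2) * t M) := by
          rw [mul_left_comm, mul_left_comm _ r, ← mul_add, mul_sum, mul_sum, ← sum_add_distrib]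
          congr 1
          refine sum_congr rfl fun M _ => ?_
          ring
      _ = _ := by
          congr 1
          refine sum_congr rfl fun M _ => ?_
          rw [mul_assoc]
          congr 2
          rw [updateWeight, if_neg hj]
          simp only [ht]
          split_ifs <;> rfl

end IsRooted

end Exploration

/-! ### The whole exploration -/

section Exploration

variable {V : Type*} [DecidableEq V] {G : SimpleGraph V} [G.LocallyFinite]

namespace IsRooted

variable {d : ℕ} {K ε κ c₂ : ℝ} {o : V} {A' R O : Finset V} {π : V → V} {rk : V → ℕ}

/-- The parents which are not roots are exactly the children continuing the cluster, each of a
unique vertex. -/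
theorem prod_image_sdiff (hR : IsRooted G o A' R O π rk) (f : V → ℝ) :
    ∏ y ∈ A'.image π \ R, f y = ∏ x ∈ A', ∏ c ∈ kids G A' π x, f c := by
  have hunion : A'.image π \ R = A'.biUnion (kids G A' π) := by
    ext c
    rw [mem_sdiff, mem_image, mem_biUnion]
    constructor
    · rintro ⟨⟨x, hx, rfl⟩, hc⟩
      obtain ⟨x', hx', hadj, hne⟩ := (hR.par x hx).resolve_left hc
      refine ⟨x', hx', ?_⟩
      simp only [kids, mem_filter, SimpleGraph.mem_neighborFinset]
      refine ⟨hadj, Ne.symm hne, ?_⟩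
      have hxx : x ≠ x' := by
        rintro rfl
        exact hne rfl
      have : ({x, x'} : Finset V) ⊆ G.neighborFinset (π x) ∩ A' := by
        intro z hz
        rw [mem_inter, SimpleGraph.mem_neighborFinset]
        rcases mem_insert.1 hz with rfl | hz
        · exact ⟨(hR.adj _ hx).symm, hx⟩
        · rw [mem_singleton] at hz
          subst hz
          exact ⟨hadj.symm, hx'⟩
      exact (card_pair hxx).symm.le.trans (card_le_card this)
    · rintro ⟨x, hx, hc⟩
      obtain ⟨x', hx', -, h, -⟩ := hR.exists_of_mem_kids hx hc
      refine ⟨⟨x', hx', h⟩, fun hcR => ?_⟩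
      simp only [kids, mem_filter, SimpleGraph.mem_neighborFinset] at hc
      exact hc.2.1 (hR.root c hcR x hx hc.1).symm
  rw [hunion, prod_biUnion]
  intro x hx x' hx' hne
  refine disjoint_left.2 fun c hc hc' => ?_
  simp only [kids, mem_filter, SimpleGraph.mem_neighborFinset] at hc hc'
  exact hc'.2.1 (hR.child x hx c hc.1 hc.2.1 x' hx' hc'.1 (Ne.symm hne)).1.symm

/-- When everything has been explored, all front weights have been used up. -/
theorem stageWeight_self (hR : IsRooted G o A' R O π rk) (hreg : Regime d K ε κ c₂)
    (D M : Finset V) : stageWeight G d K ε κ c₂ A' R π A' D M =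
      (∏ y ∈ D, siteWeight ε κ R M y) * ∏ x ∈ A', joinWeight κ c₂ (degIn G M x) := by
  rw [stageWeight, hR.prod_image_sdiff]
  simp only [vertexWeight]
  rw [prod_mul_distrib, mul_assoc]
  congr 1
  rw [mul_left_comm, ← prod_mul_distrib]
  have h1 : ∏ x ∈ A', ((∏ c ∈ kids G A' π x, frontWeight d K ε κ D M c) *
      ∏ c ∈ kids G A' π x, (frontWeight d K ε κ D M c)⁻¹) = 1 := by
    refine prod_eq_one fun x _ => ?_
    rw [← prod_mul_distrib]
    exact prod_eq_one fun c _ => mul_inv_cancel₀ (frontWeight_pos hreg _ _ _).ne'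
  rw [h1, mul_one]

/-- If the bare children of `x` are not in `D`, the neighbours of `x` in a subset of `D` are children
continuing the cluster, and possibly the parent. -/
theorem degIn_eq_kids (hR : IsRooted G o A' R O π rk) {D S : Finset V} {x : V} (hx : x ∈ A')
    (hbare : ∀ z ∈ bareKids G A' π x, z ∉ D) (hS : S ⊆ D) :
    degIn G S x = #{c ∈ kids G A' π x | c ∈ S} + if π x ∈ S then 1 else 0 := by
  have h1 : G.neighborFinset x ∩ S =
      {c ∈ kids G A' π x | c ∈ S} ∪ (if π x ∈ S then {π x} else ∅) := by
    ext z
    simp only [mem_inter, mem_union, mem_filter, SimpleGraph.mem_neighborFinset]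
    constructor
    · rintro ⟨hxz, hz⟩
      rcases mem_neighbor_cases (A := A') (π := π) hxz with rfl | h | h
      · right; rw [if_pos hz]; exact mem_singleton_self _
      · exact Or.inl ⟨h, hz⟩
      · exact absurd (hS hz) (hbare z h)
    · rintro (⟨hz, hzS⟩ | hz)
      · simp only [kids, mem_filter, SimpleGraph.mem_neighborFinset] at hz
        exact ⟨hz.1, hzS⟩
      · split_ifs at hz with hy
        · rw [mem_singleton] at hz
          subst hz
          exact ⟨hR.adj x hx, hy⟩
        · simp at hz
  rw [degIn, h1, card_union_of_disjoint]
  · split_ifs <;> simp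
  · refine disjoint_left.2 fun z hz hz' => ?_
    split_ifs at hz'
    · rw [mem_singleton] at hz'
      subst hz'
      simp [kids] at hz
    · simp at hz'

theorem card_kids_split {D M S : Finset V} (hM : M ⊆ D) :
    #{c ∈ S | c ∈ D} = #{c ∈ S | c ∈ M} + #{c ∈ S | c ∉ M ∧ c ∈ D} ∧
    S.card = #{c ∈ S | c ∈ M} + #{c ∈ S | c ∉ M ∧ c ∈ D} + #{c ∈ S | c ∉ M ∧ c ∉ D} := by
  have h1 : #{c ∈ S | c ∈ D} = #{c ∈ S | c ∈ M} + #{c ∈ S | c ∉ M ∧ c ∈ D} := by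
    rw [← card_filter_add_card_filter_not (s := {c ∈ S | c ∈ D}) (fun c => c ∈ M),
      filter_filter, filter_filter]
    congr 2
    · exact filter_congr fun c _ => ⟨fun h => h.2, fun h => ⟨hM h, h⟩⟩
    · exact filter_congr fun c _ => and_comm
  refine ⟨h1, ?_⟩
  rw [← h1, ← card_filter_add_card_filter_not (s := S) (fun c => c ∈ D)]
  congr 2
  exact filter_congr fun c _ => ⟨fun h => ⟨fun h' => h (hM h'), h⟩, fun h => h.2⟩

/-- The bound obtained by exploring the vertices of a rooted union of clusters, those farthest from
their roots first. `A` is the set of vertices still to be explored, `D` the set of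
vertices demanded to be minus at the previous time, and `O'` the set of those demanded to be
plus. -/
theorem exploration_bound (hR : IsRooted G o A' R O π rk) (hreg : Regime d K ε κ c₂)
    (hdeg : ∀ v, G.degree v ≤ d) {p : Finset V → ℝ} (hp : ∀ U, 0 ≤ p U) {E : Finset V}
    {Γ : ℝ} (hΓ : 0 ≤ Γ)
    (hfinal : ∀ D O', R ⊆ D → D ⊆ nbhd G A' → O ⊆ O' → minusSum G p E ε ∅ D O' ≤
      Γ * ∑ M ∈ labels G A' D,
        (∏ y ∈ D, siteWeight ε κ R M y) * ∏ x ∈ A', joinWeight κ c₂ (degIn G M x))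
    (n : ℕ) : ∀ A D O' : Finset V, A.card = n → A ⊆ A' →
      (∀ x ∈ A, ∀ z ∈ A' \ A, rk x ≤ rk z) → R ⊆ D → D ⊆ nbhd G A' → O ⊆ O' →
      (∀ x ∈ A' \ A, π x ∈ D ∪ O') →
      (∀ z ∈ D, z ∈ R ∨ z ∈ (A' \ A).image π ∨ ∃ a ∈ A' \ A, ∀ b ∈ A', G.Adj b z → b = a) →
      minusSum G p E ε A D O' ≤ Γ * (∏ x ∈ A, ε * K ^ irregularity G A' R π x) *
        ∑ M ∈ labels G (A' \ A) D, stageWeight G d K ε κ c₂ A' R π (A' \ A) D M := by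
  have hε := hreg.eps_pos
  have hκ := hreg.kappa_pos
  have hK : 0 < K := lt_of_lt_of_le one_pos hreg.one_le_K
  induction n with
  | zero =>
    intro A D O' hA _ _ hRD hDn hO _ _
    rw [card_eq_zero] at hA
    subst hA
    rw [sdiff_empty, prod_empty, mul_one]
    refine (hfinal D O' hRD hDn hO).trans (mul_le_mul_of_nonneg_left ?_ hΓ)
    exact sum_le_sum fun M _ => (hR.stageWeight_self hreg D M).ge
  | succ n ih =>
    intro A D O' hcard hAA hord hRD hDn hO hdec hfresh
    obtain ⟨x, hx, hxmax⟩ := exists_max_image A rk (card_pos.1 (by omega))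
    have hxA' := hAA hx
    set P := A' \ A with hP
    have hPA : P ⊆ A' := sdiff_subset
    have hxP : x ∉ P := fun h => (mem_sdiff.1 h).2 hx
    have hP' : A' \ A.erase x = insert x P := by
      ext z
      simp only [hP, mem_sdiff, mem_erase, mem_insert]
      constructor
      · rintro ⟨hz, h⟩
        by_cases hzx : z = x
        · exact Or.inl hzx
        · exact Or.inr ⟨hz, fun hzA => h ⟨hzx, hzA⟩⟩
      · rintro (rfl | ⟨hz, h⟩)
        · exact ⟨hxA', fun h => h.1 rfl⟩
        · exact ⟨hz, fun h' => h h'.2⟩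
    have hmax : ∀ z ∈ A', rk x < rk z → z ∈ P := fun z hz hlt =>
      mem_sdiff.2 ⟨hz, fun hzA => absurd (hxmax z hzA) (not_le.2 hlt)⟩
    have hord' : ∀ a ∈ A.erase x, ∀ z ∈ insert x P, rk a ≤ rk z := by
      intro a ha z hz
      rcases mem_insert.1 hz with rfl | hz
      · exact hxmax a (mem_of_mem_erase ha)
      · exact hord a (mem_of_mem_erase ha) z hz
    have hcard' : (A.erase x).card = n := by rw [card_erase_of_mem hx, hcard]; rfl
    set r : ℝ := Γ * ∏ z ∈ A.erase x, ε * K ^ irregularity G A' R π z with hr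
    have hr0 : 0 ≤ r := mul_nonneg hΓ (prod_nonneg fun _ _ => by positivity)
    have hrA : Γ * ∏ z ∈ A, ε * K ^ irregularity G A' R π z =
        r * (ε * K ^ irregularity G A' R π x) := by
      rw [← mul_prod_erase A _ hx, hr]; ring
    have hadj := hR.adj x hxA'
    -- the induction hypothesis in the form needed for `process_vertex`
    have IH : ∀ D₁ O₁ : Finset V, R ⊆ D₁ → D₁ ⊆ nbhd G A' → O ⊆ O₁ →
        (∀ z ∈ insert x P, π z ∈ D₁ ∪ O₁) →
        (∀ z ∈ D₁, z ∈ R ∨ z ∈ (insert x P).image π ∨ ∃ a ∈ P, ∀ b ∈ A', G.Adj b z → b = a) →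
        minusSum G p E ε A D₁ O₁ ≤ r * ∑ M ∈ labels G P D₁,
      ((∏ y ∈ D₁, siteWeight ε κ R M y) *
        (∏ y ∈ (insert x P).image π \ R, frontWeight d K ε κ D₁ M y) *
        ∏ x ∈ P, vertexWeight G d K ε κ c₂ A' π D₁ M x) *
      ((∏ c ∈ kids G A' π x, (frontWeight d K ε κ D₁ M c)⁻¹) *
        updateWeight d ε κ c₂ (degIn G D₁ x) (degIn G M x)) := by
      intro D₁ O₁ hRD₁ hDn₁ hO₁ hdec₁ hfresh₁
      refine hR.process_vertex hreg hdeg hp hAA hPA hx hxP hmax hdec₁ hfresh₁ hr0 ?_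
      intro T hT
      have := ih (A.erase x) (D₁ ∪ T) O₁ hcard' ((erase_subset _ _).trans hAA) (by rwa [hP'])
        (hRD₁.trans subset_union_left) (union_subset hDn₁ fun z hz => ?_) hO₁ ?_ ?_
      · rwa [hP'] at this
      · have := hT hz
        simp only [bareKids, mem_filter, SimpleGraph.mem_neighborFinset] at this
        exact mem_nbhd.2 ⟨x, hxA', this.1⟩
      · rw [hP']
        intro z hz
        exact union_subset_union_left subset_union_left (hdec₁ z hz)
      · rw [hP']
        intro z hz
        rcases mem_union.1 hz with hz | hz
        · rcases hfresh₁ z hz with h | h | ⟨a, ha, h⟩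
          · exact Or.inl h
          · exact Or.inr (Or.inl h)
          · exact Or.inr (Or.inr ⟨a, mem_insert_of_mem ha, h⟩)
        · exact Or.inr (Or.inr ⟨x, mem_insert_self _ _, fun b hb hbz =>
            eq_of_mem_bareKids hxA' (hT hz) hb hbz⟩)
    rw [hrA, mul_assoc, mul_sum]
    have himage : (insert x P).image π = insert (π x) (P.image π) := image_insert _ _ _
    have hfresh' : ∀ z ∈ D, z ∈ R ∨ z ∈ (insert x P).image π ∨
        ∃ a ∈ P, ∀ b ∈ A', G.Adj b z → b = a := by
      intro z hz
      rcases hfresh z hz with h | h | h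
      · exact Or.inl h
      · exact Or.inr (Or.inl (image_subset_image (subset_insert _ _) h))
      · exact Or.inr (Or.inr h)
    have hbareD : ∀ z ∈ bareKids G A' π x, z ∉ D := fun z hz =>
      (hR.notMem_of_mem_bareKids hPA hxA' hxP hfresh' hz).2.2
    by_cases hy : π x ∈ R ∨ π x ∈ P.image π
    · -- the parent has already been decided
      have hdecx : π x ∈ D ∪ O' := by
        rcases hy with h | h
        · exact mem_union_left _ (hRD h)
        · obtain ⟨a, ha, hax⟩ := mem_image.1 h
          exact hax ▸ hdec a ha
      have hirr : irregularity G A' R π x = 2 * ((kids G A' π x).card - 1) + 2 := by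
        rw [irregularity, if_pos]
        refine hy.imp id fun h => ?_
        obtain ⟨a, ha, hax⟩ := mem_image.1 h
        exact ⟨a, hPA ha, fun e => hxP (e ▸ ha), hax⟩
      have himage' : (insert x P).image π \ R = P.image π \ R := by
        rw [himage]
        ext z
        simp only [mem_sdiff, mem_insert]
        constructor
        · rintro ⟨rfl | h, h'⟩
          · exact ⟨hy.resolve_left h', h'⟩
          · exact ⟨h, h'⟩
        · exact fun h => ⟨Or.inr h.1, h.2⟩
      refine (IH D O' hRD hDn hO (forall_mem_insert _ _ _ |>.2 ⟨hdecx, hdec⟩) hfresh').trans ?_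
      refine mul_le_mul_of_nonneg_left (sum_le_sum fun M hM => ?_) hr0
      have hMD := (mem_labels.1 hM).1
      rw [himage', ← stageWeight, mul_comm (ε * _)]
      refine mul_le_mul_of_nonneg_left ?_ (stageWeight_nonneg hreg _ _ _)
      obtain ⟨e1, e2⟩ := card_kids_split (S := kids G A' π x) hMD
      rw [prod_frontWeight_inv, hR.degIn_eq_kids hxA' hbareD (Subset.refl D),
        hR.degIn_eq_kids hxA' hbareD hMD, hirr, e1, e2]
      refine update_decided hreg _ _ _ _ _ ?_ ?_
      · by_cases h : π x ∈ M
        · simp [h, hMD h]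
        · simp [h]
      · split_ifs <;> simp
    · -- the parent is decided now
      push Not at hy
      have hyD : π x ∉ D := by
        intro h
        rcases hfresh _ h with h | h | ⟨a, ha, h⟩
        · exact hy.1 h
        · exact hy.2 h
        · exact hxP (h x hxA' hadj ▸ ha)
      have hyP : ∀ a ∈ P, ¬ G.Adj a (π x) := by
        intro a ha hay
        have hne : π x ≠ π a := fun h => hy.2 (h ▸ mem_image_of_mem π ha)
        have := hR.child a (hPA ha) (π x) hay hne x hxA' hadj (fun h => hxP (h ▸ ha))
        exact absurd (hord x hx a ha) (not_le.2 this.2)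
      have hykids : ∀ a ∈ insert x P, π x ∉ kids G A' π a := by
        intro a ha h
        rcases mem_insert.1 ha with rfl | ha
        · simp [kids] at h
        · simp only [kids, mem_filter, SimpleGraph.mem_neighborFinset] at h
          exact hyP a ha h.1
      have himage' : (insert x P).image π \ R = insert (π x) (P.image π \ R) := by
        rw [himage, insert_sdiff_of_notMem _ hy.1]
      have hynot : π x ∉ P.image π \ R := fun h => hy.2 (mem_sdiff.1 h).1
      have hDy : Disjoint D {π x} := disjoint_singleton_right.2 hyD
      rw [minusSum_eq_add p E ε A D O' (π x), insert_eq, union_comm]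
      have hfreshy : ∀ z ∈ D ∪ {π x}, z ∈ R ∨ z ∈ (insert x P).image π ∨
          ∃ a ∈ P, ∀ b ∈ A', G.Adj b z → b = a := by
        intro z hz
        rcases mem_union.1 hz with hz | hz
        · exact hfresh' z hz
        · rw [mem_singleton] at hz
          subst hz
          exact Or.inr (Or.inl (mem_image_of_mem π (mem_insert_self _ _)))
      have B1 := IH (D ∪ {π x}) O' (hRD.trans subset_union_left)
        (union_subset hDn (singleton_subset_iff.2 (mem_nbhd.2 ⟨x, hxA', hadj⟩))) hO
        (forall_mem_insert _ _ _ |>.2 ⟨by simp, fun z hz =>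
          union_subset_union_left subset_union_left (hdec z hz)⟩) hfreshy
      have B2 := IH D (insert (π x) O') hRD hDn (hO.trans (subset_insert _ _))
        (forall_mem_insert _ _ _ |>.2 ⟨by simp, fun z hz =>
          union_subset_union_right (subset_insert _ _) (hdec z hz)⟩) hfresh'
      refine (add_le_add B1 B2).trans ?_
      rw [← mul_add]
      refine mul_le_mul_of_nonneg_left ?_ hr0
      refine (add_le_add (sum_labels_union_le (L := labels G P D) (fun M => ?_)
        (fun M hM => (mem_labels.1 hM).1) hDy ?_ ?_) le_rfl).trans ?_
      · refine mul_nonneg (mul_nonneg (mul_nonneg (prod_nonneg fun _ _ => siteWeight_nonneg hreg _ _)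
          (prod_nonneg fun _ _ => (frontWeight_pos hreg _ _ _).le))
          (prod_nonneg fun _ _ => vertexWeight_nonneg hreg _ _ _)) (mul_nonneg
          (prod_nonneg fun _ _ => inv_nonneg.2 (frontWeight_pos hreg _ _ _).le)
          (updateWeight_nonneg hreg _ _))
      · intro M hM
        obtain ⟨h1, h2⟩ := mem_labels.1 hM
        refine ⟨h1, mem_labels.2 ⟨inter_subset_right, fun a ha => ?_⟩⟩
        have e : ∀ S, S ⊆ D ∪ {π x} → degIn G S a = degIn G (S ∩ D) a := by
          intro S hS
          rw [degIn, degIn]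
          congr 1
          ext z
          simp only [mem_inter, SimpleGraph.mem_neighborFinset]
          refine ⟨fun h => ⟨h.1, h.2, ?_⟩, fun h => ⟨h.1, h.2.1⟩⟩
          refine (mem_union.1 (hS h.2)).resolve_right fun hz => ?_
          rw [mem_singleton] at hz
          exact hyP a ha (hz ▸ h.1)
        have := h2 a ha
        rwa [e M h1, e _ (Subset.refl _), union_inter_cancel_left] at this
      · intro M _
        by_cases h : π x ∈ M
        · exact Or.inr (singleton_subset_iff.2 h)
        · exact Or.inl (disjoint_singleton_right.2 h)
      rw [← sum_add_distrib]
      refine sum_le_sum fun M hM => ?_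
      have hMD := (mem_labels.1 hM).1
      have hyM : π x ∉ M := fun h => hyD (hMD h)
      obtain ⟨e1, e2⟩ := card_kids_split (S := kids G A' π x) hMD
      have hcommon : ∀ D₁ N, (∀ z, z ≠ π x → (z ∈ N ↔ z ∈ M)) →
          (∀ z, z ≠ π x → (z ∈ D₁ ↔ z ∈ D)) →
          (∏ y ∈ D, siteWeight ε κ R N y) *
            (∏ y ∈ (insert x P).image π \ R, frontWeight d K ε κ D₁ N y) *
            ∏ x ∈ P, vertexWeight G d K ε κ c₂ A' π D₁ N x =
          stageWeight G d K ε κ c₂ A' R π P D M * frontWeight d K ε κ D₁ N (π x) ∧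
          ∏ c ∈ kids G A' π x, (frontWeight d K ε κ D₁ N c)⁻¹ =
            ∏ c ∈ kids G A' π x, (frontWeight d K ε κ D M c)⁻¹ := by
        intro D₁ N hN hD₁
        have hk : ∀ a ∈ insert x P, ∏ c ∈ kids G A' π a, (frontWeight d K ε κ D₁ N c)⁻¹ =
            ∏ c ∈ kids G A' π a, (frontWeight d K ε κ D M c)⁻¹ := by
          intro a ha
          refine prod_congr rfl fun c hc => ?_
          have hcx : c ≠ π x := by
            rintro rfl
            exact hykids a ha hc
          rw [frontWeight_congr (hN c hcx) (hD₁ c hcx)]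
        refine ⟨?_, hk x (mem_insert_self _ _)⟩
        rw [himage', prod_insert hynot, stageWeight]
        have f1 : ∏ y ∈ D, siteWeight ε κ R N y = ∏ y ∈ D, siteWeight ε κ R M y :=
          prod_congr rfl fun y hyy => siteWeight_congr (hN y fun h => hyD (h ▸ hyy))
        have f2 : ∏ y ∈ P.image π \ R, frontWeight d K ε κ D₁ N y =
            ∏ y ∈ P.image π \ R, frontWeight d K ε κ D M y :=
          prod_congr rfl fun y hyy => frontWeight_congr (hN y fun h => hynot (h ▸ hyy))
            (hD₁ y fun h => hynot (h ▸ hyy))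
        have f3 : ∏ a ∈ P, vertexWeight G d K ε κ c₂ A' π D₁ N a =
            ∏ a ∈ P, vertexWeight G d K ε κ c₂ A' π D M a := by
          refine prod_congr rfl fun a ha => ?_
          rw [vertexWeight, vertexWeight, hk a (mem_insert_of_mem ha)]
          congr 2
          rw [degIn, degIn]
          congr 1
          ext z
          simp only [mem_inter, SimpleGraph.mem_neighborFinset]
          refine and_congr_right fun haz => hN z ?_
          rintro rfl
          exact hyP a ha haz
        rw [f1, f2, f3]
        ring
      have hDM : degIn G D x = #{c ∈ kids G A' π x | c ∈ M} +
          #{c ∈ kids G A' π x | c ∉ M ∧ c ∈ D} := by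
        rw [hR.degIn_eq_kids hxA' hbareD (Subset.refl D), if_neg hyD, e1, add_zero]
      have hMM : degIn G M x = #{c ∈ kids G A' π x | c ∈ M} := by
        rw [hR.degIn_eq_kids hxA' hbareD hMD, if_neg hyM, add_zero]
      have hsing : degIn G {π x} x = 1 :=
        degIn_eq_card_of_subset (by simpa using hadj)
      have hDy1 : degIn G (D ∪ {π x}) x = degIn G D x + 1 := by
        rw [degIn_union_of_disjoint hDy, hsing]
      have hMy1 : degIn G (M ∪ {π x}) x = degIn G M x + 1 := by
        rw [degIn_union_of_disjoint (hDy.mono_left hMD), hsing]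
      obtain ⟨g1, g1'⟩ := hcommon (D ∪ {π x}) M (fun _ _ => Iff.rfl) (fun z hz => by simp [hz])
      obtain ⟨g2, g2'⟩ := hcommon (D ∪ {π x}) (M ∪ {π x}) (fun z hz => by simp [hz])
        (fun z hz => by simp [hz])
      obtain ⟨g3, g3'⟩ := hcommon D M (fun _ _ => Iff.rfl) (fun _ _ => Iff.rfl)
      have hS := stageWeight_nonneg (G := G) (A := A') (R := R) (π := π) hreg P D M
      set S := stageWeight G d K ε κ c₂ A' R π P D M with hSdef
      set F := ∏ c ∈ kids G A' π x, (frontWeight d K ε κ D M c)⁻¹ with hF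
      have hF0 : 0 ≤ F := prod_nonneg fun _ _ => inv_nonneg.2 (frontWeight_pos hreg _ _ _).le
      have hnum := update_new hreg (#{c ∈ kids G A' π x | c ∈ M})
        (#{c ∈ kids G A' π x | c ∉ M ∧ c ∈ D}) (#{c ∈ kids G A' π x | c ∉ M ∧ c ∉ D})
      rw [← prod_frontWeight_inv, ← hF, ← e2, ← hDM, ← hMM] at hnum
      have hle2 : K ^ (2 * ((kids G A' π x).card - 1)) ≤ K ^ irregularity G A' R π x :=
        pow_le_pow_right₀ hreg.one_le_K (by rw [irregularity]; omega)
      have t1 : siteWeight ε κ R M (π x) * frontWeight d K ε κ (D ∪ {π x}) M (π x) =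
          1 / (2 * K) := by
        rw [siteWeight, frontWeight, if_neg hyM, if_neg hyM, if_pos (by simp)]
        field_simp
      have t2 : siteWeight ε κ R (M ∪ {π x}) (π x) *
          frontWeight d K ε κ (D ∪ {π x}) (M ∪ {π x}) (π x) = 1 / K := by
        have hm : π x ∈ M ∪ {π x} := by simp
        rw [siteWeight, frontWeight, if_pos hm, if_pos hm, if_neg hy.1]
        field_simp
      have t3 : frontWeight d K ε κ D M (π x) = 8 * d / K := by
        rw [frontWeight, if_neg hyM, if_neg hyD]
      have hW := updateWeight_nonneg hreg
      have q1 : ((∏ y ∈ D ∪ {π x}, siteWeight ε κ R M y) *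
          (∏ y ∈ (insert x P).image π \ R, frontWeight d K ε κ (D ∪ {π x}) M y) *
          ∏ z ∈ P, vertexWeight G d K ε κ c₂ A' π (D ∪ {π x}) M z) *
          ((∏ c ∈ kids G A' π x, (frontWeight d K ε κ (D ∪ {π x}) M c)⁻¹) *
          updateWeight d ε κ c₂ (degIn G (D ∪ {π x}) x) (degIn G M x)) =
          S * (F * (1 / (2 * K) * updateWeight d ε κ c₂ (degIn G D x + 1) (degIn G M x))) := by
        rw [prod_union hDy, prod_singleton, g1', hDy1, ← t1]
        calc _ = ((∏ y ∈ D, siteWeight ε κ R M y) *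
              (∏ y ∈ (insert x P).image π \ R, frontWeight d K ε κ (D ∪ {π x}) M y) *
              ∏ z ∈ P, vertexWeight G d K ε κ c₂ A' π (D ∪ {π x}) M z) *
              siteWeight ε κ R M (π x) *
              (F * updateWeight d ε κ c₂ (degIn G D x + 1) (degIn G M x)) := by ring
          _ = _ := by rw [g1]; ring
      have q2 : ((∏ y ∈ D ∪ {π x}, siteWeight ε κ R (M ∪ {π x}) y) *
          (∏ y ∈ (insert x P).image π \ R, frontWeight d K ε κ (D ∪ {π x}) (M ∪ {π x}) y) *
          ∏ z ∈ P, vertexWeight G d K ε κ c₂ A' π (D ∪ {π x}) (M ∪ {π x}) z) *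
          ((∏ c ∈ kids G A' π x, (frontWeight d K ε κ (D ∪ {π x}) (M ∪ {π x}) c)⁻¹) *
          updateWeight d ε κ c₂ (degIn G (D ∪ {π x}) x) (degIn G (M ∪ {π x}) x)) =
          S * (F * (1 / K * updateWeight d ε κ c₂ (degIn G D x + 1) (degIn G M x + 1))) := by
        rw [prod_union hDy, prod_singleton, g2', hDy1, hMy1, ← t2]
        calc _ = ((∏ y ∈ D, siteWeight ε κ R (M ∪ {π x}) y) *
              (∏ y ∈ (insert x P).image π \ R,
                frontWeight d K ε κ (D ∪ {π x}) (M ∪ {π x}) y) *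
              ∏ z ∈ P, vertexWeight G d K ε κ c₂ A' π (D ∪ {π x}) (M ∪ {π x}) z) *
              siteWeight ε κ R (M ∪ {π x}) (π x) *
              (F * updateWeight d ε κ c₂ (degIn G D x + 1) (degIn G M x + 1)) := by ring
          _ = _ := by rw [g2]; ring
      rw [q1, q2, g3, g3', t3]
      have n1 : 0 ≤ S * (F * (1 / (2 * K) *
          updateWeight d ε κ c₂ (degIn G D x + 1) (degIn G M x))) :=
        mul_nonneg hS (mul_nonneg hF0 (mul_nonneg (by positivity) (hW _ _)))
      have n2 : 0 ≤ S * (F * (1 / K *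
          updateWeight d ε κ c₂ (degIn G D x + 1) (degIn G M x + 1))) :=
        mul_nonneg hS (mul_nonneg hF0 (mul_nonneg (by positivity) (hW _ _)))
      calc _ ≤ S * (F * (1 / (2 * K) * updateWeight d ε κ c₂ (degIn G D x + 1) (degIn G M x))) +
            S * (F * (1 / K * updateWeight d ε κ c₂ (degIn G D x + 1) (degIn G M x + 1))) +
            S * (8 * d / K) * (F * updateWeight d ε κ c₂ (degIn G D x) (degIn G M x)) := by
            gcongr
            · split_ifs <;> [exact le_rfl; exact n1]
            · split_ifs <;> [exact le_rfl; exact n2]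
        _ = S * (F * (8 * d / K * updateWeight d ε κ c₂ (degIn G D x) (degIn G M x) +
            1 / (2 * K) * updateWeight d ε κ c₂ (degIn G D x + 1) (degIn G M x) +
            1 / K * updateWeight d ε κ c₂ (degIn G D x + 1) (degIn G M x + 1))) := by ring
        _ ≤ S * (ε * K ^ irregularity G A' R π x) := by
            refine mul_le_mul_of_nonneg_left (hnum.trans ?_) hS
            exact mul_le_mul_of_nonneg_left hle2 hε.le
        _ = _ := mul_comm _ _

end IsRooted

end Exploration

/-! ### Counting irregular vertices -/

section IrregularityCount

variable {V : Type*} [DecidableEq V] {G : SimpleGraph V} [G.LocallyFinite]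

namespace IsRooted

variable {o : V} {A R O : Finset V} {π : V → V} {rk : V → ℕ} {d : ℕ}

theorem card_filter_root_le (hR : IsRooted G o A R O π rk) (hdeg : ∀ v, G.degree v ≤ d) :
    #{x ∈ A | π x ∈ R} ≤ d * R.card := by
  have : {x ∈ A | π x ∈ R} ⊆ R.biUnion fun r => G.neighborFinset r := by
    intro x hx
    rw [mem_filter] at hx
    exact mem_biUnion.2 ⟨π x, hx.2, (G.mem_neighborFinset _ _).2 (hR.adj x hx.1).symm⟩
  refine (card_le_card this).trans (card_biUnion_le.trans ?_)
  calc ∑ r ∈ R, (G.neighborFinset r).card ≤ ∑ _r ∈ R, d :=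
        sum_le_sum fun r _ => (G.card_neighborFinset_eq_degree r).trans_le (hdeg r)
    _ = d * R.card := by rw [sum_const, smul_eq_mul, mul_comm]

theorem kids_sub_one_le (hR : IsRooted G o A R O π rk) (hdeg : ∀ v, G.degree v ≤ d) {x : V}
    (hx : x ∈ A) : (kids G A π x).card - 1 ≤
      (branchDeg G A x - 2) + if π x ∈ R then d else 0 := by
  split_ifs with h
  · have : (kids G A π x).card ≤ G.degree x :=
      (card_le_card (filter_subset _ _)).trans_eq (G.card_neighborFinset_eq_degree x)
    have := hdeg x
    omega
  · obtain ⟨x', hx', hadj, hne⟩ := (hR.par x hx).resolve_left h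
    have h2 : 2 ≤ degIn G A (π x) := by
      have hxx : x ≠ x' := by rintro rfl; exact hne rfl
      rw [← card_pair hxx]
      refine card_le_card fun z hz => ?_
      rw [mem_insert, mem_singleton] at hz
      rw [mem_inter, SimpleGraph.mem_neighborFinset]
      rcases hz with rfl | rfl
      exacts [⟨(hR.adj _ hx).symm, hx⟩, ⟨hadj.symm, hx'⟩]
    have : insert (π x) (kids G A π x) ⊆ {y ∈ G.neighborFinset x | 2 ≤ degIn G A y} := by
      intro z hz
      rw [mem_insert] at hz
      rw [mem_filter]
      rcases hz with rfl | hz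
      · exact ⟨(G.mem_neighborFinset _ _).2 (hR.adj x hx), h2⟩
      · rw [kids, mem_filter] at hz
        exact ⟨hz.1, hz.2.2⟩
    have := card_le_card this
    rw [card_insert_of_notMem (by simp [kids])] at this
    change _ ≤ branchDeg G A x at this
    omega

theorem card_siblings_le (hR : IsRooted G o A R O π rk) :
    #{x ∈ A | π x ∉ R ∧ ∃ x' ∈ A, x' ≠ x ∧ π x' = π x} ≤ 2 * excess G 2 (nbhd G A) A := by
  have hmaps : ∀ x ∈ {x ∈ A | π x ∉ R ∧ ∃ x' ∈ A, x' ≠ x ∧ π x' = π x}, π x ∈ nbhd G A := by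
    intro x hx
    have hx' := (mem_filter.1 hx).1
    exact mem_nbhd.2 ⟨x, hx', hR.adj x hx'⟩
  rw [card_eq_sum_card_fiberwise hmaps, excess, mul_sum]
  refine sum_le_sum fun y _ => ?_
  rw [filter_filter]
  set F := {x ∈ A | (π x ∉ R ∧ ∃ x' ∈ A, x' ≠ x ∧ π x' = π x) ∧ π x = y} with hF
  rcases F.eq_empty_or_nonempty with h | ⟨x, hx⟩
  · simp [h]
  rw [hF, mem_filter] at hx
  obtain ⟨hxA, ⟨hxR, x', hx', hne, he⟩, rfl⟩ := hx
  obtain ⟨w, hw, hwadj, hwne⟩ := (hR.par x hxA).resolve_left hxR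
  have hFN : F ⊆ {z ∈ A | π z = π x} := fun z hz => by
    rw [hF, mem_filter] at hz
    exact mem_filter.2 ⟨hz.1, hz.2.2⟩
  have h1 : insert w {z ∈ A | π z = π x} ⊆ G.neighborFinset (π x) ∩ A := by
    intro z hz
    rw [mem_inter, SimpleGraph.mem_neighborFinset]
    rcases mem_insert.1 hz with rfl | hz
    · exact ⟨hwadj.symm, hw⟩
    · rw [mem_filter] at hz
      exact ⟨hz.2 ▸ (hR.adj z hz.1).symm, hz.1⟩
  have h2 := card_le_card h1
  rw [card_insert_of_notMem (by simp [hwne])] at h2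
  change _ ≤ degIn G A (π x) at h2
  have h3 : 2 ≤ #{z ∈ A | π z = π x} := by
    rw [← card_pair hne]
    refine card_le_card fun z hz => ?_
    rw [mem_insert, mem_singleton] at hz
    rcases hz with rfl | rfl
    exacts [mem_filter.2 ⟨hx', he⟩, mem_filter.2 ⟨hxA, rfl⟩]
  have h4 := card_le_card hFN
  omega

/-- The irregularities are controlled by the trifurcations, up to a constant for each root. -/
theorem sum_irregularity_le (hR : IsRooted G o A R O π rk) (hdeg : ∀ v, G.degree v ≤ d) :
    ∑ x ∈ A, irregularity G A R π x ≤ 4 * excess G 2 (nbhd G A) A + 2 * branchExcess G A +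
      (2 * d ^ 2 + 2 * d) * R.card := by
  have h1 : ∀ x ∈ A, irregularity G A R π x ≤ 2 * (branchDeg G A x - 2) +
      (2 * d + 2) * (if π x ∈ R then 1 else 0) +
      2 * (if π x ∉ R ∧ ∃ x' ∈ A, x' ≠ x ∧ π x' = π x then 1 else 0) := by
    intro x hx
    have := hR.kids_sub_one_le hdeg hx
    rw [irregularity]
    by_cases h : π x ∈ R
    · simp only [h, if_true, true_or, not_true, false_and, if_false] at this ⊢
      omega
    · simp only [h, if_false, false_or, not_false_eq_true, true_and] at this ⊢
      split_ifs <;> omega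
  refine (sum_le_sum h1).trans ?_
  rw [sum_add_distrib, sum_add_distrib, ← mul_sum, ← mul_sum, ← mul_sum, ← card_filter,
    ← card_filter]
  have h2 := hR.card_filter_root_le hdeg
  have h3 := hR.card_siblings_le
  have h4 := Nat.mul_le_mul_left (2 * d + 2) h2
  change 2 * branchExcess G A + _ + _ ≤ _
  have h5 : (2 * d + 2) * (d * R.card) = (2 * d ^ 2 + 2 * d) * R.card := by ring
  omega

end IsRooted

end IrregularityCount

/-! ### Families of unlinked clusters -/

section Families

variable {V : Type*} [DecidableEq V] {G : SimpleGraph V} [G.LocallyFinite]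

variable (G) in
/-- A family of clusters no two of which have a common neighbour. -/
def IsFamily (F : Finset (Finset V)) : Prop :=
  (∀ C ∈ F, IsConn G C) ∧ ∀ C ∈ F, ∀ C' ∈ F, C ≠ C' → Disjoint (nbhd G C) (nbhd G C')

variable (G) in
/-- The bound on the probability that a cluster is minus, `κ` standing for `c₁ ε`. -/
noncomputable def clusterBound (ε κ c₂ c₃ : ℝ) (C : Finset V) : ℝ :=
  (ε / 2) ^ C.card +
    κ * ε ^ C.card * (c₂ ^ excess G 2 (nbhd G C) C * c₃ ^ branchExcess G C)

theorem IsFamily.subset {F F' : Finset (Finset V)} (h : IsFamily G F) (hF : F' ⊆ F) :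
    IsFamily G F' :=
  ⟨fun C hC => h.1 C (hF hC), fun C hC C' hC' => h.2 C (hF hC) C' (hF hC')⟩

/-- Every finite set is the union of its clusters. -/
theorem exists_isFamily (D : Finset V) : ∃ F, IsFamily G F ∧ F.biUnion id = D := by
  classical
  induction D using Finset.strongInduction with
  | H D ih =>
    rcases D.eq_empty_or_nonempty with rfl | hD
    · exact ⟨∅, ⟨by simp, by simp⟩, by simp⟩
    · -- a minimal non-empty part of `D` that is closed under links
      let cl : Finset (Finset V) := {S ∈ D.powerset | S.Nonempty ∧
        ∀ z ∈ S, ∀ z' ∈ D, ∀ y, G.Adj z y → G.Adj z' y → z' ∈ S}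
      have hcl : cl.Nonempty := ⟨D, by simpa [cl, hD] using fun _ _ z' hz' _ _ _ => hz'⟩
      obtain ⟨C, hC⟩ := cl.exists_minimal hcl
      have hCcl := mem_filter.1 hC.1
      obtain ⟨hCD, hCne, hCc⟩ := hCcl
      rw [mem_powerset] at hCD
      have hconn : IsConn G C := by
        refine ⟨hCne, fun S hS hSne hSc => ?_⟩
        refine hS.antisymm (hC.2 (mem_filter.2 ⟨mem_powerset.2 (hS.trans hCD), hSne, ?_⟩) hS)
        intro z hz z' hz' y h1 h2
        exact hSc z hz z' (hCc z (hS hz) z' hz' y h1 h2) y h1 h2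
      obtain ⟨F, hF, hFD⟩ := ih (D \ C) (sdiff_ssubset hCD hCne)
      have hdisj : ∀ C' ∈ F, Disjoint (nbhd G C) (nbhd G C') := by
        intro C' hC'
        refine disjoint_left.2 fun y hy hy' => ?_
        obtain ⟨z, hz, hzy⟩ := mem_nbhd.1 hy
        obtain ⟨z', hz', hzy'⟩ := mem_nbhd.1 hy'
        have : z' ∈ D \ C := hFD ▸ mem_biUnion.2 ⟨C', hC', hz'⟩
        rw [mem_sdiff] at this
        exact this.2 (hCc z hz z' this.1 y hzy hzy')
      refine ⟨insert C F, ⟨?_, ?_⟩, ?_⟩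
      · intro C' hC'
        rcases mem_insert.1 hC' with rfl | hC'
        exacts [hconn, hF.1 _ hC']
      · intro C₁ h1 C₂ h2 hne
        rcases mem_insert.1 h1 with rfl | h1' <;> rcases mem_insert.1 h2 with rfl | h2'
        · exact absurd rfl hne
        · exact hdisj _ h2'
        · exact (hdisj _ h1').symm
        · exact hF.2 _ h1' _ h2' hne
      · rw [biUnion_insert, hFD, id, union_sdiff_of_subset hCD]

namespace IsFamily

variable {F : Finset (Finset V)}

theorem eq_of_adj (hF : IsFamily G F) {C C' : Finset V} (hC : C ∈ F) (hC' : C' ∈ F) {z z' y : V}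
    (hz : z ∈ C) (hz' : z' ∈ C') (h : G.Adj z y) (h' : G.Adj z' y) : C = C' := by
  by_contra hne
  exact disjoint_left.1 (hF.2 C hC C' hC' hne) (mem_nbhd.2 ⟨z, hz, h⟩) (mem_nbhd.2 ⟨z', hz', h'⟩)

theorem pairwiseDisjoint (hF : IsFamily G F)
    (hadj : ∀ z ∈ F.biUnion id, ∃ y, G.Adj z y) :
    (F : Set (Finset V)).PairwiseDisjoint id := by
  intro C hC C' hC' hne
  refine disjoint_left.2 fun z hz hz' => hne ?_
  obtain ⟨y, hy⟩ := hadj z (mem_biUnion.2 ⟨C, hC, hz⟩)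
  exact hF.eq_of_adj hC hC' hz hz' hy hy

theorem degIn_biUnion (hF : IsFamily G F) {C : Finset V} (hC : C ∈ F) {x : V}
    (hx : x ∈ nbhd G C) : degIn G (F.biUnion id) x = degIn G C x := by
  obtain ⟨z, hz, hzx⟩ := mem_nbhd.1 hx
  rw [degIn, degIn]
  congr 1
  ext z'
  simp only [mem_inter, SimpleGraph.mem_neighborFinset, mem_biUnion, id]
  refine and_congr_right fun hxz => ⟨?_, fun h => ⟨C, hC, h⟩⟩
  rintro ⟨C', hC', hz'⟩
  rwa [hF.eq_of_adj hC hC' hz hz' hzx hxz.symm]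

theorem sum_excess (hF : IsFamily G F) (k : ℕ) :
    ∑ C ∈ F, excess G k (nbhd G C) C = excess G k (nbhd G (F.biUnion id)) (F.biUnion id) := by
  have : nbhd G (F.biUnion id) = F.biUnion (nbhd G) := by
    ext y; simp only [mem_nbhd, mem_biUnion, id]
    constructor
    · rintro ⟨x, ⟨C, hC, hx⟩, h⟩; exact ⟨C, hC, x, hx, h⟩
    · rintro ⟨C, hC, x, hx, h⟩; exact ⟨x, ⟨C, hC, hx⟩, h⟩
  rw [this, excess, sum_biUnion]
  · exact sum_congr rfl fun C hC => sum_congr rfl fun x hx => by rw [hF.degIn_biUnion hC hx]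
  · intro C hC C' hC' hne
    exact hF.2 C hC C' hC' hne

theorem sum_branchExcess_le (hF : IsFamily G F)
    (hadj : ∀ z ∈ F.biUnion id, ∃ y, G.Adj z y) :
    ∑ C ∈ F, branchExcess G C ≤ branchExcess G (F.biUnion id) := by
  rw [branchExcess, sum_biUnion (hF.pairwiseDisjoint hadj)]
  refine sum_le_sum fun C hC => sum_le_sum fun v _ => Nat.sub_le_sub_right ?_ 2
  exact branchDeg_mono (subset_biUnion_of_mem id hC) v

theorem card_le (hF : IsFamily G F) :
    (F.biUnion id).card ≤ F.card + excess G 1 (nbhd G (F.biUnion id)) (F.biUnion id) := by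
  rw [← hF.sum_excess 1]
  refine card_biUnion_le.trans ?_
  rw [card_eq_sum_ones, ← sum_add_distrib]
  exact sum_le_sum fun C hC => (hF.1 C hC).card_le

end IsFamily

end Families

/-! ### Links through vertices outside the explored clusters -/

section OutsideLinks

variable {V : Type*} [DecidableEq V] {G : SimpleGraph V} [G.LocallyFinite]
variable {o : V} {A R O : Finset V} {π : V → V} {rk : V → ℕ}

/-- Linking neighbours of `A` through vertices outside `A` costs one root for each link. -/
theorem IsRooted.excess_sdiff_le (hR : IsRooted G o A R O π rk) (hG : G.IsTree) {M : Finset V}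
    (hM : M ⊆ nbhd G A) (hO : Disjoint O M) :
    excess G 1 (nbhd G M \ A) M ≤ (M ∩ R).card := by
  classical
  have h1 : ∀ x ∈ nbhd G M \ A, degIn G M x - 1 ≤
      #{z ∈ M ∩ R | G.Adj x z ∧ G.dist o z = G.dist o x + 1} := by
    intro x hx
    have hxA := (mem_sdiff.1 hx).2
    have : G.neighborFinset x ∩ M ⊆
        insert (parent G o x) {z ∈ M ∩ R | G.Adj x z ∧ G.dist o z = G.dist o x + 1} := by
      intro z hz
      rw [mem_inter, SimpleGraph.mem_neighborFinset] at hz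
      rw [mem_insert, mem_filter, mem_inter]
      rcases dist_parent_or_child hG o hz.1 with h | h
      · exact Or.inl (parent_eq hG hz.1 h).symm
      · exact Or.inr ⟨⟨hz.2, hR.out x hxA z (hM hz.2) (disjoint_right.1 hO hz.2) hz.1 h⟩, hz.1, h⟩
    have := (card_le_card this).trans (card_insert_le _ _)
    change degIn G M x ≤ _ at this
    omega
  refine (sum_le_sum h1).trans ?_
  rw [← card_biUnion]
  · refine card_le_card fun z hz => ?_
    obtain ⟨x, -, hz⟩ := mem_biUnion.1 hz
    exact (mem_filter.1 hz).1
  · intro x _ x' _ hne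
    refine disjoint_left.2 fun z hz hz' => hne ?_
    obtain ⟨-, ha, hd⟩ := mem_filter.1 hz
    obtain ⟨-, ha', hd'⟩ := mem_filter.1 hz'
    exact parent_unique hG o ha.symm ha'.symm hd.symm hd'.symm

theorem excess_nbhd_le (k : ℕ) (M A : Finset V) :
    excess G k (nbhd G M) M ≤ excess G k A M + excess G k (nbhd G M \ A) M := by
  rw [excess, ← sum_inter_add_sum_sdiff (nbhd G M) A]
  exact Nat.add_le_add_right (sum_le_sum_of_subset inter_subset_right) _

theorem IsRooted.excess_two_le (hR : IsRooted G o A R O π rk) (hG : G.IsTree) {M : Finset V}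
    (hM : M ⊆ nbhd G A) (hO : Disjoint O M) :
    excess G 2 (nbhd G M) M ≤ excess G 2 A M + R.card := by
  refine (excess_nbhd_le 2 M A).trans (Nat.add_le_add_left ?_ _)
  calc _ ≤ excess G 1 (nbhd G M \ A) M := sum_le_sum fun x _ => by omega
    _ ≤ (M ∩ R).card := hR.excess_sdiff_le hG hM hO
    _ ≤ R.card := card_le_card inter_subset_right

theorem IsRooted.branchExcess_le (hR : IsRooted G o A R O π rk) (hG : G.IsTree) {M : Finset V}
    (hM : M ⊆ nbhd G A) (hO : Disjoint O M) :
    branchExcess G M ≤ excess G 2 (nbhd G A) A + 2 * R.card := by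
  classical
  set B := {x ∈ nbhd G M \ A | 2 ≤ degIn G M x} with hB
  have h1 : ∀ v ∈ M, branchDeg G M v - 2 ≤ (degIn G A v - 2) + #{x ∈ B | G.Adj v x} := by
    intro v hv
    have : {y ∈ G.neighborFinset v | 2 ≤ degIn G M y} ⊆
        (G.neighborFinset v ∩ A) ∪ {x ∈ B | G.Adj v x} := by
      intro x hx
      rw [mem_filter, SimpleGraph.mem_neighborFinset] at hx
      rw [mem_union, mem_inter, SimpleGraph.mem_neighborFinset, mem_filter, hB, mem_filter,
        mem_sdiff]
      by_cases hxA : x ∈ A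
      · exact Or.inl ⟨hx.1, hxA⟩
      · exact Or.inr ⟨⟨⟨mem_nbhd.2 ⟨v, hv, hx.1⟩, hxA⟩, hx.2⟩, hx.1⟩
    have := (card_le_card this).trans (card_union_le _ _)
    change branchDeg G M v ≤ degIn G A v + _ at this
    omega
  refine (sum_le_sum h1).trans ?_
  rw [sum_add_distrib]
  refine Nat.add_le_add (sum_le_sum_of_subset hM) ?_
  calc ∑ v ∈ M, #{x ∈ B | G.Adj v x} = ∑ x ∈ B, #{v ∈ M | G.Adj v x} := by
        simp only [card_filter]
        exact sum_comm
    _ ≤ ∑ x ∈ B, 2 * (degIn G M x - 1) := by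
        refine sum_le_sum fun x hx => ?_
        have h2 := (mem_filter.1 hx).2
        have : {v ∈ M | G.Adj v x} = G.neighborFinset x ∩ M := by
          ext v
          simp [and_comm, G.adj_comm v x]
        rw [this]
        change degIn G M x ≤ _
        omega
    _ ≤ 2 * excess G 1 (nbhd G M \ A) M := by
        rw [← mul_sum]
        exact Nat.mul_le_mul_left 2 (sum_le_sum_of_subset (filter_subset _ _))
    _ ≤ 2 * R.card := Nat.mul_le_mul_left 2
        ((hR.excess_sdiff_le hG hM hO).trans (card_le_card inter_subset_right))

end OutsideLinks

/-! ### The bound for rooted clusters -/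

section FinalBound

variable {V : Type*} [DecidableEq V] {G : SimpleGraph V} [G.LocallyFinite]
variable {o : V} {A R O : Finset V} {π : V → V} {rk : V → ℕ} {d : ℕ} {K ε κ c₂ c₃ : ℝ}

variable (G) in
/-- The bound to be proved by induction on time: the random set of minus vertices in `E`, equal to
`U` with probability `p U`, contains a family of clusters with at most the product of the
`clusterBound`s as probability. -/
def FamilyBound (ε κ c₂ c₃ : ℝ) (p : Finset V → ℝ) (E : Finset V) : Prop :=
  ∀ F, IsFamily G F → F.biUnion id ⊆ E →
    minusSum G p E ε ∅ (F.biUnion id) ∅ ≤ ∏ C ∈ F, clusterBound G ε κ c₂ c₃ C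

theorem minusSum_anti {p : Finset V → ℝ} (hp : ∀ U, 0 ≤ p U) (h0 : 0 ≤ ε) (h1 : ε ≤ 1)
    {E A D D' O O' : Finset V} (hD : D' ⊆ D) (hO : O' ⊆ O) :
    minusSum G p E ε A D O ≤ minusSum G p E ε A D' O' := by
  refine sum_le_sum_of_subset_of_nonneg (fun U hU => ?_) fun U _ _ =>
    mul_nonneg (hp U) (prod_nonneg fun _ _ => minusProb_nonneg h0 h1 U _)
  rw [mem_filter] at hU ⊢
  exact ⟨hU.1, hD.trans hU.2.1, hU.2.2.mono_left hO⟩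

theorem minusSum_eq_zero {p : Finset V → ℝ} {E A D O : Finset V} (h : ¬ Disjoint O D) :
    minusSum G p E ε A D O = 0 := by
  rw [minusSum, filter_eq_empty_iff.2, sum_empty]
  exact fun U _ hU => h (hU.2.mono_right hU.1)

theorem prod_siteWeight {D M : Finset V} (hMD : M ⊆ D) :
    ∏ y ∈ D, siteWeight ε κ R M y =
      ε ^ D.card * (κ ^ (M \ R).card * (1 / 2) ^ (D \ M).card) := by
  simp only [siteWeight]
  rw [prod_mul_distrib, prod_const, ← prod_sdiff hMD, mul_comm (∏ x ∈ D \ M, _)]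
  congr 2
  · rw [prod_congr rfl fun y hy => if_pos hy, prod_ite, prod_const_one, one_mul, prod_const,
      ← sdiff_eq_filter]
  · rw [prod_congr rfl fun y hy => if_neg (mem_sdiff.1 hy).2, prod_const]

theorem prod_joinWeight (M : Finset V) :
    ∏ x ∈ A, joinWeight κ c₂ (degIn G M x) = c₂ ^ excess G 2 A M / κ ^ excess G 1 A M := by
  simp only [joinWeight, prod_div_distrib, prod_pow_eq_pow_sum, excess]

/-- Once `A` is explored, the set `D` of vertices demanded to be minus at the previous time is
bounded by splitting it into clusters, and expanding the product of the `clusterBound`s: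
`M` is the union of the clusters for which the second term is chosen. -/
theorem IsRooted.terminal_bound (hR : IsRooted G o A R O π rk) (hG : G.IsTree)
    (hreg : Regime d K ε κ c₂) (hc₃ : 1 ≤ c₃) {p : Finset V → ℝ} (hp : ∀ U, 0 ≤ p U)
    {E : Finset V} (hE : nbhd G A ⊆ E) (hfam : FamilyBound G ε κ c₂ c₃ p E) {D O' : Finset V}
    (hD : D ⊆ nbhd G A) (hO : O ⊆ O') :
    minusSum G p E ε ∅ D O' ≤ ((c₂ * c₃ ^ 2) ^ R.card * c₃ ^ excess G 2 (nbhd G A) A) *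
      ∑ M ∈ labels G A D,
        (∏ y ∈ D, siteWeight ε κ R M y) * ∏ x ∈ A, joinWeight κ c₂ (degIn G M x) := by
  have hε := hreg.eps_pos
  have hκ := hreg.kappa_pos
  have hκ1 := hreg.kappa_le_one
  have hc₂ := hreg.one_le_c
  have hc₂0 : 0 < c₂ := by linarith
  have hc₃0 : 0 < c₃ := by linarith
  have hterm : ∀ M : Finset V, 0 ≤
      (∏ y ∈ D, siteWeight ε κ R M y) * ∏ x ∈ A, joinWeight κ c₂ (degIn G M x) := fun M =>
    mul_nonneg (prod_nonneg fun _ _ => siteWeight_nonneg hreg _ _)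
      (prod_nonneg fun _ _ => joinWeight_nonneg hreg _)
  by_cases hdisj : Disjoint O' D
  swap
  · rw [minusSum_eq_zero hdisj]
    exact mul_nonneg (by positivity) (sum_nonneg fun M _ => hterm M)
  obtain ⟨F, hF, rfl⟩ := exists_isFamily (G := G) D
  have hadj : ∀ z ∈ F.biUnion id, ∃ y, G.Adj z y := fun z hz => by
    obtain ⟨x, -, h⟩ := mem_nbhd.1 (hD hz)
    exact ⟨x, h.symm⟩
  have hpd := hF.pairwiseDisjoint hadj
  refine (minusSum_anti hp hε.le hreg.eps_le_one (Subset.refl _) (empty_subset O')).trans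
    ((hfam F hF (hD.trans hE)).trans ?_)
  simp only [clusterBound]
  rw [prod_congr rfl fun C _ => add_comm _ _, prod_add, mul_sum]
  have hinj : Set.InjOn (fun S : Finset (Finset V) => S.biUnion id)
      (F.powerset : Set (Finset (Finset V))) := by
    have key : ∀ S ∈ F.powerset, ∀ S' ∈ F.powerset, S.biUnion id = S'.biUnion id → S ⊆ S' := by
      intro S hS S' hS' h C hC
      rw [mem_powerset] at hS hS'
      obtain ⟨z, hz⟩ := (hF.1 C (hS hC)).1
      have hz' : z ∈ S'.biUnion id := h ▸ mem_biUnion.2 ⟨C, hC, hz⟩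
      obtain ⟨C', hC', hzC'⟩ := mem_biUnion.1 hz'
      obtain ⟨y, hy⟩ := hadj z (mem_biUnion.2 ⟨C, hS hC, hz⟩)
      rwa [hF.eq_of_adj (hS hC) (hS' hC') hz hzC' hy hy]
    exact fun S hS S' hS' h => (key S hS S' hS' h).antisymm (key S' hS' S hS h.symm)
  have himage : (F.powerset.image fun S => S.biUnion id) ⊆ labels G A (F.biUnion id) := by
    intro M hM
    obtain ⟨S, hS, rfl⟩ := mem_image.1 hM
    rw [mem_powerset] at hS
    have hSF : S.biUnion id ⊆ F.biUnion id := biUnion_subset_biUnion_of_subset_left _ hS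
    refine mem_labels.2 ⟨hSF, fun x _ => ?_⟩
    refine (Nat.eq_zero_or_pos _).imp id fun h => (degIn_mono hSF x).antisymm ?_
    obtain ⟨z, hz, hxz⟩ := degIn_pos.1 h
    obtain ⟨C, hC, hzC⟩ := mem_biUnion.1 hz
    rw [hF.degIn_biUnion (hS hC) (mem_nbhd.2 ⟨z, hzC, hxz.symm⟩)]
    exact degIn_mono (subset_biUnion_of_mem id hC) x
  refine le_trans ?_ (sum_le_sum_of_subset_of_nonneg himage fun M _ _ =>
    mul_nonneg (by positivity) (hterm M))
  rw [sum_image hinj]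
  refine sum_le_sum fun S hS => ?_
  rw [mem_powerset] at hS
  have hSfam := hF.subset hS
  set M := S.biUnion id with hM
  have hMD : M ⊆ F.biUnion id := biUnion_subset_biUnion_of_subset_left _ hS
  have hMN : M ⊆ nbhd G A := hMD.trans hD
  have hOM : Disjoint O M := (hdisj.mono_left hO).mono_right hMD
  have hSadj : ∀ z ∈ S.biUnion id, ∃ y, G.Adj z y := fun z hz => hadj z (hMD hz)
  have hcardS : ∑ C ∈ S, C.card = M.card := (card_biUnion (hSfam.pairwiseDisjoint hSadj)).symm
  have hcardF : ∑ C ∈ F, C.card = (F.biUnion id).card := (card_biUnion hpd).symm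
  have hcardFS : ∑ C ∈ F \ S, C.card = (F.biUnion id \ M).card := by
    have h1 := sum_sdiff hS (f := fun C : Finset V => C.card)
    rw [card_sdiff_of_subset hMD]
    omega
  -- the numbers of clusters and of trifurcations
  have hcount : (M \ R).card ≤ S.card + excess G 1 A M := by
    have h1 := hSfam.card_le
    rw [← hM] at h1
    have h2 := excess_nbhd_le (G := G) 1 M A
    have h3 := hR.excess_sdiff_le hG hMN hOM
    have h4 := card_sdiff_add_card_inter M R
    omega
  have he : ∑ C ∈ S, excess G 2 (nbhd G C) C ≤ excess G 2 A M + R.card := by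
    rw [hSfam.sum_excess 2]
    exact hR.excess_two_le hG hMN hOM
  have hq : ∑ C ∈ S, branchExcess G C ≤ excess G 2 (nbhd G A) A + 2 * R.card :=
    (hSfam.sum_branchExcess_le hSadj).trans (hR.branchExcess_le hG hMN hOM)
  rw [prod_siteWeight hMD, prod_joinWeight]
  have hL : (∏ C ∈ S, κ * ε ^ C.card * (c₂ ^ excess G 2 (nbhd G C) C * c₃ ^ branchExcess G C)) *
      ∏ C ∈ F \ S, (ε / 2) ^ C.card =
      ε ^ (F.biUnion id).card * (1 / 2) ^ (F.biUnion id \ M).card * (κ ^ S.card *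
        (c₂ ^ (∑ C ∈ S, excess G 2 (nbhd G C) C) * c₃ ^ (∑ C ∈ S, branchExcess G C))) := by
    simp only [prod_mul_distrib, prod_pow_eq_pow_sum, prod_const]
    rw [← hcardF, ← sum_sdiff hS, hcardFS, hcardS, div_eq_mul_one_div ε, mul_pow, pow_add]
    ring
  rw [hL]
  have hκS : κ ^ S.card ≤ κ ^ (M \ R).card / κ ^ excess G 1 A M := by
    rw [le_div_iff₀ (pow_pos hκ _), ← pow_add]
    exact pow_le_pow_of_le_one hκ.le hκ1 hcount
  calc _ ≤ ε ^ (F.biUnion id).card * (1 / 2) ^ (F.biUnion id \ M).card *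
        (κ ^ (M \ R).card / κ ^ excess G 1 A M *
        (c₂ ^ (excess G 2 A M + R.card) * c₃ ^ (excess G 2 (nbhd G A) A + 2 * R.card))) := by
        gcongr
    _ = _ := by
        rw [pow_add, pow_add, pow_mul, mul_pow]
        ring

/-- The bound for a rooted union of clusters, all of whose roots were minus. -/
theorem IsRooted.minusSum_le (hR : IsRooted G o A R O π rk) (hG : G.IsTree)
    (hreg : Regime d K ε κ (K ^ 6)) (hdeg : ∀ v, G.degree v ≤ d) {p : Finset V → ℝ}
    (hp : ∀ U, 0 ≤ p U) {E : Finset V} (hE : nbhd G A ⊆ E)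
    (hfam : FamilyBound G ε κ (K ^ 6) (K ^ 2) p E) :
    minusSum G p E ε A R O ≤ ε ^ A.card *
      ((K ^ 6) ^ excess G 2 (nbhd G A) A * (K ^ 2) ^ branchExcess G A) *
      (ε * (3 / 2 * K ^ (10 + 2 * d ^ 2 + 2 * d))) ^ R.card := by
  have hε := hreg.eps_pos
  have hK := hreg.one_le_K
  have hK0 : 0 < K := by linarith
  have hK2 : 1 ≤ K ^ 2 := one_le_pow₀ hK
  have h := hR.exploration_bound hreg hdeg hp (E := E)
    (Γ := (K ^ 6 * (K ^ 2) ^ 2) ^ R.card * (K ^ 2) ^ excess G 2 (nbhd G A) A) (by positivity)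
    (fun D O' _ hD hO => hR.terminal_bound hG hreg hK2 hp hE hfam hD hO) A.card A R O rfl
    (Subset.refl _) (by simp) (Subset.refl _) hR.root_mem (Subset.refl _) (by simp)
    (fun z hz => Or.inl hz)
  rw [sdiff_self, bot_eq_empty] at h
  have hsum : ∑ M ∈ labels G ∅ R, stageWeight G d K ε κ (K ^ 6) A R π ∅ R M =
      (ε * (3 / 2)) ^ R.card := by
    have : labels G ∅ R = R.powerset := by simp [labels]
    rw [this, show (ε * (3 / 2)) ^ R.card = ∏ _y ∈ R, (ε + ε / 2) by
      rw [prod_const]; congr 1; ring, prod_add]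
    refine sum_congr rfl fun M hM => ?_
    rw [mem_powerset] at hM
    rw [stageWeight, image_empty, empty_sdiff, prod_empty, prod_empty, mul_one, mul_one,
      prod_siteWeight hM, sdiff_eq_empty_iff_subset.2 hM, card_empty, pow_zero,
      one_mul, prod_const, prod_const, div_eq_mul_one_div ε, mul_pow, ← mul_assoc, ← pow_add,
      add_comm, card_sdiff_add_card_eq_card hM]
  have hprod : ∏ x ∈ A, ε * K ^ irregularity G A R π x ≤
      ε ^ A.card * K ^ (4 * excess G 2 (nbhd G A) A + 2 * branchExcess G A +
      (2 * d ^ 2 + 2 * d) * R.card) := by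
    rw [prod_mul_distrib, prod_const, prod_pow_eq_pow_sum]
    exact mul_le_mul_of_nonneg_left (pow_le_pow_right₀ hK (hR.sum_irregularity_le hdeg))
      (by positivity)
  rw [hsum] at h
  refine h.trans ?_
  calc _ ≤ (K ^ 6 * (K ^ 2) ^ 2) ^ R.card * (K ^ 2) ^ excess G 2 (nbhd G A) A *
        (ε ^ A.card * K ^ (4 * excess G 2 (nbhd G A) A + 2 * branchExcess G A +
        (2 * d ^ 2 + 2 * d) * R.card)) * (ε * (3 / 2)) ^ R.card := by gcongr
    _ = _ := by
        simp only [mul_pow, ← pow_mul, pow_add]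
        ring

end FinalBound

/-! ### Rooting the clusters of a family -/

section Rooting

variable {V : Type*} [DecidableEq V] {G : SimpleGraph V} [G.LocallyFinite]
variable {o : V} {A R O : Finset V} {π : V → V} {rk : V → ℕ} {d : ℕ} {K ε κ c₂ c₃ : ℝ}

theorem disjoint_of_disjoint_nbhd (hpos : ∀ v, 0 < G.degree v) {A C : Finset V}
    (h : Disjoint (nbhd G A) (nbhd G C)) : Disjoint A C := by
  refine disjoint_left.2 fun z hz hz' => ?_
  obtain ⟨y, hy⟩ := (G.degree_pos_iff_exists_adj z).1 (hpos z)
  exact disjoint_left.1 h (mem_nbhd.2 ⟨z, hz, hy⟩) (mem_nbhd.2 ⟨z, hz', hy⟩)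

/-- A cluster `C` unlinked to `A` can be rooted at any of its neighbours `y`. -/
theorem IsRooted.union (hR : IsRooted G o A R O π rk) (hG : G.IsTree)
    (hpos : ∀ v, 0 < G.degree v) {C O' : Finset V} (hC : IsConn G C)
    (hdis : Disjoint (nbhd G A) (nbhd G C)) {y : V} (hy : y ∈ nbhd G C) (hO : O ⊆ O')
    (htop : ∀ z ∈ nbhd G C, ∀ x ∉ C, G.Adj x z → G.dist o z = G.dist o x + 1 →
      z ∈ insert y O') :
    IsRooted G o (A ∪ C) (insert y R) O' (fun x => if x ∈ C then parent G y x else π x)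
      (fun x => if x ∈ C then G.dist y x else rk x) := by
  have hAC := disjoint_of_disjoint_nbhd hpos hdis
  have hAnot : ∀ x ∈ A, x ∉ C := fun x hx => disjoint_left.1 hAC hx
  obtain ⟨w, hw, hwy⟩ := mem_nbhd.1 hy
  have hodd : ∀ z ∈ C, G.dist y z % 2 = 1 := fun z hz => by
    rw [hC.parity hG y hz hw, SimpleGraph.dist_comm, SimpleGraph.dist_eq_one_iff_adj.2 hwy]
  have hne : ∀ z ∈ C, z ≠ y := by
    rintro z hz rfl
    simpa using hodd z hz
  have hsame : ∀ x ∈ A, ∀ z ∈ C, ∀ v, G.Adj x v → ¬ G.Adj z v := fun x hx z hz v h h' =>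
    disjoint_left.1 hdis (mem_nbhd.2 ⟨x, hx, h⟩) (mem_nbhd.2 ⟨z, hz, h'⟩)
  constructor
  · intro x hx
    rcases mem_union.1 hx with hx | hx
    · simpa only [if_neg (hAnot x hx)] using hR.adj x hx
    · simpa only [if_pos hx] using (parent_spec hG (hne x hx)).1
  · intro x hx v hv hvne x' hx' hv' hne'
    rcases mem_union.1 hx with hx | hx <;> rcases mem_union.1 hx' with hx' | hx'
    · simp only [if_neg (hAnot x hx), if_neg (hAnot x' hx')] at hvne ⊢
      exact hR.child x hx v hv hvne x' hx' hv' hne'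
    · exact absurd hv' (hsame x hx x' hx' v hv)
    · exact absurd hv (hsame x' hx' x hx v hv')
    · simp only [if_pos hx, if_pos hx'] at hvne ⊢
      have h1 : G.dist y v = G.dist y x + 1 :=
        (dist_parent_or_child hG y hv).resolve_left fun h => hvne (parent_eq hG hv h).symm
      have h2 : G.dist y x' = G.dist y v + 1 :=
        (dist_parent_or_child hG y hv'.symm).resolve_left fun h =>
          hne' (parent_unique hG y hv'.symm hv.symm h h1.symm)
      exact ⟨parent_eq hG hv' h2.symm, by omega⟩
  · intro x hx
    rcases mem_union.1 hx with hx | hx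
    · simp only [if_neg (hAnot x hx)]
      rcases hR.par x hx with h | ⟨x', hx', h, h'⟩
      · exact Or.inl (mem_insert_of_mem h)
      · exact Or.inr ⟨x', mem_union_left _ hx', h, by rwa [if_neg (hAnot x' hx')]⟩
    · simp only [if_pos hx]
      by_cases h : parent G y x = y
      · exact Or.inl (mem_insert.2 (Or.inl h))
      · obtain ⟨x', hx', h1, h2⟩ := hC.exists_grandparent hG hy hx h
        exact Or.inr ⟨x', mem_union_right _ hx', h1, by rwa [if_pos hx']⟩
  · intro r hr x hx hxr
    rcases mem_insert.1 hr with rfl | hr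
    · have hxC : x ∈ C := (mem_union.1 hx).resolve_left fun h => hsame x h w hw _ hxr hwy
      simp only [if_pos hxC]
      refine parent_eq hG hxr ?_
      rw [SimpleGraph.dist_self, SimpleGraph.dist_comm, SimpleGraph.dist_eq_one_iff_adj.2 hxr]
    · have hxA : x ∈ A := (mem_union.1 hx).resolve_right fun h =>
        disjoint_left.1 hdis (hR.root_mem hr) (mem_nbhd.2 ⟨x, h, hxr⟩)
      simp only [if_neg (hAnot x hxA)]
      exact hR.root r hr x hxA hxr
  · rw [nbhd_union]
    exact insert_subset (mem_union_right _ hy) (hR.root_mem.trans subset_union_left)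
  · intro x hx z hz hzO hxz hd
    rw [mem_union, not_or] at hx
    rw [nbhd_union] at hz
    rcases mem_union.1 hz with hz | hz
    · exact mem_insert_of_mem (hR.out x hx.1 z hz (fun h => hzO (hO h)) hxz hd)
    · rcases mem_insert.1 (htop z hz x hx.2 hxz hd) with rfl | h
      · exact mem_insert_self _ _
      · exact absurd h hzO

theorem isRooted_empty (o : V) (π : V → V) (rk : V → ℕ) : IsRooted G o ∅ ∅ ∅ π rk := by
  constructor <;> simp

theorem degIn_union_left {A C : Finset V} (h : Disjoint (nbhd G A) (nbhd G C)) {x : V}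
    (hx : x ∈ nbhd G A) : degIn G (A ∪ C) x = degIn G A x := by
  have h1 := degIn_union_le (G := G) A C x
  rw [degIn_eq_zero_of_notMem (disjoint_left.1 h hx), add_zero] at h1
  exact h1.antisymm (degIn_mono subset_union_left x)

theorem excess_union {A C : Finset V} (h : Disjoint (nbhd G A) (nbhd G C)) (k : ℕ) :
    excess G k (nbhd G (A ∪ C)) (A ∪ C) = excess G k (nbhd G A) A + excess G k (nbhd G C) C := by
  rw [nbhd_union, excess, sum_union h]
  congr 1
  · exact sum_congr rfl fun x hx => by rw [degIn_union_left h hx]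
  · exact sum_congr rfl fun x hx => by rw [union_comm, degIn_union_left h.symm hx]

theorem branchExcess_union_le {A C : Finset V} (h : Disjoint (nbhd G A) (nbhd G C)) :
    branchExcess G (A ∪ C) ≤ branchExcess G A + branchExcess G C := by
  have key : ∀ A C : Finset V, Disjoint (nbhd G A) (nbhd G C) → ∀ v ∈ A,
      branchDeg G (A ∪ C) v = branchDeg G A v := by
    intro A C h v hv
    rw [branchDeg, branchDeg]
    congr 1
    refine filter_congr fun y hy => ?_
    rw [degIn_union_left h (mem_nbhd.2 ⟨v, hv, (G.mem_neighborFinset _ _).1 hy⟩)]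
  refine (sum_union_inter (s₁ := A) (s₂ := C) (f := fun v => branchDeg G (A ∪ C) v - 2)).le.trans'
    (Nat.le_add_right _ _) |>.trans ?_
  refine Nat.add_le_add (sum_le_sum fun v hv => ?_) (sum_le_sum fun v hv => ?_)
  · rw [key A C h v hv]
  · rw [union_comm, key C A h.symm v hv]

/-- Either `t` is minus, or some neighbour of `x` is minus while `t` is not, or `x` is minus by
noise. -/
theorem minusSum_le_split {p : Finset V → ℝ} (hp : ∀ U, 0 ≤ p U) (h0 : 0 ≤ ε) (h1 : ε ≤ 1)
    {E B : Finset V} (R O : Finset V) {x : V} (hx : x ∈ B) (t : V) :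
    minusSum G p E ε B R O ≤ minusSum G p E ε B (insert t R) O +
      ∑ y ∈ G.neighborFinset x, minusSum G p E ε B (insert y R) (insert t O) +
      ε / 2 * minusSum G p E ε (B.erase x) R O := by
  rw [minusSum_eq_add p E ε B R O t, add_assoc]
  refine add_le_add le_rfl ?_
  have e : ∀ y, minusSum G p E ε B (insert y R) (insert t O) =
      ∑ U ∈ E.powerset with (R ⊆ U ∧ Disjoint (insert t O) U),
        if y ∈ U then p U * ∏ z ∈ B, minusProb G ε U z else 0 := by
    intro y
    rw [minusSum, ← sum_filter, filter_filter]
    refine sum_congr (filter_congr fun U _ => ?_) fun _ _ => rfl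
    rw [insert_subset_iff]; tauto
  have hmono : minusSum G p E ε (B.erase x) R (insert t O) ≤
      minusSum G p E ε (B.erase x) R O :=
    minusSum_anti hp h0 h1 (Subset.refl _) (subset_insert _ _)
  refine le_trans ?_ (add_le_add le_rfl (mul_le_mul_of_nonneg_left hmono (by positivity)))
  simp only [e]
  rw [sum_comm]
  unfold minusSum
  rw [mul_sum, ← sum_add_distrib]
  refine sum_le_sum fun U _ => ?_
  have hB : 0 ≤ p U * ∏ z ∈ B, minusProb G ε U z :=
    mul_nonneg (hp U) (prod_nonneg fun _ _ => minusProb_nonneg h0 h1 U _)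
  have hBx : 0 ≤ p U * ∏ z ∈ B.erase x, minusProb G ε U z :=
    mul_nonneg (hp U) (prod_nonneg fun _ _ => minusProb_nonneg h0 h1 U _)
  have hs : ∀ y ∈ G.neighborFinset x,
      0 ≤ if y ∈ U then p U * ∏ z ∈ B, minusProb G ε U z else 0 := by
    intro y _; split_ifs <;> [exact hB; exact le_rfl]
  by_cases h : ∃ y ∈ G.neighborFinset x, y ∈ U
  · obtain ⟨y, hy, hyU⟩ := h
    have := single_le_sum hs hy
    rw [if_pos hyU] at this
    have := mul_nonneg (show 0 ≤ ε / 2 by positivity) hBx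
    linarith
  · have hdeg : degIn G U x = 0 := by
      rw [degIn, card_eq_zero]
      exact eq_empty_of_forall_notMem fun y hy => h ⟨y, (mem_inter.1 hy).1, (mem_inter.1 hy).2⟩
    have hq : minusProb G ε U x = ε / 2 := by rw [minusProb, if_neg (by omega)]
    have h2 : p U * ∏ z ∈ B, minusProb G ε U z =
        ε / 2 * (p U * ∏ z ∈ B.erase x, minusProb G ε U z) := by
      rw [← mul_prod_erase B _ hx, hq]; ring
    have h3 := sum_nonneg hs
    linarith

/-- One step of the bound for a family: the possible states around a leaf of `C` add up to at most
the bound for `C`. -/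
theorem clusterBound_step (hε : 0 < ε) {g T T' : ℝ} {n : ℕ} (hg : 0 ≤ g)
    (hT' : T' ≤ T) :
    (1 + d) * (ε ^ (n + 1) * T * (ε * g)) +
      ε / 2 * ((ε / 2) ^ n + 2 * (1 + d) * g * ε * ε ^ n * T') ≤
      (ε / 2) ^ (n + 1) + 2 * (1 + d) * g * ε * ε ^ (n + 1) * T := by
  have h : (1 + d) * g * ε ^ (n + 2) * T' ≤ (1 + d) * g * ε ^ (n + 2) * T := by gcongr
  calc _ = (ε / 2) ^ (n + 1) + (1 + d) * g * ε ^ (n + 2) * T + (1 + d) * g * ε ^ (n + 2) * T' := by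
        ring
    _ ≤ (ε / 2) ^ (n + 1) + (1 + d) * g * ε ^ (n + 2) * T + (1 + d) * g * ε ^ (n + 2) * T := by
        gcongr
    _ = _ := by ring

theorem clusterBound_nonneg (hreg : Regime d K ε κ c₂) (hc₃ : 1 ≤ c₃) (C : Finset V) :
    0 ≤ clusterBound G ε κ c₂ c₃ C := by
  have := hreg.eps_pos
  have := hreg.kappa_pos
  have := hreg.one_le_c
  unfold clusterBound
  positivity

/-- The bound for a rooted union `A` of clusters together with a family `F` of clusters that are not
yet rooted. For each of the latter in turn, a leaf `x` is examined: if no neighbour of `x` is minus,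
then `x` is minus by noise and is removed, otherwise the cluster is rooted at a minus vertex. -/
theorem pending_bound (hG : G.IsTree) (hpos : ∀ v, 0 < G.degree v) (hdeg : ∀ v, G.degree v ≤ d)
    {g : ℝ} (hg : g = 3 / 2 * K ^ (10 + 2 * d ^ 2 + 2 * d)) (hκ : κ = 2 * (1 + d) * g * ε)
    (hreg : Regime d K ε κ (K ^ 6)) {p : Finset V → ℝ} (hp : ∀ U, 0 ≤ p U) {E : Finset V}
    (hfam : FamilyBound G ε κ (K ^ 6) (K ^ 2) p E) (o : V) (n : ℕ) :
    ∀ (A R O : Finset V) (π : V → V) (rk : V → ℕ) (F : Finset (Finset V)),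
      IsRooted G o A R O π rk → IsFamily G F → (∀ C ∈ F, Disjoint (nbhd G A) (nbhd G C)) →
      nbhd G (A ∪ F.biUnion id) ⊆ E → ∑ C ∈ F, C.card = n →
      minusSum G p E ε (A ∪ F.biUnion id) R O ≤ ε ^ A.card *
        ((K ^ 6) ^ excess G 2 (nbhd G A) A * (K ^ 2) ^ branchExcess G A) * (ε * g) ^ R.card *
        ∏ C ∈ F, clusterBound G ε κ (K ^ 6) (K ^ 2) C := by
  have hε := hreg.eps_pos
  have hε1 := hreg.eps_le_one
  have hK := hreg.one_le_K
  have hK0 : 0 < K := by linarith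
  have hK2 : 1 ≤ K ^ 2 := one_le_pow₀ hK
  have hK6 : 1 ≤ K ^ 6 := one_le_pow₀ hK
  have hg0 : 0 ≤ g := hg ▸ by positivity
  induction n using Nat.strong_induction_on with
  | _ n ih =>
    intro A R O π rk F hR hF hAF hE hn
    rcases F.eq_empty_or_nonempty with rfl | ⟨C, hC⟩
    · simp only [biUnion_empty, union_empty, prod_empty, mul_one] at hE ⊢
      rw [hg]
      exact hR.minusSum_le hG hreg hdeg hp hE hfam
    have hconn := hF.1 C hC
    have hdis := hAF C hC
    obtain ⟨x, hx, hleaf⟩ := hconn.exists_leaf hG hpos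
    obtain ⟨t, ht, htop⟩ := hconn.exists_top hG hpos o
    set F' := F.erase C with hF'
    have hF'sub : F' ⊆ F := erase_subset _ _
    have hCF' : C ∉ F' := notMem_erase C F
    have hinsert : insert C F' = F := insert_erase hC
    have hF'fam := hF.subset hF'sub
    have hdisF' : ∀ C' ∈ F', Disjoint (nbhd G C) (nbhd G C') := fun C' hC' =>
      hF.2 C hC C' (hF'sub hC') (ne_of_mem_erase hC').symm
    have hunion : A ∪ F.biUnion id = A ∪ C ∪ F'.biUnion id := by
      rw [← hinsert, biUnion_insert, id, union_assoc]
    have hcard : C.card + ∑ C' ∈ F', C'.card = n := by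
      rw [← hn, ← hinsert, sum_insert hCF']
    have hCpos : 0 < C.card := card_pos.2 ⟨x, hx⟩
    set P := ∏ C' ∈ F', clusterBound G ε κ (K ^ 6) (K ^ 2) C' with hP
    have hP0 : 0 ≤ P := prod_nonneg fun _ _ => clusterBound_nonneg hreg hK2 _
    set W := ε ^ A.card * ((K ^ 6) ^ excess G 2 (nbhd G A) A * (K ^ 2) ^ branchExcess G A) *
      (ε * g) ^ R.card with hW
    have hW0 : 0 ≤ W := by positivity
    set T := (K ^ 6) ^ excess G 2 (nbhd G C) C * (K ^ 2) ^ branchExcess G C with hT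
    -- the cluster `C` is rooted at `y`
    have hroot : ∀ y ∈ nbhd G C, ∀ O', O ⊆ O' → t ∈ insert y O' →
        minusSum G p E ε (A ∪ F.biUnion id) (insert y R) O' ≤
          W * P * (ε ^ C.card * T * (ε * g)) := by
      intro y hy O' hO htO
      have hyR : y ∉ R := fun h => disjoint_left.1 hdis (hR.root_mem h) hy
      have h1 := ih (∑ C' ∈ F', C'.card) (by omega) (A ∪ C) (insert y R) O' _ _ F'
        (hR.union hG hpos hconn hdis hy hO fun z hz x hx h h' => htop z hz x hx h h' ▸ htO)
        hF'fam (fun C' hC' => by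
          rw [nbhd_union]
          exact disjoint_union_left.2 ⟨hAF C' (hF'sub hC'), hdisF' C' hC'⟩)
        (by rw [← hunion]; exact hE) rfl
      rw [← hunion] at h1
      refine h1.trans ?_
      rw [card_union_of_disjoint (disjoint_of_disjoint_nbhd hpos hdis),
        card_insert_of_notMem hyR, excess_union hdis, ← hP]
      calc _ ≤ ε ^ (A.card + C.card) *
            ((K ^ 6) ^ (excess G 2 (nbhd G A) A + excess G 2 (nbhd G C) C) *
            (K ^ 2) ^ (branchExcess G A + branchExcess G C)) * (ε * g) ^ (R.card + 1) * P := by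
            gcongr
            exact branchExcess_union_le hdis
        _ = _ := by rw [hW, hT]; ring
    have hxB : x ∈ A ∪ F.biUnion id :=
      mem_union_right _ (mem_biUnion.2 ⟨C, hC, hx⟩)
    have hsum : minusSum G p E ε (A ∪ F.biUnion id) (insert t R) O +
        ∑ y ∈ G.neighborFinset x, minusSum G p E ε (A ∪ F.biUnion id) (insert y R) (insert t O) ≤
        (1 + d) * (W * P * (ε ^ C.card * T * (ε * g))) := by
      have hX : 0 ≤ W * P * (ε ^ C.card * T * (ε * g)) := by positivity
      have h1 := hroot t ht O (Subset.refl _) (mem_insert_self _ _)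
      have h2 : ∑ y ∈ G.neighborFinset x,
          minusSum G p E ε (A ∪ F.biUnion id) (insert y R) (insert t O) ≤
          ∑ _y ∈ G.neighborFinset x, W * P * (ε ^ C.card * T * (ε * g)) :=
        sum_le_sum fun y hy => hroot y
          (mem_nbhd.2 ⟨x, hx, (G.mem_neighborFinset _ _).1 hy⟩) _ (subset_insert _ _)
          (mem_insert_of_mem (mem_insert_self _ _))
      rw [sum_const, SimpleGraph.card_neighborFinset_eq_degree, nsmul_eq_mul] at h2
      have h3 : (G.degree x : ℝ) ≤ d := by exact_mod_cast hdeg x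
      nlinarith
    refine (minusSum_le_split hp hε.le hε1 R O hxB t).trans ?_
    have hxA : x ∉ A := disjoint_right.1 (disjoint_of_disjoint_nbhd hpos hdis) hx
    have hxF' : x ∉ F'.biUnion id := by
      intro h
      obtain ⟨C', hC', hxC'⟩ := mem_biUnion.1 h
      exact disjoint_left.1 (disjoint_of_disjoint_nbhd hpos (hdisF' C' hC')) hx hxC'
    have herase : (A ∪ F.biUnion id).erase x = A ∪ (C.erase x ∪ F'.biUnion id) := by
      rw [hunion, union_assoc, erase_union_distrib, erase_union_distrib, erase_eq_of_notMem hxA,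
        erase_eq_of_notMem hxF']
    have hprodF : ∏ C' ∈ F, clusterBound G ε κ (K ^ 6) (K ^ 2) C' =
        clusterBound G ε κ (K ^ 6) (K ^ 2) C * P := by rw [← hinsert, prod_insert hCF']
    have hE' : nbhd G (A ∪ (C.erase x ∪ F'.biUnion id)) ⊆ E := by
      rw [← herase]
      exact (nbhd_mono (erase_subset _ _)).trans hE
    have hT1 : 1 ≤ T := one_le_mul_of_one_le_of_one_le (one_le_pow₀ hK6) (one_le_pow₀ hK2)
    -- the remaining part of `C` stays pending
    have hrest : ∃ (k : ℕ) (T' : ℝ), C.card = k + 1 ∧ T' ≤ T ∧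
        minusSum G p E ε ((A ∪ F.biUnion id).erase x) R O ≤
          W * P * ((ε / 2) ^ k + 2 * (1 + d) * g * ε * ε ^ k * T') := by
      rw [herase]
      rcases hleaf with hleaf | hleaf
      · refine ⟨0, 0, by rw [hleaf, card_singleton], by linarith, ?_⟩
        have he : C.erase x = ∅ := by rw [hleaf, erase_singleton]
        rw [he, empty_union] at hE' ⊢
        have h1 := ih (∑ C' ∈ F', C'.card) (by omega) A R O π rk F' hR hF'fam
          (fun C' hC' => hAF C' (hF'sub hC')) hE' rfl
        simpa using h1
      · set C₁ := C.erase x with hC₁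
        have hC₁C : C₁ ⊆ C := erase_subset _ _
        have hC₁card : C.card = C₁.card + 1 := (card_erase_add_one hx).symm
        have hdis₁ : ∀ C' ∈ F', Disjoint (nbhd G C₁) (nbhd G C') := fun C' hC' =>
          (hdisF' C' hC').mono_left (nbhd_mono hC₁C)
        have hC₁F' : C₁ ∉ F' := by
          intro h
          have := disjoint_of_disjoint_nbhd hpos (hdis₁ C₁ h)
          rw [disjoint_self_iff_empty] at this
          exact hleaf.1.ne_empty this
        refine ⟨C₁.card, (K ^ 6) ^ excess G 2 (nbhd G C₁) C₁ * (K ^ 2) ^ branchExcess G C₁,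
          hC₁card, ?_, ?_⟩
        · rw [hT]
          gcongr
          · exact excess_mono 2 (nbhd_mono hC₁C) hC₁C
          · exact branchExcess_mono hC₁C
        · have h1 := ih (C₁.card + ∑ C' ∈ F', C'.card) (by omega) A R O π rk (insert C₁ F') hR
            ⟨?_, ?_⟩ ?_ ?_ (by rw [sum_insert hC₁F'])
          · rw [biUnion_insert, id, prod_insert hC₁F', ← hP] at h1
            refine h1.trans (le_of_eq ?_)
            rw [clusterBound, hκ]
            ring
          · intro C' hC'
            rcases mem_insert.1 hC' with rfl | hC'
            exacts [hleaf, hF'fam.1 _ hC']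
          · intro D h1 D' h2 hne
            rcases mem_insert.1 h1 with h1 | h1 <;> rcases mem_insert.1 h2 with h2 | h2
            · exact absurd (h1.trans h2.symm) hne
            · exact h1 ▸ hdis₁ _ h2
            · exact h2 ▸ (hdis₁ _ h1).symm
            · exact hF'fam.2 _ h1 _ h2 hne
          · intro C' hC'
            rcases mem_insert.1 hC' with rfl | hC'
            exacts [hdis.mono_right (nbhd_mono hC₁C), hAF C' (hF'sub hC')]
          · rwa [biUnion_insert, id]
    obtain ⟨k, T', hk, hT', hrest⟩ := hrest
    have hstep := clusterBound_step (d := d) hε (n := k) hg0 hT'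
    rw [hprodF, clusterBound, ← hT, hk, hκ]
    rw [hk] at hsum
    calc _ ≤ (1 + d) * (W * P * (ε ^ (k + 1) * T * (ε * g))) +
          ε / 2 * (W * P * ((ε / 2) ^ k + 2 * (1 + d) * g * ε * ε ^ k * T')) := by gcongr
      _ = W * P * ((1 + d) * (ε ^ (k + 1) * T * (ε * g)) +
          ε / 2 * ((ε / 2) ^ k + 2 * (1 + d) * g * ε * ε ^ k * T')) := by ring
      _ ≤ W * P * ((ε / 2) ^ (k + 1) + 2 * (1 + d) * g * ε * ε ^ (k + 1) * T) := by gcongr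
      _ = _ := by ring

end Rooting

/-! ### Induction on time -/

section MinusProcess

open MeasureTheory ProbabilityTheory

variable {V : Type*} [DecidableEq V] {G : SimpleGraph V} [G.LocallyFinite] {ε : ℝ}

/-- The σ-algebra generated by the updates up to time `t`. -/
@[reducible] def pastSigma (V : Type*) (t : ℕ) : MeasurableSpace (ℕ × V → Update) :=
  ⨆ i ∈ {i : ℕ × V | i.1 ≤ t}, MeasurableSpace.comap (fun ω => ω i) inferInstance

theorem pastSigma_le (t : ℕ) : pastSigma V t ≤ MeasurableSpace.pi :=
  iSup₂_le fun i _ => (measurable_pi_apply i).comap_le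

theorem pastSigma_mono {t t' : ℕ} (h : t ≤ t') : pastSigma V t ≤ pastSigma V t' :=
  biSup_mono fun _ hi => le_trans hi h

theorem measurableSet_update {t : ℕ} {i : ℕ × V} (hi : i.1 ≤ t) (S : Set Update) :
    MeasurableSet[pastSigma V t] {ω | ω i ∈ S} := by
  have h : MeasurableSpace.comap (fun ω : ℕ × V → Update => ω i) inferInstance ≤ pastSigma V t :=
    le_biSup (fun i : ℕ × V => MeasurableSpace.comap (fun ω : ℕ × V → Update => ω i) inferInstance)
      hi
  exact h _ ⟨S, trivial, rfl⟩

/-- The vote condition, stated with `encard` in `spin`, in terms of the finite set `U` of minus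
vertices. -/
theorem two_le_encard_iff {U : Finset V} {x : V} {P : V → Prop}
    (hU : ∀ y, G.Adj x y → (P y ↔ y ∈ U)) :
    2 ≤ {y ∈ G.neighborSet x | P y}.encard ↔ 2 ≤ degIn G U x := by
  have : {y ∈ G.neighborSet x | P y} = ((G.neighborFinset x ∩ U : Finset V) : Set V) := by
    ext y
    simp only [Set.mem_ofPred_eq, SimpleGraph.mem_neighborSet, coe_inter, Set.mem_inter_iff,
      mem_coe, SimpleGraph.mem_neighborFinset]
    exact and_congr_right fun h => hU y h
  rw [this, Set.encard_coe_eq_coe_finsetCard]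
  exact Nat.ofNat_le_cast

theorem spin_succ (ω : ℕ × V → Update) (t : ℕ) (x : V) (s : ℤˣ) : spin G ω (t + 1) x = s ↔
    (ω (t + 1, x) = Update.vote ∧
      ((2 ≤ {y ∈ G.neighborSet x | spin G ω t y = -1}.encard ∧ s = -1) ∨
        (¬ 2 ≤ {y ∈ G.neighborSet x | spin G ω t y = -1}.encard ∧ s = 1))) ∨
      ω (t + 1, x) = Update.noise s := by
  simp only [spin]
  cases h : ω (t + 1, x) with
  | vote =>
    dsimp only
    split_ifs with h2
    all_goals simp only [h2, true_and, false_and, not_true, not_false_eq_true, or_false, false_or,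
      eq_comm]
  | noise s' => simp

/-- The spins at time `t` are determined by the updates up to time `t`. -/
theorem measurableSet_spin (t : ℕ) :
    ∀ (x : V) (s : ℤˣ), MeasurableSet[pastSigma V t] {ω | spin G ω t x = s} := by
  induction t with
  | zero => intro x s; simp only [spin]; exact MeasurableSet.const _
  | succ t ih =>
    intro x s
    have hcount : MeasurableSet[pastSigma V (t + 1)]
        {ω : ℕ × V → Update | 2 ≤ {y ∈ G.neighborSet x | spin G ω t y = -1}.encard} := by
      have e : {ω : ℕ × V → Update | 2 ≤ {y ∈ G.neighborSet x | spin G ω t y = -1}.encard} =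
          ⋃ y ∈ G.neighborFinset x, ⋃ z ∈ (G.neighborFinset x).erase y,
            ({ω | spin G ω t y = -1} ∩ {ω | spin G ω t z = -1}) := by
        ext ω
        have h2 : (2 : ℕ∞) ≤ {y ∈ G.neighborSet x | spin G ω t y = -1}.encard ↔
            1 < {y ∈ G.neighborSet x | spin G ω t y = -1}.encard := by
          rw [← ENat.add_one_le_iff (by simp)]; norm_num [one_add_one_eq_two]
        rw [Set.mem_ofPred_eq, h2, Set.one_lt_encard_iff]
        simp only [Set.mem_ofPred_eq, SimpleGraph.mem_neighborSet, Set.mem_iUnion, Set.mem_inter_iff,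
          mem_erase, SimpleGraph.mem_neighborFinset, exists_prop]
        constructor
        · rintro ⟨a, b, ⟨ha, ha'⟩, ⟨hb, hb'⟩, hne⟩
          exact ⟨a, ha, b, ⟨hne.symm, hb⟩, ha', hb'⟩
        · rintro ⟨a, ha, b, ⟨hne, hb⟩, ha', hb'⟩
          exact ⟨a, b, ⟨ha, ha'⟩, ⟨hb, hb'⟩, hne.symm⟩
      rw [e]
      have ih' : ∀ y, MeasurableSet[pastSigma V (t + 1)] {ω | spin G ω t y = -1} := fun y =>
        pastSigma_mono t.le_succ _ (ih y (-1))
      exact Finset.measurableSet_biUnion _ fun y _ => Finset.measurableSet_biUnion _ fun z _ =>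
        (ih' y).inter (ih' z)
    have hv : MeasurableSet[pastSigma V (t + 1)] {ω : ℕ × V → Update | ω (t + 1, x) = Update.vote} :=
      measurableSet_update (i := (t + 1, x)) le_rfl {Update.vote}
    have hn : MeasurableSet[pastSigma V (t + 1)]
        {ω : ℕ × V → Update | ω (t + 1, x) = Update.noise s} :=
      measurableSet_update (i := (t + 1, x)) le_rfl {Update.noise s}
    simp only [spin_succ]
    exact (hv.inter ((hcount.inter (MeasurableSet.const _)).union
      (hcount.compl.inter (MeasurableSet.const _)))).union hn

variable (G) in
/-- The event that the set of minus vertices of `E` at time `t` is `U`. -/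
def stateEvent (t : ℕ) (E U : Finset V) : Set (ℕ × V → Update) :=
  {ω | ∀ y ∈ E, (spin G ω t y = -1 ↔ y ∈ U)}

theorem measurableSet_stateEvent (t : ℕ) (E U : Finset V) :
    MeasurableSet[pastSigma V t] (stateEvent G t E U) := by
  have : stateEvent G t E U = ⋂ y ∈ E, {ω | spin G ω t y = -1 ↔ y ∈ U} := by
    ext ω; simp [stateEvent]
  rw [this]
  refine Finset.measurableSet_biInter _ fun y _ => ?_
  by_cases h : y ∈ U
  · simpa only [h, iff_true] using measurableSet_spin t y (-1)
  · simp only [h, iff_false]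
    exact (measurableSet_spin t y (-1)).compl

theorem mem_stateEvent_filter (t : ℕ) (E : Finset V) (ω : ℕ × V → Update)
    [DecidablePred fun y => spin G ω t y = -1] :
    ω ∈ stateEvent G t E {y ∈ E | spin G ω t y = -1} := by
  intro y hy
  simp [hy]

theorem eq_of_mem_stateEvent {t : ℕ} {E U U' : Finset V} {ω : ℕ × V → Update} (hU : U ⊆ E)
    (hU' : U' ⊆ E) (h : ω ∈ stateEvent G t E U) (h' : ω ∈ stateEvent G t E U') : U = U' := by
  ext y
  exact ⟨fun hy => (h' y (hU hy)).1 ((h y (hU hy)).2 hy),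
    fun hy => (h y (hU' hy)).1 ((h' y (hU' hy)).2 hy)⟩

variable (G) in
/-- The probability that the set of minus vertices of `E` at time `t` is `U`. -/
noncomputable def stateProb (ε : ℝ) (t : ℕ) (E U : Finset V) : ℝ :=
  (processLaw V ε).real (stateEvent G t E U)

theorem minusSum_stateProb_le (h0 : 0 ≤ ε) (h1 : ε ≤ 1) (t : ℕ) (E D : Finset V) :
    minusSum G (stateProb G ε t E) E ε ∅ D ∅ ≤ probMinus G ε t D := by
  have : IsProbabilityMeasure (updateLaw ε) :=
    isProbabilityMeasure_updateLaw h0 h1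
  have : IsProbabilityMeasure (processLaw V ε) := by unfold processLaw; infer_instance
  simp only [minusSum, prod_empty, mul_one, stateProb]
  rw [← measureReal_biUnion_finset]
  · refine measureReal_mono ?_
    intro ω hω x hx
    simp only [Set.mem_iUnion, mem_filter, mem_powerset] at hω
    obtain ⟨U, ⟨hUE, hDU, -⟩, hω⟩ := hω
    exact (hω x (hUE (hDU hx))).2 (hDU hx)
  · intro U hU U' hU' hne
    simp only [coe_filter, mem_powerset, Set.mem_ofPred_eq] at hU hU'
    exact Set.disjoint_left.2 fun ω h h' => hne (eq_of_mem_stateEvent hU.1 hU'.1 h h')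
  · exact fun U _ => pastSigma_le t _ (measurableSet_stateEvent t E U)

/-- The updates that make `x` minus if `U` is the set of minus vertices at the previous time. -/
def minusUpdates (G : SimpleGraph V) [G.LocallyFinite] (U : Finset V) (x : V) : Set Update :=
  {u | u = Update.noise (-1) ∨ (u = Update.vote ∧ 2 ≤ degIn G U x)}

theorem updateLaw_minusUpdates (h0 : 0 ≤ ε) (h1 : ε ≤ 1) (U : Finset V) (x : V) :
    (updateLaw ε).real (minusUpdates G U x) = minusProb G ε U x := by
  rw [measureReal_def, updateLaw]
  have h3 : (1 : ℤˣ) ≠ -1 := by decide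
  by_cases h : 2 ≤ degIn G U x
  · simp only [Measure.coe_add, Measure.coe_smul, Pi.add_apply, Pi.smul_apply,
      Measure.dirac_apply, minusUpdates, smul_eq_mul, minusProb, h]
    simp [Set.indicator, h3]
    rw [← ENNReal.ofReal_add (by linarith) (by linarith), ENNReal.toReal_ofReal (by linarith)]
    ring
  · simp only [Measure.coe_add, Measure.coe_smul, Pi.add_apply, Pi.smul_apply,
      Measure.dirac_apply, minusUpdates, smul_eq_mul, minusProb, h]
    simp [Set.indicator, h3]
    linarith

/-- The updates at time `t + 1` are independent of the state at time `t`. -/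
theorem processLaw_inter (h0 : 0 ≤ ε) (h1 : ε ≤ 1) {t : ℕ} {B : Set (ℕ × V → Update)}
    (hB : MeasurableSet[pastSigma V t] B) (A : Finset V) (S : V → Set Update) :
    (processLaw V ε).real (B ∩ {ω | ∀ x ∈ A, ω (t + 1, x) ∈ S x}) =
      (processLaw V ε).real B * ∏ x ∈ A, (updateLaw ε).real (S x) := by
  have : IsProbabilityMeasure (updateLaw ε) :=
    isProbabilityMeasure_updateLaw h0 h1
  have hind : iIndepFun (fun (i : ℕ × V) (ω : ℕ × V → Update) => ω i) (processLaw V ε) :=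
    iIndepFun_infinitePi (P := fun _ : ℕ × V => updateLaw ε) (X := fun _ (u : Update) => u)
      fun _ => measurable_id
  have hdisj : Disjoint {i : ℕ × V | i.1 ≤ t} {i : ℕ × V | i.1 = t + 1} :=
    Set.disjoint_left.2 fun i hi hi' => by
      simp only [Set.mem_ofPred_eq] at hi hi'
      omega
  have hindep := indep_iSup_of_disjoint (fun i => (measurable_pi_apply i).comap_le) hind.iIndep hdisj
  have hset : {ω : ℕ × V → Update | ∀ x ∈ A, ω (t + 1, x) ∈ S x} =
      ((A.image fun x => (t + 1, x) : Finset (ℕ × V)) : Set (ℕ × V)).pi fun i => S i.2 := by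
    ext ω
    simp [Set.mem_pi]
  have hmeas : MeasurableSet[⨆ i ∈ {i : ℕ × V | i.1 = t + 1},
      MeasurableSpace.comap (fun ω : ℕ × V → Update => ω i) inferInstance]
      {ω : ℕ × V → Update | ∀ x ∈ A, ω (t + 1, x) ∈ S x} := by
    have : {ω : ℕ × V → Update | ∀ x ∈ A, ω (t + 1, x) ∈ S x} =
        ⋂ x ∈ A, {ω | ω (t + 1, x) ∈ S x} := by ext ω; simp
    rw [this]
    refine Finset.measurableSet_biInter _ fun x _ => ?_
    have hle := le_biSup (fun i : ℕ × V => MeasurableSpace.comap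
      (fun ω : ℕ × V → Update => ω i) inferInstance)
      (show (t + 1, x) ∈ {i : ℕ × V | i.1 = t + 1} from rfl)
    exact hle _ ⟨S x, trivial, rfl⟩
  rw [measureReal_def, (Indep_iff _ _ _).1 hindep _ _ hB hmeas, ENNReal.toReal_mul,
    ← measureReal_def, hset, processLaw, Measure.infinitePi_pi _ fun _ _ => MeasurableSpace.measurableSet_top,
    ENNReal.toReal_prod, prod_image fun x _ y _ h => (Prod.mk.inj h).2]
  rfl

theorem probMinus_succ_le (h0 : 0 ≤ ε) (h1 : ε ≤ 1) (t : ℕ) {A E : Finset V}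
    (hE : nbhd G A ⊆ E) :
    probMinus G ε (t + 1) A ≤ minusSum G (stateProb G ε t E) E ε A ∅ ∅ := by
  classical
  have : IsProbabilityMeasure (updateLaw ε) :=
    isProbabilityMeasure_updateLaw h0 h1
  have : IsProbabilityMeasure (processLaw V ε) := by unfold processLaw; infer_instance
  have hsub : {ω : ℕ × V → Update | ∀ x ∈ (A : Set V), spin G ω (t + 1) x = -1} ⊆
      ⋃ U ∈ E.powerset, (stateEvent G t E U ∩
        {ω | ∀ x ∈ A, ω (t + 1, x) ∈ minusUpdates G U x}) := by
    intro ω hω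
    simp only [Set.mem_iUnion]
    refine ⟨{y ∈ E | spin G ω t y = -1}, mem_powerset.2 (filter_subset _ _),
      mem_stateEvent_filter t E ω, fun x hx => ?_⟩
    have h := (spin_succ ω t x (-1)).1 (hω x hx)
    have h3 : (-1 : ℤˣ) ≠ 1 := by decide
    rw [two_le_encard_iff (U := {y ∈ E | spin G ω t y = -1}) fun y hy => by
      simp [hE (mem_nbhd.2 ⟨x, hx, hy⟩)]] at h
    rcases h with ⟨hv, h | h⟩ | h
    · exact Or.inr ⟨hv, h.1⟩
    · exact absurd h.2 h3
    · exact Or.inl h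
  refine (measureReal_mono hsub (measure_ne_top _ _)).trans ((measureReal_biUnion_finset_le _ _).trans ?_)
  rw [minusSum, filter_true_of_mem fun U _ => ⟨empty_subset U, disjoint_empty_left U⟩]
  refine sum_le_sum fun U _ => ?_
  rw [processLaw_inter h0 h1 (measurableSet_stateEvent t E U), stateProb,
    prod_congr rfl fun x _ => updateLaw_minusUpdates h0 h1 U x]

/-- The bound for all families of clusters, at all times. -/
theorem probMinus_family_le {d : ℕ} {K κ g : ℝ} (hG : G.IsTree) (hpos : ∀ v, 0 < G.degree v)
    (hdeg : ∀ v, G.degree v ≤ d) (hg : g = 3 / 2 * K ^ (10 + 2 * d ^ 2 + 2 * d))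
    (hκ : κ = 2 * (1 + d) * g * ε) (hreg : Regime d K ε κ (K ^ 6)) (o : V) (t : ℕ) :
    ∀ F : Finset (Finset V), IsFamily G F →
      probMinus G ε t (F.biUnion id : Finset V) ≤
        ∏ C ∈ F, clusterBound G ε κ (K ^ 6) (K ^ 2) C := by
  have h0 := hreg.eps_pos.le
  have h1 := hreg.eps_le_one
  have : IsProbabilityMeasure (updateLaw ε) :=
    isProbabilityMeasure_updateLaw h0 h1
  have : IsProbabilityMeasure (processLaw V ε) := by unfold processLaw; infer_instance
  induction t with
  | zero =>
    intro F hF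
    rcases F.eq_empty_or_nonempty with rfl | ⟨C, hC⟩
    · rw [prod_empty]
      exact measureReal_le_one
    · obtain ⟨z, hz⟩ := (hF.1 C hC).1
      have hempty : {ω : ℕ × V → Update | ∀ x ∈ ((F.biUnion id : Finset V) : Set V),
          spin G ω 0 x = -1} = ∅ := by
        refine Set.eq_empty_of_forall_notMem fun ω hω => ?_
        have h3 : (1 : ℤˣ) ≠ -1 := by decide
        exact h3 (hω z (mem_coe.2 (mem_biUnion.2 ⟨C, hC, hz⟩)))
      rw [probMinus, hempty, measureReal_empty]
      exact prod_nonneg fun _ _ =>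
        clusterBound_nonneg hreg (one_le_pow₀ hreg.one_le_K) _
  | succ t ih =>
    intro F hF
    set E := nbhd G (F.biUnion id) with hE
    refine (probMinus_succ_le h0 h1 t (Subset.refl _)).trans ?_
    have h := pending_bound hG hpos hdeg hg hκ hreg (p := stateProb G ε t E) (E := E)
      (fun _ => measureReal_nonneg)
      (fun F' hF' _ => (minusSum_stateProb_le h0 h1 t E _).trans (ih F' hF')) o _ ∅ ∅ ∅
      (fun v => v) (fun _ => 0) F (isRooted_empty o _ _) hF (by simp [nbhd]) (by simp [hE]) rfl
    have h2 : ε ^ (∅ : Finset V).card * ((K ^ 6) ^ excess G 2 (nbhd G ∅) ∅ *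
        (K ^ 2) ^ branchExcess G ∅) * (ε * g) ^ (∅ : Finset V).card = 1 := by
      simp [excess, branchExcess, nbhd]
    rwa [h2, one_mul, empty_union] at h

end MinusProcess

/-! ### Comparison with the trifurcation counts -/

section Trifurcations

variable {V : Type*} [DecidableEq V] {G : SimpleGraph V} [G.LocallyFinite] {d : ℕ}

/-- Grouping the vertices of `S` by the value of `f`. -/
theorem sum_sub_two_le (S : Finset V) (f : V → ℕ) (hf : ∀ x ∈ S, f x ≤ d) {Z : ℕ → Set V}
    (hfin : ∀ p, 3 ≤ p → (Z p).Finite) (hZ : ∀ x ∈ S, x ∈ Z (f x)) :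
    ∑ x ∈ S, (f x - 2) ≤ ∑ p ∈ Icc 3 d, (p - 2) * (Z p).ncard := by
  have h1 : ∑ x ∈ S, (f x - 2) = ∑ x ∈ S with 3 ≤ f x, (f x - 2) := by
    rw [sum_filter]
    refine sum_congr rfl fun x _ => ?_
    split_ifs with h <;> omega
  rw [h1, ← sum_fiberwise_of_maps_to (t := Icc 3 d) (g := f) fun x hx => by
    rw [mem_filter] at hx
    exact mem_Icc.2 ⟨hx.2, hf x hx.1⟩]
  refine sum_le_sum fun p hp => ?_
  rw [sum_congr rfl fun x hx => by rw [(mem_filter.1 hx).2], sum_const, smul_eq_mul, mul_comm]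
  refine Nat.mul_le_mul_left _ ?_
  rw [← Set.ncard_coe_finset]
  refine Set.ncard_le_ncard (fun x hx => ?_) (hfin p (mem_Icc.1 hp).1)
  rw [mem_coe, mem_filter, mem_filter] at hx
  exact hx.2 ▸ hZ x hx.1.1

theorem excess_le_STri (hdeg : ∀ v, G.degree v ≤ d) (C : Finset V) :
    excess G 2 (nbhd G C) C ≤ STri G d C := by
  have key : ∀ x, (G.neighborSet x ∩ C).encard = (degIn G C x : ℕ∞) := by
    intro x
    rw [degIn, ← Set.encard_coe_eq_coe_finsetCard, coe_inter, SimpleGraph.coe_neighborFinset]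
  refine sum_sub_two_le _ _ (fun x _ => (degIn_le_degree C x).trans (hdeg x)) ?_
    fun x _ => key x
  intro p hp
  refine (nbhd G C).finite_toSet.subset fun x hx => ?_
  have hx' : (G.neighborSet x ∩ C).encard = p := hx
  rw [key, Nat.cast_inj] at hx'
  by_contra h
  rw [degIn_eq_zero_of_notMem h] at hx'
  omega

theorem branchExcess_le_DTri (hdeg : ∀ v, G.degree v ≤ d) (C : Finset V) :
    branchExcess G C ≤ DTri G d C := by
  refine sum_sub_two_le _ _ (fun x _ => (branchDeg_le_degree C x).trans (hdeg x)) ?_ ?_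
  · intro p hp
    refine (nbhd G (nbhd G C)).finite_toSet.subset ?_
    rintro x ⟨Y, hY, hcard, hYC⟩
    obtain ⟨y, hy⟩ := card_pos.1 (by omega : 0 < Y.card)
    obtain ⟨z, hz, hzC, -⟩ := hYC y hy
    rw [SimpleGraph.mem_neighborSet] at hz
    have hxy := hY hy
    rw [SimpleGraph.mem_neighborSet] at hxy
    exact mem_nbhd.2 ⟨y, mem_nbhd.2 ⟨z, hzC, hz.symm⟩, hxy.symm⟩
  · intro x hx
    refine ⟨{y ∈ G.neighborFinset x | 2 ≤ degIn G C y}, ?_, rfl, ?_⟩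
    · intro y hy
      rw [mem_coe, mem_filter, SimpleGraph.mem_neighborFinset] at hy
      exact hy.1
    · intro y hy
      obtain ⟨z, hz, hne⟩ := exists_mem_ne
        (show 1 < (G.neighborFinset y ∩ C).card from (mem_filter.1 hy).2) x
      rw [mem_inter, SimpleGraph.mem_neighborFinset] at hz
      exact ⟨z, hz.1, hz.2, hne⟩

end Trifurcations

/-! ### Odd clusters -/

section OddClusters

variable {V : Type*} [DecidableEq V] {G : SimpleGraph V} [G.LocallyFinite] {o : V}

theorem exists_common_neighbor_of_dist_eq_two (hG : G.Connected) {x y : V}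
    (h : G.dist x y = 2) : ∃ v, G.Adj x v ∧ G.Adj y v := by
  obtain ⟨p, hp⟩ := hG.exists_walk_length_eq_dist x y
  rw [h] at hp
  refine ⟨p.snd, p.adj_snd (fun hn => by simp [SimpleGraph.Walk.length_eq_zero_iff.2 hn] at hp), ?_⟩
  have := p.adj_getVert_succ (i := 1) (by omega)
  rw [show 1 + 1 = p.length from hp.symm, p.getVert_length] at this
  exact this.symm

theorem IsOddCluster.isConn (hG : G.IsTree) {C : Finset V} (h : IsOddCluster G o C) :
    IsConn G C := by
  obtain ⟨-, hconn⟩ := h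
  obtain ⟨⟨z₀, hz₀⟩⟩ := hconn.nonempty
  refine ⟨⟨z₀, hz₀⟩, fun S hS hSne hSc => hS.antisymm fun c hc => ?_⟩
  obtain ⟨s, hs⟩ := hSne
  have hreach := hconn.preconnected ⟨s, hS hs⟩ ⟨c, hc⟩
  rw [SimpleGraph.reachable_iff_reflTransGen] at hreach
  have key : ∀ w : (C : Set V), Relation.ReflTransGen
      ((doubleNeighborGraph G).induce (C : Set V)).Adj ⟨s, hS hs⟩ w → (w : V) ∈ S := by
    intro w hw
    induction hw with
    | refl => exact hs
    | @tail a b _ hab ih =>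
      obtain ⟨v, hav, hbv⟩ := exists_common_neighbor_of_dist_eq_two hG.1
        (show G.dist (a : V) b = 2 from hab)
      exact hSc a ih b b.2 v hav hbv
  exact key _ hreach

/-- Disjoint odd sets that are not adjacent have no common neighbour. -/
theorem disjoint_nbhd_of_not_adjacentSets (hG : G.IsTree) {A B : Finset V}
    (hA : ∀ x ∈ A, IsOddVertex G o x) (hB : ∀ x ∈ B, IsOddVertex G o x) (hdis : Disjoint A B)
    (h : ¬ AdjacentSets G (A : Set V) (B : Set V)) : Disjoint (nbhd G A) (nbhd G B) := by
  refine disjoint_left.2 fun v hv hv' => h ?_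
  obtain ⟨x, hx, hxv⟩ := mem_nbhd.1 hv
  obtain ⟨y, hy, hyv⟩ := mem_nbhd.1 hv'
  have hmem : G.dist x y ∈ {n | ∃ x ∈ (A : Set V), ∃ y ∈ (B : Set V), G.dist x y = n} :=
    ⟨x, hx, y, hy, rfl⟩
  have hle : G.dist x y ≤ 2 := by
    have := hG.1.dist_triangle (u := x) (v := v) (w := y)
    rw [SimpleGraph.dist_eq_one_iff_adj.2 hxv, SimpleGraph.dist_eq_one_iff_adj.2 hyv.symm] at this
    exact this
  refine ((Nat.sInf_le hmem).trans hle).antisymm ?_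
  obtain ⟨a, ha, b, hb, hab⟩ := Nat.sInf_mem ⟨_, hmem⟩
  change 2 ≤ sInf {n | ∃ x ∈ (A : Set V), ∃ y ∈ (B : Set V), G.dist x y = n}
  rw [← hab]
  have h0 : G.dist a b ≠ 0 := fun h => by
    rw [(hG.1.dist_eq_zero_iff).1 h] at ha
    exact disjoint_left.1 hdis ha hb
  have h1 : G.dist a b ≠ 1 := fun h => by
    have h2 := dist_parent_or_child hG o (SimpleGraph.dist_eq_one_iff_adj.1 h)
    obtain ⟨m, hm⟩ := hA a ha
    obtain ⟨n, hn⟩ := hB b hb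
    omega
  omega

end OddClusters

end MinusBiasedVote

open Finset MinusBiasedVote in
theorem theorem2p1 (d : ℕ) (hd : 3 ≤ d) :
    ∃ c₁ c₂ c₃ ε₀ : ℝ, 1 < c₁ ∧ 1 < c₂ ∧ 1 < c₃ ∧ 0 < ε₀ ∧
      ∀ (V : Type*) (G : SimpleGraph V) [G.LocallyFinite],
        G.IsTree → G.IsRegularOfDegree d →
      ∀ (o : V) (ε : ℝ), 0 < ε → ε < 1 → ε < ε₀ →
      ∀ (t k : ℕ), 1 ≤ k → ∀ (A : Finset V) (C : Fin k → Finset V),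
        (A : Set V) = ⋃ i, (C i : Set V) →
        (∀ i, MinusBiasedVote.IsOddCluster G o (C i : Set V)) →
        (∀ i j, i ≠ j → Disjoint (C i) (C j)) →
        (∀ i j, i ≠ j → ¬ MinusBiasedVote.AdjacentSets G (C i : Set V) (C j : Set V)) →
        MinusBiasedVote.probMinus G ε t (A : Set V) ≤
          ∏ i, ((ε / 2) ^ (C i).card +
            c₁ * ε ^ ((C i).card + 1) *
              c₂ ^ MinusBiasedVote.STri G d (C i : Set V) *
              c₃ ^ MinusBiasedVote.DTri G d (C i : Set V)) := by
  classical
  have hd' : (3 : ℝ) ≤ d := by exact_mod_cast hd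
  obtain ⟨K, hK⟩ : ∃ K : ℝ, K = 8 * d := ⟨_, rfl⟩
  obtain ⟨g, hg⟩ : ∃ g : ℝ, g = 3 / 2 * K ^ (10 + 2 * d ^ 2 + 2 * d) := ⟨_, rfl⟩
  obtain ⟨c₁, hc₁⟩ : ∃ c₁ : ℝ, c₁ = 2 * (1 + d) * g := ⟨_, rfl⟩
  have hK1 : 1 < K := by linarith
  have hKg : K ^ 6 ≤ g := by
    have : K ^ 6 ≤ K ^ (10 + 2 * d ^ 2 + 2 * d) := pow_le_pow_right₀ hK1.le (by omega)
    have : 0 ≤ K ^ 6 := by positivity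
    linarith
  have hK6 : 1 < K ^ 6 := one_lt_pow₀ hK1 (by norm_num)
  have hK2 : 1 < K ^ 2 := one_lt_pow₀ hK1 (by norm_num)
  -- `c₁` exceeds `K ^ 6`, so that smallness of `c₁ ε` is the only condition on `ε`
  have hgc : g ≤ c₁ := by nlinarith
  have hc₁1 : 1 < c₁ := by linarith
  refine ⟨c₁, K ^ 6, K ^ 2, 1 / (24 * d ^ 2 * c₁), hc₁1, hK6, hK2, by positivity, ?_⟩
  intro V G _ hG hreg o ε hε _ hεε₀ t k _ A C hA hodd hdis hnadj
  have hdeg : ∀ v, G.degree v = d := hreg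
  have hpos : ∀ v, 0 < G.degree v := fun v => by rw [hdeg]; omega
  have hsmall : 24 * (d : ℝ) ^ 2 * (c₁ * ε) ≤ 1 := by
    rw [lt_div_iff₀ (by positivity)] at hεε₀
    linarith
  have hd2 : 1 ≤ (d : ℝ) ^ 2 := by nlinarith
  have hc₁ε : 0 < c₁ * ε := by positivity
  have hεc : ε ≤ c₁ * ε := by nlinarith
  have hregime : Regime d K ε (c₁ * ε) (K ^ 6) := by
    refine ⟨by omega, hε, ?_, hc₁ε, hsmall, hK6.le, ?_, hK.ge⟩
    · nlinarith
    · have : K ^ 6 * ε ≤ c₁ * ε := by gcongr; linarith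
      nlinarith
  -- the clusters as a family
  have hconn : ∀ i, IsConn G (C i) := fun i => (hodd i).isConn hG
  have hdisj : ∀ i j, i ≠ j → Disjoint (nbhd G (C i)) (nbhd G (C j)) := fun i j hij =>
    disjoint_nbhd_of_not_adjacentSets hG (hodd i).1 (hodd j).1 (hdis i j hij) (hnadj i j hij)
  have hinj : Function.Injective C := by
    intro i j hij
    by_contra hne
    have := hdis i j hne
    rw [← hij, disjoint_self_iff_empty] at this
    exact (hconn i).1.ne_empty this
  have hF : IsFamily G (univ.image C) := by
    refine ⟨fun D hD => ?_, fun D hD D' hD' hne => ?_⟩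
    · obtain ⟨i, -, rfl⟩ := mem_image.1 hD
      exact hconn i
    · obtain ⟨i, -, rfl⟩ := mem_image.1 hD
      obtain ⟨j, -, rfl⟩ := mem_image.1 hD'
      exact hdisj i j fun h => hne (congrArg C h)
  have hAF : A = (univ.image C).biUnion id := by
    rw [← coe_inj, hA]
    ext z
    simp
  rw [hAF]
  refine (probMinus_family_le hG hpos (fun v => (hdeg v).le) hg (by rw [hc₁]) hregime o t _
    hF).trans ?_
  rw [prod_image fun i _ j _ h => hinj h]
  refine prod_le_prod (fun i _ => clusterBound_nonneg hregime hK2.le _) fun i _ => ?_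
  have he := excess_le_STri (fun v => (hdeg v).le) (C i)
  have hq := branchExcess_le_DTri (fun v => (hdeg v).le) (C i)
  calc clusterBound G ε (c₁ * ε) (K ^ 6) (K ^ 2) (C i) ≤ (ε / 2) ^ (C i).card +
        c₁ * ε * ε ^ (C i).card * ((K ^ 6) ^ STri G d (C i : Set V) *
          (K ^ 2) ^ DTri G d (C i : Set V)) := by
        unfold clusterBound
        gcongr
        · exact hK6.le
        · exact hK2.le
    _ = _ := by ring
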